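/- Let $(\Omega,\mathscr A,\mathbb P)$ be a probability space, let $\nu>0$ and $\rho>0$, and let $\mathcal M_\nu$ be a Poisson random measure on $\mathbb R$ with rate $\nu$, that is, a random measure such that $\mathcal M_\nu(B_1),\dots,\mathcal M_\nu(B_n)$ are independent for pairwise disjoint Borel sets $B_1,\dots,B_n$, and $\mathbb P(\mathcal M_\nu(B)=m)=e^{-\nu\lambda(B)}(\nu\lambda(B))^m/m!$ for every bounded Borel set $B\subset\mathbb R$ and every $m\in\mathbb N_0$, where $\lambda$ is the Lebesgue measure. Let $u:\mathbb R\to\mathbb R$ be a nonnegative, bounded, measurable function that is nonzero on some nonempty open set and has compact support $[-C^{\mathrm{left}},C^{\mathrm{right}}]$ with $C^{\mathrm{left}},C^{\mathrm{right}}>0$, and let $$V(\omega,x)=\int_{\mathbb R}u(x-y)\,\mathcal M_\nu^\omega(dy)$$ be the Poisson random potential (of fixed strength) with single-site potential $u$. For $N\in\mathbb N$ put $L_N=N/\rho$ and $\Lambda_N=(-L_N/2,L_N/2)$, and let $E_{N,V}^{1,\omega}\le E_{N,V}^{2,\omega}\le\cdots$ be the eigenvalues, repeated according to multiplicity, of the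 operator $-\frac{d^2}{dx^2}+V(\omega,\cdot)$ on $L^2(\Lambda_N)$ with Dirichlet boundary conditions; they are defined for $\mathbb P$-almost every $\omega$. For $0<\zeta_2<\zeta_1<1$ and an integer $j\ge2$ define, up to a null set, the event $$\Omega_{N,V}^{j,\zeta_1,\zeta_2}=\Big\{\omega:\ E_{N,V}^{j,\omega}-E_{N,V}^{1,\omega}\ge N^{-1+\zeta_1},\quad E_{N,V}^{1,\omega}\le\Big[(1+\zeta_2)\frac{\nu\pi}{\ln(L_N)}\Big]^2\Big\}.$$ **Theorem 5.4.** (1) For every $\varepsilon>0$ there is an integer $j\ge2$ such that for all $0<\zeta_2<\zeta_1<1$ $$\liminf_{N\to\infty}\mathbb P\big(\Omega_{N,V}^{j,\zeta_1,\zeta_2}\big)\ge1-\varepsilon .$$ (2) Let $0<a\le C^{\mathrm{right}}$, $0<b\le C^{\mathrm{left}}$ and $c>0$. If $$m:=\min\Big\{\int_{C^{\mathrm{right}}-a}^{C^{\mathrm{right}}}u(x)\,dx,\ \int_{-C^{\mathrm{left}}}^{-C^{\mathrm{left}}+b}u(x)\,dx\Big\}>0\quad\text{and}\quad \max\Big\{2(a+b),\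 \frac{16(8\pi+1)^2}{m}\Big\}<c ,$$ then for all $0<\zeta_2<\zeta_1<1$ $$\liminf_{N\to\infty}\mathbb P\big(\Omega_{N,V}^{2,\zeta_1,\zeta_2}\big)\ge e^{-\nu c}.$$ -/

import Mathlib

open MeasureTheory ProbabilityTheory Filter Topology Set
open scoped ENNReal

noncomputable section

namespace PoissonBEC

/-- `M` is a Poisson random measure on `ℝ` with rate `ν` over the probability space `(Ω, P)`:
a measurable family of measures, independent on pairwise disjoint Borel sets, such that the mass of
a bounded Borel set `B` has the Poisson distribution with parameter `ν * λ(B)`. -/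
structure IsPoissonRandomMeasure {Ω : Type*} [MeasurableSpace Ω] (P : Measure Ω) (ν : ℝ)
    (M : Ω → Measure ℝ) : Prop where
  measurable : Measurable M
  indep : ∀ (n : ℕ) (B : Fin n → Set ℝ), (∀ i, MeasurableSet (B i)) →
    (∀ i j, i ≠ j → Disjoint (B i) (B j)) → iIndepFun (fun i ω => M ω (B i)) P
  law : ∀ B : Set ℝ, MeasurableSet B → Bornology.IsBounded B → ∀ m : ℕ,
    P {ω | M ω B = m} = ENNReal.ofReal
      (Real.exp (-(ν * (volume B).toReal)) * (ν * (volume B).toReal) ^ m / (m.factorial : ℝ))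

/-- Admissible single-site potentials: nonnegative, bounded, measurable, not vanishing on some
nonempty open set, with compact support `[-Cl, Cr]`, where `Cl, Cr > 0`. -/
structure IsSingleSitePotential (u : ℝ → ℝ) (Cl Cr : ℝ) : Prop where
  left_pos : 0 < Cl
  right_pos : 0 < Cr
  measurable : Measurable u
  nonneg : ∀ x, 0 ≤ u x
  bounded : ∃ K, ∀ x, u x ≤ K
  support_eq : tsupport u = Icc (-Cl) Cr
  nonzero : ∃ U : Set ℝ, IsOpen U ∧ U.Nonempty ∧ ∀ x ∈ U, u x ≠ 0

/-- The Poisson random potential `V(ω, x) = ∫ u(x - y) M^ω(dy)`. -/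
def potential {Ω : Type*} (u : ℝ → ℝ) (M : Ω → Measure ℝ) (ω : Ω) (x : ℝ) : ℝ :=
  ∫ y, u (x - y) ∂(M ω)

/-- The interval `(-L/2, L/2)`. -/
def box (L : ℝ) : Set ℝ := Ioo (-(L / 2)) (L / 2)

/-- The complex Hilbert space `L²(-L/2, L/2)`. -/
abbrev L2 (L : ℝ) : Type := Lp ℂ 2 (volume.restrict (box L))

/-- The pairs `(φ, φ')` in `L² × L²` with `φ` in `C_c^∞(-L/2, L/2)`. -/
def testGraph (L : ℝ) : Submodule ℂ (L2 L × L2 L) where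
  carrier := {p | ∃ φ : ℝ → ℂ, ContDiff ℝ ((⊤ : ℕ∞) : WithTop ℕ∞) φ ∧ HasCompactSupport φ ∧ tsupport φ ⊆ box L ∧
    p.1 =ᵐ[volume.restrict (box L)] φ ∧ p.2 =ᵐ[volume.restrict (box L)] deriv φ}
  zero_mem' := by
    refine ⟨0, contDiff_const, HasCompactSupport.zero, ?_, Lp.coeFn_zero _ _ _, ?_⟩
    · simp [tsupport]
    · have h : deriv (0 : ℝ → ℂ) = 0 := by
        funext x
        simp
      rw [h]
      exact Lp.coeFn_zero _ _ _
  add_mem' := by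
    rintro p q ⟨φ, h1, h2, h3, h4, h5⟩ ⟨χ, k1, k2, k3, k4, k5⟩
    refine ⟨φ + χ, h1.add k1, h2.add k2, (tsupport_add φ χ).trans (union_subset h3 k3), ?_, ?_⟩
    · exact (Lp.coeFn_add _ _).trans (h4.add k4)
    · have h : deriv (φ + χ) = deriv φ + deriv χ := by
        funext x
        exact deriv_add (h1.differentiable (by simp) x) (k1.differentiable (by simp) x)
      rw [h]
      exact (Lp.coeFn_add _ _).trans (h5.add k5)
  smul_mem' := by
    rintro c p ⟨φ, h1, h2, h3, h4, h5⟩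
    refine ⟨c • φ, h1.const_smul c, h2.smul_left (f := fun _ => c), ?_, ?_, ?_⟩
    · exact (tsupport_smul_subset_right (fun _ => c) φ).trans h3
    · exact (Lp.coeFn_smul _ _).trans (h4.const_smul c)
    · have h : deriv (c • φ) = c • deriv φ := by
        funext x
        exact deriv_const_smul c (h1.differentiable (by simp) x)
      rw [h]
      exact (Lp.coeFn_smul _ _).trans (h5.const_smul c)

/-- The pairs `(ψ, ψ')` with `ψ` in the Sobolev space `H¹₀(-L/2, L/2)`, the closure of `C_c^∞` in
the `H¹`-norm. -/
def sobolevGraph (L : ℝ) : Submodule ℂ (L2 L × L2 L) := (testGraph L).topologicalClosure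

/-- The graph of the Dirichlet Schrödinger operator `-Δ + V` on `L²(-L/2, L/2)`: the operator
of the form `(φ, ψ) ↦ ⟪φ', ψ'⟫ + ⟪φ, V ψ⟫` on `H¹₀`, i.e. the (Friedrichs) self-adjoint extension of
`-d²/dx² + V` on `C_c^∞`, for `V` bounded and nonnegative on the interval. A pair `(ψ, h)` belongs
to the graph, that is, `-ψ'' + V ψ = h`, if `ψ` is in `H¹₀`, with derivative `g`, the product
`w = V ψ` is in `L²` and `⟪φ', g⟫ + ⟪φ, w⟫ = ⟪φ, h⟫` for all test functions `φ`. -/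
def schrodingerGraph (L : ℝ) (V : ℝ → ℝ) : Submodule ℂ (L2 L × L2 L) where
  carrier := {p | ∃ g w : L2 L, (p.1, g) ∈ sobolevGraph L ∧
    (w =ᵐ[volume.restrict (box L)] fun x => (V x : ℂ) * p.1 x) ∧
    ∀ q ∈ testGraph L, inner ℂ q.2 g + inner ℂ q.1 w = inner ℂ q.1 p.2}
  zero_mem' := by
    refine ⟨0, 0, (sobolevGraph L).zero_mem, ?_, by simp⟩
    filter_upwards [Lp.coeFn_zero ℂ 2 (volume.restrict (box L))] with x hx
    simp only [Prod.fst_zero, hx, Pi.zero_apply, mul_zero]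
  add_mem' := by
    rintro p p' ⟨g, w, h1, h2, h3⟩ ⟨g', w', k1, k2, k3⟩
    refine ⟨g + g', w + w', (sobolevGraph L).add_mem h1 k1, ?_, ?_⟩
    · filter_upwards [h2, k2, Lp.coeFn_add w w', Lp.coeFn_add p.1 p'.1] with x a b c d
      simp only [Prod.fst_add, c, d, Pi.add_apply, a, b]
      ring
    · intro q hq
      simp only [inner_add_right, Prod.snd_add, ← h3 q hq, ← k3 q hq]
      ring
  smul_mem' := by
    rintro c p ⟨g, w, h1, h2, h3⟩
    refine ⟨c • g, c • w, (sobolevGraph L).smul_mem c h1, ?_, ?_⟩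
    · filter_upwards [h2, Lp.coeFn_smul c w, Lp.coeFn_smul c p.1] with x a b d
      simp only [Prod.smul_fst, b, d, Pi.smul_apply, a, smul_eq_mul]
      ring
    · intro q hq
      simp only [inner_smul_right, Prod.smul_snd, ← h3 q hq]
      ring

/-- The space of all `ψ` in the domain of the operator with `(-Δ + V) ψ = E ψ`. -/
def eigenspace (L : ℝ) (V : ℝ → ℝ) (E : ℝ) : Submodule ℂ (L2 L) :=
  (schrodingerGraph L V).comap (LinearMap.id.prod ((E : ℂ) • LinearMap.id))

/-- The number of eigenvalues `≤ E` of the Dirichlet operator `-Δ + V`, counted with multiplicity: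
the dimension of the span of all eigenvectors with eigenvalue `≤ E` (eigenspaces of different
eigenvalues are orthogonal). -/
def eigenvalueCount (L : ℝ) (V : ℝ → ℝ) (E : ℝ) : Cardinal :=
  Module.rank ℂ (⨆ F : Iic E, eigenspace L V F : Submodule ℂ (L2 L))

/-- The `j`-th eigenvalue (`j = 1, 2, …`) of the Dirichlet operator `-Δ + V` on `(-L/2, L/2)`, the
eigenvalues being written in ascending order and repeated according to multiplicity: the least `E`
such that at least `j` eigenvalues, counted with multiplicity, are `≤ E`. -/
def eigenvalue (L : ℝ) (V : ℝ → ℝ) (j : ℕ) : ℝ :=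
  sInf {E : ℝ | (j : Cardinal) ≤ eigenvalueCount L V E}

/-- The gap event: with `L_N = N / ρ`, the `j`-th and the first eigenvalue of `-Δ + V(ω)` with
Dirichlet boundary conditions on `(-L_N/2, L_N/2)` satisfy `E^j - E^1 ≥ N ^ (-1 + ζ₁)` and
`E^1 ≤ ((1 + ζ₂) ν π / ln L_N)²`. -/
def gapEvent {Ω : Type*} (ν ρ : ℝ) (V : Ω → ℝ → ℝ) (j : ℕ) (ζ₁ ζ₂ : ℝ) (N : ℕ) : Set Ω :=
  {ω | (N : ℝ) ^ (-1 + ζ₁) ≤ eigenvalue (N / ρ) (V ω) j - eigenvalue (N / ρ) (V ω) 1 ∧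
    eigenvalue (N / ρ) (V ω) 1 ≤ ((1 + ζ₂) * (ν * Real.pi / Real.log (N / ρ))) ^ 2}

end PoissonBEC

end

/-!
The eigenvalues of `-d²/dx² + V` in a large box are governed by the long intervals without points of
the Poisson process: the ground state energy is about `(π / l) ^ 2` for the longest such interval,
of length `l`, which is about `ln L / ν`. If only few empty intervals come within a constant length
of the longest one, then the `j`-th eigenvalue, for `j` larger than their number, is at least about
`(π / (l - δ)) ^ 2`, and the difference is of order `δ / l ^ 3`, an inverse power of `ln L`, which
is much larger than `N ^ (-1 + ζ₁)`.

*Counting long gaps.* The box is divided into cells of a fixed small length `h`, and a cell is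
occupied if it contains a point. The occupied cells form a Bernoulli string, a cell being empty with
probability `p = exp (-(ν * h))` (`IsPoissonRandomMeasure.measure_occupied`). The insertion of `D`
empty cells into a run of empty cells that comes within `D` of the longest run makes it the unique
longest one, so that it can be recovered: the insertion is injective, and it multiplies the
probability by `p ^ D`. Hence the expected number of such runs is at most `p ^ (-D)`, and Markov's
inequality yields the first claim (`sum_weight_le_card_longRuns`). Inserting into a longest run
shows that the lead of the longest run is at least `D` cells with probability at least
`p ^ D = exp (-(ν * h * D))`, which yields the second claim with `h * D` close to `c`
(`le_sum_weight_card_longRuns_le_one`).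

*Eigenvalues.* In one dimension `H¹₀` consists of the primitives of the functions of mean zero, and
taking the primitive is a compact operator. This represents the Dirichlet operator as the inverse of
a compact positive operator (`mem_schrodingerGraph_iff`). So its spectrum is discrete, Rayleigh
quotients bound the first eigenvalue from above (`eigenvalue_one_le`), and a lower bound for the
form with a penalty at finitely many points bounds a higher eigenvalue from below
(`le_eigenvalue`).

*Upper bound.* The trial function is a sine arc on the longest interval without potential
(`eigenvalue_one_le_of_eq_zero`).

*Lower bound.* Every occupied cell comes with two disjoint intervals on each of which `V` has a mass
of at least some `m > 0`. On such an interval of length `a` the form dominates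
`f ^ 2 / (a + 1 / m)` pointwise (`sq_le_mul_integral_energyDensity`), so that the obstacles act as
Robin boundary conditions, by which an empty interval appears to be longer by at most `a + 1 / m` at
each end (`riccati`). The points near the obstacles contribute only a bounded multiple of the form
itself (`setIntegral_sq_le`). Long gaps are cut in the middle, at the price of one eigenvalue each.
All this is summed over the gaps in `IsObstacleRow.form_lower_bound`; the resulting gap between the
eigenvalues is `IsObstacleRow.eigenvalue_gap`.

*Typical configurations.* With probability tending to `1` the longest run has a length between
`θ ln L / ν` and `2 ln L / ν`, up to constants, for any given `θ < 1`, and the runs at the boundary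
of the box are at most half as long as this lower bound (`IsMassPair.eventually_measure_le`).
-/

noncomputable section
namespace PoissonBEC

/-! ### Runs of empty cells in a finite row of cells -/

/-- A row of `n` cells, numbered `1, …, n`, has a set `O` of occupied cells. For a position `i`
(the number of an occupied cell, or `0` for the left end of the row), `run n O i` is the number of
consecutive empty cells directly after `i`; the position `n + 1` acts as the right end. -/
def run (n : ℕ) (O : Finset ℕ) (i : ℕ) : ℕ := sInf {r | i + r + 1 ∈ insert (n + 1) O}

lemma run_spec {n i : ℕ} (O : Finset ℕ) (hi : i ≤ n) : i + run n O i + 1 ∈ insert (n + 1) O := by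
  have h : n - i ∈ {r | i + r + 1 ∈ insert (n + 1) O} := by
    have : i + (n - i) + 1 = n + 1 := by omega
    rw [Set.mem_ofPred_eq, this]
    exact Finset.mem_insert_self _ _
  exact Nat.sInf_mem ⟨_, h⟩

lemma notMem_of_lt_run {n i r : ℕ} {O : Finset ℕ} (hr : r < run n O i) :
    i + r + 1 ∉ insert (n + 1) O :=
  fun h => Nat.notMem_of_lt_sInf hr h

lemma run_le {n i r : ℕ} {O : Finset ℕ} (h : i + r + 1 ∈ insert (n + 1) O) : run n O i ≤ r :=
  Nat.sInf_le h

lemma run_eq {n i r : ℕ} {O : Finset ℕ} (h : i + r + 1 ∈ insert (n + 1) O)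
    (h' : ∀ r' < r, i + r' + 1 ∉ insert (n + 1) O) : run n O i = r := by
  refine le_antisymm (run_le h) ?_
  by_contra hlt
  exact h' _ (not_le.mp hlt) (Nat.sInf_mem (s := {r | i + r + 1 ∈ insert (n + 1) O}) ⟨r, h⟩)

/-- The renumbering of the cells when `D` new cells are inserted directly after position `i`. -/
def shift (i D x : ℕ) : ℕ := if x ≤ i then x else x + D

lemma shift_injective (i D : ℕ) : Function.Injective (shift i D) := by
  intro x y h
  unfold shift at h
  split_ifs at h <;> omega

lemma shift_self (i D : ℕ) : shift i D i = i := by simp [shift]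

/-- The set of occupied cells after insertion of `D` empty cells after position `i`. -/
def insertEmpty (O : Finset ℕ) (i D : ℕ) : Finset ℕ := O.image (shift i D)

lemma insert_zero_insertEmpty (O : Finset ℕ) (i D : ℕ) :
    insert 0 (insertEmpty O i D) = (insert 0 O).image (shift i D) := by
  rw [Finset.image_insert, insertEmpty]
  simp [shift]

lemma insert_last_insertEmpty {n i : ℕ} (O : Finset ℕ) (D : ℕ) (hi : i ≤ n) :
    insert (n + D + 1) (insertEmpty O i D) = (insert (n + 1) O).image (shift i D) := by
  rw [Finset.image_insert, insertEmpty]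
  have : shift i D (n + 1) = n + D + 1 := by
    unfold shift
    split_ifs <;> omega
  rw [this]

lemma insertEmpty_subset {n i D : ℕ} {O : Finset ℕ} (hO : O ⊆ Finset.Icc 1 n) :
    insertEmpty O i D ⊆ Finset.Icc 1 (n + D) := by
  intro x hx
  obtain ⟨y, hy, rfl⟩ := Finset.mem_image.mp hx
  have := Finset.mem_Icc.mp (hO hy)
  rw [Finset.mem_Icc]
  unfold shift
  split_ifs <;> omega

lemma card_insertEmpty (O : Finset ℕ) (i D : ℕ) : (insertEmpty O i D).card = O.card :=
  Finset.card_image_of_injective _ (shift_injective i D)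

lemma le_of_mem_insert_zero {n i : ℕ} {O : Finset ℕ} (hO : O ⊆ Finset.Icc 1 n)
    (hi : i ∈ insert 0 O) : i ≤ n := by
  rcases Finset.mem_insert.mp hi with rfl | h
  · omega
  · exact (Finset.mem_Icc.mp (hO h)).2

/-- Insertion of `D` empty cells after `i` prolongs the run after `i` by `D` and keeps the
lengths of all other runs. -/
lemma run_insertEmpty {n i D k : ℕ} {O : Finset ℕ} (hO : O ⊆ Finset.Icc 1 n)
    (hi : i ∈ insert 0 O) (hk : k ∈ insert 0 O) :
    run (n + D) (insertEmpty O i D) (shift i D k) = run n O k + if k = i then D else 0 := by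
  have hin := le_of_mem_insert_zero hO hi
  have hkn := le_of_mem_insert_zero hO hk
  have hspec := run_spec O hkn
  refine run_eq ?_ ?_ <;> rw [insert_last_insertEmpty O D hin]
  · refine Finset.mem_image.mpr ⟨_, hspec, ?_⟩
    rcases lt_trichotomy k i with h | h | h
    · have hi' : i ∈ insert (n + 1) O := by
        rcases Finset.mem_insert.mp hi with rfl | h'
        · omega
        · exact Finset.mem_insert_of_mem h'
      have hle : run n O k ≤ i - k - 1 := by
        apply run_le
        have : k + (i - k - 1) + 1 = i := by omega
        rwa [this]
      unfold shift
      split_ifs <;> omega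
    · subst h
      unfold shift
      split_ifs <;> omega
    · unfold shift
      split_ifs <;> omega
  · intro r' hr' hmem
    obtain ⟨x, hx, hxe⟩ := Finset.mem_image.mp hmem
    have hno : ∀ r, r < run n O k → x ≠ k + r + 1 := by
      rintro r hr rfl
      exact notMem_of_lt_run hr hx
    have h1 := hno r'
    have h2 := hno (r' - D)
    unfold shift at hxe
    split_ifs at hxe hr' <;> omega

open Classical in
/-- The positions whose run falls short of the longest run by less than `D`. -/
def longRuns (n : ℕ) (O : Finset ℕ) (D : ℕ) : Finset ℕ :=
  (insert 0 O).filter fun i => ∀ k ∈ (insert 0 O : Finset ℕ), run n O k < run n O i + D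

lemma mem_longRuns {n D i : ℕ} {O : Finset ℕ} :
    i ∈ longRuns n O D ↔ i ∈ insert 0 O ∧ ∀ k ∈ insert 0 O, run n O k < run n O i + D := by
  simp only [longRuns, Finset.mem_filter]

lemma run_lt_of_insertEmpty {n i D : ℕ} {O : Finset ℕ} (hO : O ⊆ Finset.Icc 1 n)
    (hi : i ∈ longRuns n O D) {k : ℕ} (hk : k ∈ insert 0 (insertEmpty O i D)) (hki : k ≠ i) :
    run (n + D) (insertEmpty O i D) k < run (n + D) (insertEmpty O i D) i := by
  obtain ⟨hi0, hi1⟩ := mem_longRuns.mp hi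
  rw [insert_zero_insertEmpty] at hk
  obtain ⟨x, hx, rfl⟩ := Finset.mem_image.mp hk
  have h2 := run_insertEmpty (D := D) hO hi0 hi0
  rw [shift_self, if_pos rfl] at h2
  have hxi : x ≠ i := by
    rintro rfl
    exact hki (shift_self _ _)
  rw [run_insertEmpty hO hi0 hx, h2, if_neg hxi]
  exact hi1 x hx

/-- A long run made the unique longest one by insertion of `D` empty cells can be recovered. -/
lemma insertEmpty_inj {n D i i' : ℕ} {O O' : Finset ℕ} (hO : O ⊆ Finset.Icc 1 n)
    (hO' : O' ⊆ Finset.Icc 1 n) (hi : i ∈ longRuns n O D) (hi' : i' ∈ longRuns n O' D)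
    (h : insertEmpty O i D = insertEmpty O' i' D) : O = O' ∧ i = i' := by
  have hmem : ∀ {O : Finset ℕ} {i : ℕ}, i ∈ longRuns n O D → i ∈ insert 0 (insertEmpty O i D) := by
    intro O i hi
    rw [insert_zero_insertEmpty]
    exact Finset.mem_image.mpr ⟨i, (mem_longRuns.mp hi).1, shift_self _ _⟩
  have hii : i = i' := by
    by_contra hne
    have h1 := run_lt_of_insertEmpty hO hi (k := i') (by rw [h]; exact hmem hi') (Ne.symm hne)
    have h2 := run_lt_of_insertEmpty hO' hi' (k := i) (by rw [← h]; exact hmem hi) hne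
    rw [h] at h1
    omega
  subst hii
  exact ⟨Finset.image_injective (shift_injective i D) h, rfl⟩

/-- The probability that exactly the cells in `O` are occupied, if the `n` cells are independent
and each of them is empty with probability `p`. -/
def weight (p : ℝ) (n : ℕ) (O : Finset ℕ) : ℝ := (1 - p) ^ O.card * p ^ (n - O.card)

lemma weight_nonneg {p : ℝ} (hp0 : 0 ≤ p) (hp1 : p ≤ 1) (n : ℕ) (O : Finset ℕ) :
    0 ≤ weight p n O :=
  mul_nonneg (pow_nonneg (by linarith) _) (pow_nonneg hp0 _)

lemma sum_weight (p : ℝ) (n : ℕ) : ∑ O ∈ (Finset.Icc 1 n).powerset, weight p n O = 1 := by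
  have := Finset.sum_pow_mul_eq_add_pow (1 - p) p (Finset.Icc 1 n)
  simpa [weight] using this

lemma weight_insertEmpty (p : ℝ) {n i D : ℕ} {O : Finset ℕ} (hO : O ⊆ Finset.Icc 1 n) :
    weight p (n + D) (insertEmpty O i D) = weight p n O * p ^ D := by
  have : O.card ≤ n := by simpa using Finset.card_le_card hO
  rw [weight, weight, card_insertEmpty, show n + D - O.card = (n - O.card) + D by omega, pow_add]
  ring

/-- The expected number of runs that fall short of the longest one by less than `D` is at most
`p⁻ᴰ`: insertion of `D` empty cells into such a run is injective. -/
lemma sum_weight_card_longRuns_le {p : ℝ} (hp0 : 0 ≤ p) (hp1 : p ≤ 1) (n D : ℕ) :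
    (∑ O ∈ (Finset.Icc 1 n).powerset, weight p n O * (longRuns n O D).card) * p ^ D ≤ 1 := by
  classical
  let s := (Finset.Icc 1 n).powerset.sigma fun O => longRuns n O D
  have h1 : (∑ O ∈ (Finset.Icc 1 n).powerset, weight p n O * (longRuns n O D).card) * p ^ D =
      ∑ x ∈ s, weight p (n + D) (insertEmpty x.1 x.2 D) := by
    rw [Finset.sum_sigma, Finset.sum_mul]
    refine Finset.sum_congr rfl fun O hO => ?_
    rw [Finset.sum_congr rfl fun i _ => weight_insertEmpty p (i := i) (D := D)
      (Finset.mem_powerset.mp hO)]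
    simp
    ring
  have hinj : Set.InjOn (fun x : Σ _ : Finset ℕ, ℕ => insertEmpty x.1 x.2 D) s := by
    rintro ⟨O, i⟩ hx ⟨O', i'⟩ hx' h
    simp only [s, Finset.coe_sigma, Set.mem_sigma_iff, Finset.mem_coe, Finset.mem_powerset]
      at hx hx'
    obtain ⟨rfl, rfl⟩ := insertEmpty_inj hx.1 hx'.1 hx.2 hx'.2 h
    rfl
  rw [h1, ← Finset.sum_image (f := fun O => weight p (n + D) O) hinj, ← sum_weight p (n + D)]
  refine Finset.sum_le_sum_of_subset_of_nonneg ?_ fun O _ _ => weight_nonneg hp0 hp1 _ _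
  intro O hO
  obtain ⟨⟨O, i⟩, hx, rfl⟩ := Finset.mem_image.mp hO
  simp only [s, Finset.mem_sigma, Finset.mem_powerset] at hx
  exact Finset.mem_powerset.mpr (insertEmpty_subset hx.1)

/-- Markov's inequality for the number of nearly longest runs. -/
lemma sum_weight_le_card_longRuns {p : ℝ} (hp0 : 0 < p) (hp1 : p ≤ 1) (n D j : ℕ) :
    ∑ O ∈ (Finset.Icc 1 n).powerset with j ≤ (longRuns n O D).card, weight p n O * j ≤
      (p ^ D)⁻¹ := by
  have h := sum_weight_card_longRuns_le hp0.le hp1 n D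
  rw [← le_div_iff₀ (by positivity), one_div] at h
  refine le_trans ?_ h
  rw [Finset.sum_filter]
  refine Finset.sum_le_sum fun O _ => ?_
  have hw := weight_nonneg hp0.le hp1 n O
  split_ifs with hj
  · exact mul_le_mul_of_nonneg_left (by exact_mod_cast hj) hw
  · positivity

/-- With probability at least `pᴰ` the longest run exceeds all others by at least `D`: insertion
of `D` empty cells into a longest run maps the rows of `n` cells injectively to such rows of
`n + D` cells. -/
lemma le_sum_weight_card_longRuns_le_one {p : ℝ} (hp0 : 0 ≤ p) (hp1 : p ≤ 1) (n : ℕ) {D : ℕ}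
    (hD : 0 < D) :
    p ^ D ≤ ∑ O ∈ (Finset.Icc 1 (n + D)).powerset with (longRuns (n + D) O D).card ≤ 1,
      weight p (n + D) O := by
  classical
  have hmax : ∀ O : Finset ℕ, ∃ i, i ∈ longRuns n O D ∧
      ∀ k ∈ insert 0 O, run n O k ≤ run n O i := by
    intro O
    obtain ⟨i, hi, him⟩ := Finset.exists_max_image (insert 0 O) (run n O) ⟨0, by simp⟩
    exact ⟨i, mem_longRuns.mpr ⟨hi, fun k hk => by have := him k hk; omega⟩, him⟩
  choose top htop htop' using hmax
  have hinj : Set.InjOn (fun O => insertEmpty O (top O) D)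
      ((Finset.Icc 1 n).powerset : Set (Finset ℕ)) := by
    intro O hO O' hO' h
    exact (insertEmpty_inj (Finset.mem_powerset.mp hO) (Finset.mem_powerset.mp hO')
      (htop O) (htop O') h).1
  calc p ^ D = ∑ O ∈ (Finset.Icc 1 n).powerset, weight p (n + D) (insertEmpty O (top O) D) := by
        rw [Finset.sum_congr rfl fun O hO => weight_insertEmpty p (i := top O) (D := D)
          (Finset.mem_powerset.mp hO), ← Finset.sum_mul, sum_weight, one_mul]
    _ = ∑ O ∈ (Finset.Icc 1 n).powerset.image fun O => insertEmpty O (top O) D,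
          weight p (n + D) O := by rw [Finset.sum_image hinj]
    _ ≤ _ := by
        refine Finset.sum_le_sum_of_subset_of_nonneg ?_ fun O _ _ => weight_nonneg hp0 hp1 _ _
        intro O' hO'
        obtain ⟨O, hO, rfl⟩ := Finset.mem_image.mp hO'
        have hOs := Finset.mem_powerset.mp hO
        refine Finset.mem_filter.mpr ⟨Finset.mem_powerset.mpr (insertEmpty_subset hOs), ?_⟩
        have htop0 := (mem_longRuns.mp (htop O)).1
        refine Finset.card_le_one_iff_subset_singleton.mpr ⟨top O, fun k hk => ?_⟩
        obtain ⟨hk0, hk1⟩ := mem_longRuns.mp hk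
        rw [insert_zero_insertEmpty] at hk0 hk1
        obtain ⟨x, hx, rfl⟩ := Finset.mem_image.mp hk0
        have h1 := hk1 (top O) (Finset.mem_image.mpr ⟨top O, htop0, shift_self _ _⟩)
        have h2 := run_insertEmpty (D := D) hOs htop0 htop0
        rw [shift_self, if_pos rfl] at h2
        rw [run_insertEmpty hOs htop0 hx, h2] at h1
        have h3 := htop' O x hx
        by_cases hxt : x = top O
        · rw [hxt, shift_self]
          simp
        · rw [if_neg hxt] at h1
          omega

/-! ### Primitives of square-integrable functions on an interval -/

instance isFiniteMeasure_box (L : ℝ) : IsFiniteMeasure (volume.restrict (box L)) :=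
  ⟨by simp [box]⟩

lemma measurableSet_box (L : ℝ) : MeasurableSet (box L) := measurableSet_Ioo

/-- The indicator function of `(-∞, x)` as an element of `L²(-L/2, L/2)`. The scalar product with
it is the value at `x` of the primitive that vanishes at `-L/2`. -/
def below (L x : ℝ) : L2 L :=
  indicatorConstLp 2 (measurableSet_Iio (a := x)) (measure_ne_top (volume.restrict (box L)) _) 1

lemma inner_below (L x : ℝ) (g : L2 L) :
    inner ℂ (below L x) g = ∫ y in Iio x, g y ∂(volume.restrict (box L)) :=
  L2.inner_indicatorConstLp_one _ _ _

lemma norm_below_sub_sq_le (L : ℝ) {x y : ℝ} (hxy : x ≤ y) :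
    ‖below L y - below L x‖ ^ 2 ≤ y - x := by
  have h : ∀ s t : ℝ, inner ℂ (below L s) (below L t) =
      (((volume.restrict (box L)).real (Iio s ∩ Iio t) : ℝ) : ℂ) := fun s t =>
    L2.inner_indicatorConstLp_one_indicatorConstLp_one _ _
  have e : ‖below L y - below L x‖ ^ 2 = (volume.restrict (box L)).real (Ico x y) := by
    rw [@norm_sub_sq ℂ, ← @inner_self_eq_norm_sq ℂ, ← @inner_self_eq_norm_sq ℂ, h, h, h]
    have h1 : (Iio y : Set ℝ) ∩ Iio x = Iio x := inter_eq_right.mpr (Iio_subset_Iio hxy)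
    rw [h1, inter_self, inter_self]
    have h2 : (Iio y : Set ℝ) = Iio x ∪ Ico x y := (Iio_union_Ico_eq_Iio hxy).symm
    have h3 : (volume.restrict (box L)).real (Iio y) =
        (volume.restrict (box L)).real (Iio x) + (volume.restrict (box L)).real (Ico x y) := by
      rw [h2, measureReal_union _ measurableSet_Ico]
      exact disjoint_left.mpr fun z hz hz' => not_lt.mpr hz'.1 hz
    rw [h3]
    simp only [RCLike.re_to_complex, Complex.ofReal_re]
    ring
  rw [e, measureReal_restrict_apply measurableSet_Ico]
  calc volume.real (Ico x y ∩ box L) ≤ volume.real (Ico x y) :=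
        measureReal_mono inter_subset_left (by simp)
    _ = y - x := by simp [hxy]

lemma norm_below_sub_le (L x y : ℝ) : ‖below L y - below L x‖ ≤ √|y - x| := by
  rcases le_total x y with h | h
  · rw [abs_of_nonneg (sub_nonneg.mpr h)]
    exact Real.le_sqrt_of_sq_le (norm_below_sub_sq_le L h)
  · rw [norm_sub_rev, abs_sub_comm, abs_of_nonneg (sub_nonneg.mpr h)]
    exact Real.le_sqrt_of_sq_le (norm_below_sub_sq_le L h)

lemma continuous_below (L : ℝ) : Continuous (below L) := by
  rw [continuous_iff_continuousAt]
  intro x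
  rw [ContinuousAt, tendsto_iff_norm_sub_tendsto_zero]
  have h : Tendsto (fun y : ℝ => √|y - x|) (𝓝 x) (𝓝 0) := by
    have : ContinuousAt (fun y : ℝ => √|y - x|) x := by fun_prop
    simpa [ContinuousAt] using this
  exact squeeze_zero (fun _ => norm_nonneg _) (fun y => norm_below_sub_le L x y) h

lemma norm_below_le (L x : ℝ) : ‖below L x‖ ≤ √(volume.real (box L)) := by
  refine Real.le_sqrt_of_sq_le ?_
  have h : inner ℂ (below L x) (below L x) =
      (((volume.restrict (box L)).real (Iio x ∩ Iio x) : ℝ) : ℂ) :=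
    L2.inner_indicatorConstLp_one_indicatorConstLp_one _ _
  rw [← @inner_self_eq_norm_sq ℂ, h, inter_self, measureReal_restrict_apply measurableSet_Iio]
  simp only [RCLike.re_to_complex, Complex.ofReal_re]
  exact measureReal_mono inter_subset_right (by simp [box])

lemma memLp_inner_below {L : ℝ} {s : ℝ → ℝ} (hs : Measurable s) (g : L2 L) :
    MemLp (fun x => inner ℂ (below L (s x)) g) 2 (volume.restrict (box L)) := by
  refine MemLp.of_bound ?_ (√(volume.real (box L)) * ‖g‖) (ae_of_all _ fun x => ?_)
  · have hc : Continuous fun x : ℝ => inner ℂ (below L x) g :=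
      (continuous_below L).inner continuous_const
    exact (hc.measurable.comp hs).aestronglyMeasurable
  · exact (norm_inner_le_norm _ _).trans
      (mul_le_mul_of_nonneg_right (norm_below_le L _) (norm_nonneg _))

lemma norm_le_sqrt_mul {L : ℝ} {f : L2 L} {C : ℝ} (hC : 0 ≤ C)
    (h : ∀ᵐ x ∂(volume.restrict (box L)), ‖f x‖ ≤ C) : ‖f‖ ≤ √(volume.real (box L)) * C := by
  refine (Lp.norm_le_of_ae_bound hC h).trans (le_of_eq ?_)
  congr 1
  have : ((2 : ℝ≥0∞).toReal)⁻¹ = (1 / 2 : ℝ) := by norm_num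
  rw [this, Real.sqrt_eq_rpow]
  simp only [measureUnivNNReal, measureReal_def, Measure.restrict_apply_univ]
  norm_num
  rfl

/-- The operator `g ↦ (x ↦ G (s x))`, where `G` is the primitive of `g` vanishing at `-L/2`. -/
def primitiveAt (L : ℝ) (s : ℝ → ℝ) (hs : Measurable s) : L2 L →L[ℂ] L2 L :=
  LinearMap.mkContinuous
    { toFun := fun g => (memLp_inner_below hs g).toLp _
      map_add' := fun f g => by
        rw [← MemLp.toLp_add]
        congr 1
        funext x
        simp [inner_add_right]
      map_smul' := fun c g => by
        rw [RingHom.id_apply, ← MemLp.toLp_const_smul]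
        congr 1
        funext x
        simp [inner_smul_right] }
    (√(volume.real (box L)) * √(volume.real (box L))) fun g => by
      rw [mul_assoc]
      refine norm_le_sqrt_mul (by positivity) ?_
      filter_upwards [(memLp_inner_below hs g).coeFn_toLp] with x hx
      rw [LinearMap.coe_mk, AddHom.coe_mk, hx]
      exact (norm_inner_le_norm _ _).trans
        (mul_le_mul_of_nonneg_right (norm_below_le L _) (norm_nonneg _))

lemma coeFn_primitiveAt {L : ℝ} {s : ℝ → ℝ} (hs : Measurable s) (g : L2 L) :
    primitiveAt L s hs g =ᵐ[volume.restrict (box L)] fun x => inner ℂ (below L (s x)) g :=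
  (memLp_inner_below hs g).coeFn_toLp

/-- The operator that maps `g` to its primitive vanishing at `-L/2`. -/
def primitive (L : ℝ) : L2 L →L[ℂ] L2 L := primitiveAt L id measurable_id

lemma coeFn_primitive {L : ℝ} (g : L2 L) :
    primitive L g =ᵐ[volume.restrict (box L)] fun x => inner ℂ (below L x) g :=
  coeFn_primitiveAt measurable_id g

lemma isCompactOperator_primitiveAt_of_finite {ι : Type*} [Fintype ι] [MeasurableSpace ι]
    [DiscreteMeasurableSpace ι] {L : ℝ} (y : ι → ℝ) {s : ℝ → ι} (hs : Measurable s) :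
    IsCompactOperator (primitiveAt L (y ∘ s) ((measurable_of_finite y).comp hs)) := by
  have hmem : ∀ c : ι → ℂ, MemLp (c ∘ s) 2 (volume.restrict (box L)) := fun c => by
    refine MemLp.of_bound ((measurable_of_finite c).comp hs).aestronglyMeasurable ‖c‖
      (ae_of_all _ fun x => norm_le_pi_norm c (s x))
  let R : (ι → ℂ) →ₗ[ℂ] L2 L :=
    { toFun := fun c => (hmem c).toLp _
      map_add' := fun c d => by
        rw [← MemLp.toLp_add]
        rfl
      map_smul' := fun a c => by
        rw [RingHom.id_apply, ← MemLp.toLp_const_smul]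
        rfl }
  let F : L2 L →L[ℂ] (ι → ℂ) := ContinuousLinearMap.pi fun i => innerSL ℂ (below L (y i))
  have h : (primitiveAt L (y ∘ s) ((measurable_of_finite y).comp hs) : L2 L → L2 L) =
      (LinearMap.toContinuousLinearMap R) ∘ F := by
    funext g
    rfl
  rw [h]
  exact (isCompactOperator_of_locallyCompactSpace_dom F).clm_comp
    (LinearMap.toContinuousLinearMap R)

lemma norm_primitiveAt_sub_le {L C : ℝ} {s t : ℝ → ℝ} (hs : Measurable s)
    (ht : Measurable t) (h : ∀ x ∈ box L, |s x - t x| ≤ C) :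
    ‖primitiveAt L s hs - primitiveAt L t ht‖ ≤ √(volume.real (box L)) * √C := by
  refine ContinuousLinearMap.opNorm_le_bound _ (by positivity) fun g => ?_
  rw [mul_assoc]
  refine norm_le_sqrt_mul (by positivity) ?_
  rw [_root_.sub_apply]
  filter_upwards [Lp.coeFn_sub (primitiveAt L s hs g) (primitiveAt L t ht g),
    coeFn_primitiveAt hs g, coeFn_primitiveAt ht g, ae_restrict_mem (measurableSet_box L)]
    with x h1 h2 h3 hx
  rw [h1, Pi.sub_apply, h2, h3, ← inner_sub_left]
  refine (norm_inner_le_norm _ _).trans (mul_le_mul_of_nonneg_right ?_ (norm_nonneg _))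
  exact (norm_below_sub_le L _ _).trans (Real.sqrt_le_sqrt (h x hx))

/-- Primitives are uniformly close to step functions, so that the operator is a limit of operators
of finite rank. -/
lemma isCompactOperator_primitive {L : ℝ} (hL : 0 < L) : IsCompactOperator (primitive L) := by
  let k : ∀ n : ℕ, ℝ → Fin (n + 1) := fun n x => ⟨min ⌊(x + L / 2) / (L / (n + 1))⌋₊ n, by omega⟩
  let y : ∀ n : ℕ, Fin (n + 1) → ℝ := fun n i => -(L / 2) + (i : ℕ) * (L / (n + 1))
  have hk : ∀ n, Measurable (k n) := by
    intro n
    have h1 : Measurable fun x : ℝ => ⌊(x + L / 2) / (L / (n + 1))⌋₊ :=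
      Nat.measurable_floor.comp (by fun_prop)
    have h2 : Measurable fun m : ℕ => (⟨min m n, by omega⟩ : Fin (n + 1)) :=
      measurable_from_top
    exact h2.comp h1
  refine isCompactOperator_of_tendsto (l := atTop)
    (F := fun n : ℕ => primitiveAt L (y n ∘ k n) ((measurable_of_finite (y n)).comp (hk n)))
    ?_ (Eventually.of_forall fun n => isCompactOperator_primitiveAt_of_finite (y n) (hk n))
  rw [tendsto_iff_norm_sub_tendsto_zero]
  have hlim : Tendsto (fun n : ℕ => √(volume.real (box L)) * √(L / ((n : ℝ) + 1))) atTop (𝓝 0) := by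
    have h1 : Tendsto (fun n : ℕ => L / ((n : ℝ) + 1)) atTop (𝓝 0) :=
      tendsto_const_nhds.div_atTop (tendsto_natCast_atTop_atTop.atTop_add tendsto_const_nhds)
    have h2 := (Real.continuous_sqrt.tendsto 0).comp h1
    rw [Real.sqrt_zero] at h2
    simpa using h2.const_mul (√(volume.real (box L)))
  refine squeeze_zero (fun _ => norm_nonneg _) (fun n => ?_) hlim
  refine norm_primitiveAt_sub_le _ _ fun x hx => ?_
  have hd : 0 < L / ((n : ℝ) + 1) := by positivity
  have hx0 : 0 < x + L / 2 := by
    have := hx.1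
    linarith
  have hx1 : (x + L / 2) / (L / (n + 1)) < n + 1 := by
    rw [div_lt_iff₀ hd, mul_div_cancel₀ _ (by positivity)]
    have := hx.2
    linarith
  have hfl : ⌊(x + L / 2) / (L / (n + 1))⌋₊ ≤ n :=
    Nat.lt_succ_iff.mp ((Nat.floor_lt (by positivity)).mpr (by exact_mod_cast hx1))
  have e : (y n ∘ k n) x = -(L / 2) + (⌊(x + L / 2) / (L / (n + 1))⌋₊ : ℝ) * (L / (n + 1)) := by
    simp only [y, k, Function.comp_apply, min_eq_left hfl]
  rw [e, id_eq]
  have h1 := Nat.floor_le (a := (x + L / 2) / (L / (n + 1))) (by positivity)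
  have h2 := Nat.lt_floor_add_one ((x + L / 2) / (L / (n + 1)))
  rw [le_div_iff₀ hd] at h1
  rw [div_lt_iff₀ hd] at h2
  rw [abs_le]
  constructor <;> linarith

/-! ### The Sobolev space as a space of primitives -/

/-- The constant function `1`. -/
def one (L : ℝ) : L2 L := below L (L / 2)

lemma coeFn_one (L : ℝ) : one L =ᵐ[volume.restrict (box L)] fun _ => 1 := by
  filter_upwards [indicatorConstLp_coeFn (p := 2) (μ := volume.restrict (box L))
    (hs := measurableSet_Iio (a := L / 2)) (hμs := measure_ne_top _ _) (c := (1 : ℂ)),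
    ae_restrict_mem (measurableSet_box L)] with x hx hx'
  rw [one, below, hx, indicator_of_mem (show x ∈ Iio (L / 2) from hx'.2)]

lemma exists_mem_testGraph {L : ℝ} {φ : ℝ → ℂ} (h1 : ContDiff ℝ ((⊤ : ℕ∞) : WithTop ℕ∞) φ)
    (h2 : HasCompactSupport φ) (h3 : tsupport φ ⊆ box L) :
    ∃ p ∈ testGraph L, p.1 =ᵐ[volume.restrict (box L)] φ ∧
      p.2 =ᵐ[volume.restrict (box L)] deriv φ := by
  have m1 : MemLp φ 2 (volume.restrict (box L)) :=
    (h1.continuous.memLp_of_hasCompactSupport h2).restrict _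
  have m2 : MemLp (deriv φ) 2 (volume.restrict (box L)) :=
    ((h1.continuous_deriv (by simp)).memLp_of_hasCompactSupport h2.deriv).restrict _
  exact ⟨(m1.toLp _, m2.toLp _), ⟨φ, h1, h2, h3, m1.coeFn_toLp, m2.coeFn_toLp⟩,
    m1.coeFn_toLp, m2.coeFn_toLp⟩

lemma inner_below_of_deriv {L : ℝ} {φ : ℝ → ℂ} (h1 : ContDiff ℝ ((⊤ : ℕ∞) : WithTop ℕ∞) φ)
    (h2 : HasCompactSupport φ) (h3 : tsupport φ ⊆ box L) {g : L2 L}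
    (hg : g =ᵐ[volume.restrict (box L)] deriv φ) (x : ℝ) : inner ℂ (below L x) g = φ x := by
  rw [inner_below, setIntegral_congr_ae measurableSet_Iio (g := deriv φ)
    (hg.mono fun y hy _ => hy), Measure.restrict_restrict measurableSet_Iio,
    ← HasCompactSupport.integral_Iic_deriv_eq (h1.of_le (by simp)) h2 x,
    ← setIntegral_congr_set (Iio_ae_eq_Iic (a := x) (μ := volume))]
  refine (setIntegral_eq_of_subset_of_forall_sdiff_eq_zero measurableSet_Iio inter_subset_left
    fun y hy => ?_).symm
  by_contra hne
  exact hy.2 ⟨hy.1, h3 (support_deriv_subset hne)⟩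

lemma fst_eq_primitive_of_mem_testGraph {L : ℝ} {p : L2 L × L2 L} (hp : p ∈ testGraph L) :
    p.1 = primitive L p.2 := by
  obtain ⟨φ, h1, h2, h3, h4, h5⟩ := hp
  refine Lp.ext ?_
  filter_upwards [h4, coeFn_primitive p.2] with x hx hx'
  rw [hx, hx', inner_below_of_deriv h1 h2 h3 h5]

lemma inner_one_of_mem_testGraph {L : ℝ} {p : L2 L × L2 L} (hp : p ∈ testGraph L) :
    inner ℂ (one L) p.2 = 0 := by
  obtain ⟨φ, h1, h2, h3, h4, h5⟩ := hp
  rw [one, inner_below_of_deriv h1 h2 h3 h5]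
  by_contra hne
  exact lt_irrefl _ (h3 (subset_tsupport φ hne)).2

lemma inner_eq_integral_smul {L : ℝ} {g h : L2 L} {η : ℝ → ℝ}
    (hg : g =ᵐ[volume.restrict (box L)] fun x => (η x : ℂ)) (hη : tsupport η ⊆ box L) :
    inner ℂ g h = ∫ x, η x • h x := by
  rw [L2.inner_def, ← setIntegral_eq_integral_of_forall_compl_eq_zero (s := box L)
    (f := fun x => η x • h x)]
  · refine integral_congr_ae ?_
    filter_upwards [hg] with x hx
    rw [hx]
    simp [mul_comm]
  · intro x hx
    have : η x = 0 := image_eq_zero_of_notMem_tsupport fun h => hx (hη h)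
    rw [this, zero_smul]

lemma locallyIntegrableOn_coeFn {L : ℝ} (h : L2 L) :
    LocallyIntegrableOn (h : ℝ → ℂ) (box L) volume :=
  IntegrableOn.locallyIntegrableOn ((Lp.memLp h).integrable (by norm_num))

/-- A smooth function with compact support in an interval and vanishing integral is the
derivative of such a function. -/
lemma exists_deriv_eq {L : ℝ} {η : ℝ → ℝ} (h1 : ContDiff ℝ ((⊤ : ℕ∞) : WithTop ℕ∞) η)
    (h2 : HasCompactSupport η) (h3 : tsupport η ⊆ box L) (h4 : ∫ x, η x = 0) :
    ∃ φ : ℝ → ℝ, ContDiff ℝ ((⊤ : ℕ∞) : WithTop ℕ∞) φ ∧ HasCompactSupport φ ∧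
      tsupport φ ⊆ box L ∧ deriv φ = η := by
  have hint : Integrable η := h1.continuous.integrable_of_hasCompactSupport h2
  obtain ⟨r, hr1, hr2⟩ : ∃ r, r < L / 2 ∧ ∀ x ∈ tsupport η, |x| ≤ r := by
    rcases (tsupport η).eq_empty_or_nonempty with he | hne
    · exact ⟨L / 2 - 1, by linarith, by simp [he]⟩
    · obtain ⟨x, hx, hm⟩ := h2.isCompact.exists_isMaxOn hne continuous_abs.continuousOn
      exact ⟨|x|, abs_lt.mpr (h3 hx), fun y hy => hm hy⟩
  have hz : ∀ x, r < |x| → η x = 0 := fun x hx =>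
    image_eq_zero_of_notMem_tsupport fun h => not_le.mpr hx (hr2 x h)
  let φ : ℝ → ℝ := fun x => ∫ y in (-L)..x, η y
  have hd : ∀ x, HasDerivAt φ (η x) x := fun x =>
    intervalIntegral.integral_hasDerivAt_right hint.intervalIntegrable
      (h1.continuous.stronglyMeasurableAtFilter _ _) h1.continuous.continuousAt
  have hderiv : deriv φ = η := funext fun x => (hd x).deriv
  rcases lt_or_ge L 0 with hL | hL
  · have : η = 0 := by
      funext x
      refine image_eq_zero_of_notMem_tsupport fun h => ?_
      have := h3 h
      have h5 := this.1.trans this.2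
      linarith
    exact ⟨0, contDiff_const, HasCompactSupport.zero, by simp [tsupport], by
      rw [this]; funext x; simp⟩
  have hsupp : ∀ x, x ∉ Icc (-r) r → φ x = 0 := by
    intro x hx
    have hx' : r < |x| := by
      by_contra hle
      exact hx (abs_le.mp (not_lt.mp hle))
    rcases lt_abs.mp hx' with h | h
    · have : φ x = ∫ y, η y := by
        refine intervalIntegral.integral_eq_integral_of_support_subset fun y hy => ?_
        have hy' := hr2 y (subset_tsupport η hy)
        rw [abs_le] at hy'
        exact ⟨by linarith, by linarith⟩
      rw [this, h4]
    · refine intervalIntegral.integral_zero_ae (ae_of_all _ fun y hy => hz y ?_)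
      rw [lt_abs]
      right
      rcases mem_uIoc.mp hy with hy | hy
      · linarith [hy.2]
      · linarith [hy.2]
  have hts : tsupport φ ⊆ Icc (-r) r := by
    refine closure_minimal (fun x hx => ?_) isClosed_Icc
    by_contra hne
    exact hx (hsupp x hne)
  refine ⟨φ, ?_, isCompact_Icc.of_isClosed_subset (isClosed_tsupport φ) hts, hts.trans ?_, hderiv⟩
  · exact contDiff_infty_iff_deriv.mpr ⟨fun x => (hd x).differentiableAt, by rwa [hderiv]⟩
  · exact fun x hx => ⟨by linarith [hx.1], by linarith [hx.2]⟩

lemma exists_mem_testGraph_real {L : ℝ} {φ : ℝ → ℝ}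
    (h1 : ContDiff ℝ ((⊤ : ℕ∞) : WithTop ℕ∞) φ) (h2 : HasCompactSupport φ)
    (h3 : tsupport φ ⊆ box L) :
    ∃ p ∈ testGraph L, p.1 =ᵐ[volume.restrict (box L)] (fun x => (φ x : ℂ)) ∧
      p.2 =ᵐ[volume.restrict (box L)] fun x => ((deriv φ x : ℝ) : ℂ) := by
  have hs : tsupport (fun x => (φ x : ℂ)) ⊆ tsupport φ :=
    closure_mono fun x hx h => hx (by simp [h])
  obtain ⟨p, hp, hp1, hp2⟩ := exists_mem_testGraph (L := L) (φ := fun x => (φ x : ℂ))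
    (Complex.ofRealCLM.contDiff.comp h1)
    (h2.of_isClosed_subset (isClosed_tsupport _) hs) (hs.trans h3)
  refine ⟨p, hp, hp1, hp2.trans (Eventually.of_forall fun x => ?_)⟩
  exact ((h1.differentiable (by simp) x).hasDerivAt.ofReal_comp).deriv

/-- The lemma of du Bois-Reymond. -/
lemma exists_eq_smul_one {L : ℝ} (hL : 0 < L) {h : L2 L}
    (H : ∀ p ∈ testGraph L, inner ℂ p.2 h = 0) : ∃ c : ℂ, h = c • one L := by
  let f : ContDiffBump (0 : ℝ) := ⟨L / 8, L / 4, by positivity, by linarith⟩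
  let χ : ℝ → ℝ := f.normed volume
  have χ1 : ContDiff ℝ ((⊤ : ℕ∞) : WithTop ℕ∞) χ := f.contDiff_normed
  have χ2 : HasCompactSupport χ := f.hasCompactSupport_normed
  have χ3 : tsupport χ ⊆ box L := by
    rw [f.tsupport_normed_eq, Real.closedBall_eq_Icc]
    intro x hx
    have h1 := hx.1
    have h2 := hx.2
    simp only [f] at h1 h2
    exact ⟨by linarith, by linarith⟩
  have χ4 : ∫ x, χ x = 1 := f.integral_normed
  let c : ℂ := ∫ x, χ x • h x
  have hloc := locallyIntegrableOn_coeFn h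
  have hint : ∀ g : ℝ → ℝ, Continuous g → HasCompactSupport g → tsupport g ⊆ box L →
      Integrable fun x => g x • h x := by
    intro g g1 g2 g3
    have h5 : IntegrableOn (fun x => g x • h x) (tsupport g) volume :=
      (hloc.integrableOn_compact_subset g3 g2.isCompact).continuousOn_smul g1.continuousOn
        g2.isCompact
    refine (integrableOn_iff_integrable_of_support_subset fun x hx => ?_).mp h5
    by_contra hne
    exact hx (by simp [image_eq_zero_of_notMem_tsupport hne])
  have key : ∀ g : ℝ → ℝ, ContDiff ℝ ((⊤ : ℕ∞) : WithTop ℕ∞) g → HasCompactSupport g →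
      tsupport g ⊆ box L → ∫ x, g x • (h x - c) = 0 := by
    intro g g1 g2 g3
    have gi : Integrable g := g1.continuous.integrable_of_hasCompactSupport g2
    have χi : Integrable χ := χ1.continuous.integrable_of_hasCompactSupport χ2
    let η : ℝ → ℝ := fun x => g x - (∫ y, g y) * χ x
    have hηs : tsupport η ⊆ tsupport g ∪ tsupport χ := by
      refine closure_minimal (fun x hx => ?_) ((isClosed_tsupport g).union (isClosed_tsupport χ))
      by_contra hne
      rw [mem_union, not_or] at hne
      refine hx ?_
      simp only [η, image_eq_zero_of_notMem_tsupport hne.1, image_eq_zero_of_notMem_tsupport hne.2]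
      ring
    have η1 : ContDiff ℝ ((⊤ : ℕ∞) : WithTop ℕ∞) η := g1.sub (contDiff_const.mul χ1)
    have η2 : HasCompactSupport η :=
      (g2.isCompact.union χ2.isCompact).of_isClosed_subset (isClosed_tsupport _) hηs
    have η4 : ∫ x, η x = 0 := by
      rw [integral_sub gi (χi.const_mul _), integral_const_mul, χ4]
      ring
    obtain ⟨φ, φ1, φ2, φ3, φ4⟩ := exists_deriv_eq η1 η2 (hηs.trans (union_subset g3 χ3)) η4
    obtain ⟨p, hp, -, hp2⟩ := exists_mem_testGraph_real φ1 φ2 φ3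
    rw [φ4] at hp2
    have h6 := H p hp
    rw [inner_eq_integral_smul hp2 (hηs.trans (union_subset g3 χ3))] at h6
    have e1 : ∀ x, η x • h x = g x • h x - (∫ y, g y) • (χ x • h x) := by
      intro x
      simp only [η, sub_smul, mul_smul]
    simp_rw [e1] at h6
    rw [integral_sub (hint g g1.continuous g2 g3) ((hint χ χ1.continuous χ2 χ3).fun_smul _),
      integral_smul] at h6
    simp_rw [smul_sub]
    rw [integral_sub (hint g g1.continuous g2 g3) (gi.smul_const c), integral_smul_const]
    exact h6
  have hae := isOpen_Ioo.ae_eq_zero_of_integral_contDiff_smul_eq_zero (U := box L)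
    (f := fun x => h x - c) (hloc.sub (locallyIntegrableOn_const c)) key
  refine ⟨c, Lp.ext ?_⟩
  filter_upwards [Lp.coeFn_smul c (one L), coeFn_one L,
    (ae_restrict_iff' (measurableSet_box L)).mpr hae] with x h1 h2 h3
  rw [h1, Pi.smul_apply, h2, smul_eq_mul, mul_one]
  exact sub_eq_zero.mp h3

lemma eq_zero_of_forall_inner_eq_zero {L : ℝ} {h : L2 L}
    (H : ∀ p ∈ testGraph L, inner ℂ p.1 h = 0) : h = 0 := by
  have hae := isOpen_Ioo.ae_eq_zero_of_integral_contDiff_smul_eq_zero (U := box L)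
    (locallyIntegrableOn_coeFn h) fun g g1 g2 g3 => by
      obtain ⟨p, hp, hp1, -⟩ := exists_mem_testGraph_real g1 g2 g3
      rw [← inner_eq_integral_smul hp1 g3]
      exact H p hp
  refine Lp.ext ?_
  filter_upwards [Lp.coeFn_zero ℂ 2 (volume.restrict (box L)),
    (ae_restrict_iff' (measurableSet_box L)).mpr hae] with x h1 h2
  rw [h1, h2, Pi.zero_apply]

/-- The derivatives of test functions are dense in the orthogonal complement of the constants. -/
lemma mem_closure_deriv {L : ℝ} (hL : 0 < L) {g : L2 L} (hg : inner ℂ (one L) g = 0) :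
    g ∈ closure (((testGraph L).map (LinearMap.snd ℂ (L2 L) (L2 L)) : Submodule ℂ (L2 L)) :
      Set (L2 L)) := by
  rw [← Submodule.topologicalClosure_coe, ← Submodule.orthogonal_orthogonal_eq_closure,
    SetLike.mem_coe, Submodule.mem_orthogonal]
  intro h hh
  obtain ⟨c, rfl⟩ := exists_eq_smul_one hL fun p hp =>
    (Submodule.mem_orthogonal _ h).mp hh p.2 (Submodule.mem_map_of_mem hp)
  rw [inner_smul_left, hg, mul_zero]

/-- A continuous relation between `g` and its primitive holds on the Sobolev space if it holds for
test functions. -/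
lemma forall_of_testGraph {L : ℝ} (hL : 0 < L) {A : Set (L2 L)} (hA : IsClosed A)
    (h : ∀ p ∈ testGraph L, p.2 ∈ A) {g : L2 L} (hg : inner ℂ (one L) g = 0) : g ∈ A := by
  refine closure_minimal ?_ hA (mem_closure_deriv hL hg)
  rintro _ ⟨p, hp, rfl⟩
  exact h p hp

lemma mem_sobolevGraph_iff {L : ℝ} (hL : 0 < L) {p : L2 L × L2 L} :
    p ∈ sobolevGraph L ↔ p.1 = primitive L p.2 ∧ inner ℂ (one L) p.2 = 0 := by
  constructor
  · intro hp
    have hc : IsClosed {p : L2 L × L2 L | p.1 = primitive L p.2 ∧ inner ℂ (one L) p.2 = 0} :=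
      (isClosed_eq continuous_fst ((primitive L).continuous.comp continuous_snd)).inter
        (isClosed_eq (continuous_const.inner continuous_snd) continuous_const)
    have hsub : (testGraph L : Set (L2 L × L2 L)) ⊆
        {p : L2 L × L2 L | p.1 = primitive L p.2 ∧ inner ℂ (one L) p.2 = 0} := fun p hp =>
      ⟨fst_eq_primitive_of_mem_testGraph hp, inner_one_of_mem_testGraph hp⟩
    exact closure_minimal hsub hc hp
  · rintro ⟨h1, h2⟩
    have hA : IsClosed {g : L2 L | (primitive L g, g) ∈ sobolevGraph L} :=
      (Submodule.isClosed_topologicalClosure _).preimage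
        ((primitive L).continuous.prodMk continuous_id)
    have := forall_of_testGraph hL hA (fun p hp => by
      rw [Set.mem_ofPred_eq, ← fst_eq_primitive_of_mem_testGraph hp]
      exact Submodule.le_topologicalClosure _ hp) h2
    rw [Set.mem_ofPred_eq, ← h1] at this
    exact this

/-! ### Inverses of nonnegative operators given by quadratic forms -/

section Abstract

variable {H : Type} [NormedAddCommGroup H] [InnerProductSpace ℂ H]

/-- The eigenspace for the eigenvalue `E` of the inverse of `T`. -/
def inverseEigenspace (T : H →L[ℂ] H) (E : ℝ) : Submodule ℂ H :=
  LinearMap.eqLocus ((E : ℂ) • (T : H →ₗ[ℂ] H)) LinearMap.id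

lemma mem_inverseEigenspace {T : H →L[ℂ] H} {E : ℝ} {x : H} :
    x ∈ inverseEigenspace T E ↔ (E : ℂ) • T x = x := Iff.rfl

/-- The span of the eigenvectors of the inverse of `T` for eigenvalues at most `E`. -/
def inverseSpan (T : H →L[ℂ] H) (E : ℝ) : Submodule ℂ H :=
  ⨆ F : Iic E, inverseEigenspace T F

lemma inverseEigenspace_le_inverseSpan (T : H →L[ℂ] H) {E F : ℝ} (h : F ≤ E) :
    inverseEigenspace T F ≤ inverseSpan T E :=
  le_iSup (fun F : Iic E => inverseEigenspace T F) ⟨F, h⟩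

lemma inverseSpan_mono (T : H →L[ℂ] H) : Monotone (inverseSpan T) := fun _ _ h =>
  iSup_le fun F => inverseEigenspace_le_inverseSpan T (F.2.trans h)

lemma apply_of_mem_inverseEigenspace {T : H →L[ℂ] H} {E : ℝ} {x : H}
    (hx : x ∈ inverseEigenspace T E) : T x = ((E⁻¹ : ℝ) : ℂ) • x := by
  rw [mem_inverseEigenspace] at hx
  rcases eq_or_ne E 0 with rfl | hE
  · have : x = 0 := by rw [← hx]; simp
    simp [this]
  · nth_rewrite 2 [← hx]
    rw [smul_smul, ← Complex.ofReal_mul, inv_mul_cancel₀ hE, Complex.ofReal_one, one_smul]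

lemma eq_zero_of_mem_inverseEigenspace {T : H →L[ℂ] H} (hT : T.IsPositive) {E : ℝ} (hE : E ≤ 0)
    {x : H} (hx : x ∈ inverseEigenspace T E) : x = 0 := by
  rw [mem_inverseEigenspace] at hx
  have h1 := hT.re_inner_nonneg_left x
  have h2 : ‖x‖ ^ 2 = E * RCLike.re (inner ℂ (T x) x) := by
    rw [← @inner_self_eq_norm_sq ℂ]
    nth_rewrite 1 [← hx]
    rw [inner_smul_left]
    simp
  have h3 : ‖x‖ ^ 2 ≤ 0 := by
    rw [h2]
    exact mul_nonpos_of_nonpos_of_nonneg hE h1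
  simpa using le_antisymm h3 (by positivity)

lemma inner_eq_zero_of_mem_inverseEigenspace {T : H →L[ℂ] H} (hT : T.IsPositive) {E F : ℝ}
    (hEF : E ≠ F) {x y : H} (hx : x ∈ inverseEigenspace T E) (hy : y ∈ inverseEigenspace T F) :
    inner ℂ x y = 0 := by
  rw [mem_inverseEigenspace] at hx hy
  have hs : inner ℂ (T x) y = inner ℂ x (T y) := hT.1 x y
  have h1 : inner ℂ x y = (E : ℂ) * inner ℂ (T x) y := by
    nth_rewrite 1 [← hx]
    simp
  have h2 : inner ℂ x y = (F : ℂ) * inner ℂ x (T y) := by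
    nth_rewrite 1 [← hy]
    simp
  have h3 : ((F : ℂ) - E) * inner ℂ x y = 0 := by
    linear_combination (F : ℂ) * h1 - (E : ℂ) * h2 + (E : ℂ) * F * hs
  rcases mul_eq_zero.mp h3 with h | h
  · exact absurd (by exact_mod_cast (sub_eq_zero.mp h).symm) hEF
  · exact h

/-- On the span of the eigenvectors for eigenvalues at most `E` the form of the inverse of `T` is
bounded by `E`. -/
lemma re_inner_le_of_mem_inverseSpan {T : H →L[ℂ] H} (hT : T.IsPositive) {E : ℝ} {f : H}
    (hf : f ∈ inverseSpan T E) : RCLike.re (inner ℂ (T f) f) ≤ E * ‖T f‖ ^ 2 := by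
  obtain ⟨a, ha, rfl⟩ := (Submodule.mem_iSup_iff_exists_finsupp _ _).mp hf
  have hTa : ∀ F : Iic E, T (a F) = (((F : ℝ)⁻¹ : ℝ) : ℂ) • a F := fun F =>
    apply_of_mem_inverseEigenspace (ha F)
  have h0 : 0 ≤ RCLike.re (inner ℂ (T (a.sum fun _ x => x))
      ((E : ℂ) • T (a.sum fun _ x => x) - a.sum fun _ x => x)) := by
    rw [Finsupp.sum, map_sum, Finset.smul_sum, ← Finset.sum_sub_distrib, sum_inner]
    simp_rw [inner_sum]
    rw [map_sum]
    refine Finset.sum_nonneg fun F hF => ?_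
    have hzero : ∀ G ∈ a.support, G ≠ F →
        inner ℂ (T (a F)) ((E : ℂ) • T (a G) - a G) = 0 := by
      intro G _ hGF
      have h := inner_eq_zero_of_mem_inverseEigenspace hT
        (fun h => hGF (Subtype.ext h.symm)) (ha F) (ha G)
      rw [hTa, hTa]
      simp [h]
    rw [Finset.sum_eq_single_of_mem F hF hzero]
    rcases le_or_gt (F : ℝ) 0 with hF0 | hF0
    · rw [eq_zero_of_mem_inverseEigenspace hT hF0 (ha F)]
      simp
    · have e : inner ℂ (T (a F)) ((E : ℂ) • T (a F) - a F) =
          (((F : ℝ)⁻¹ * (E * (F : ℝ)⁻¹ - 1) * ‖a F‖ ^ 2 : ℝ) : ℂ) := by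
        have e' : (E : ℂ) • ((((F : ℝ)⁻¹ : ℝ) : ℂ) • a F) - a F =
            ((E * (F : ℝ)⁻¹ - 1 : ℝ) : ℂ) • a F := by
          rw [smul_smul]
          push_cast
          rw [sub_smul, one_smul]
        rw [hTa, e', inner_smul_left, inner_smul_right, inner_self_eq_norm_sq_to_K,
          Complex.conj_ofReal]
        push_cast
        simp only [Complex.coe_algebraMap]
        ring
      rw [e]
      have hE1 : 1 ≤ E * (F : ℝ)⁻¹ := by
        rw [← div_eq_mul_inv, one_le_div hF0]
        exact F.2
      have : 0 ≤ (F : ℝ)⁻¹ * (E * (F : ℝ)⁻¹ - 1) * ‖a F‖ ^ 2 :=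
        mul_nonneg (mul_nonneg (by positivity) (by linarith)) (by positivity)
      simpa only [RCLike.re_to_complex, Complex.ofReal_re] using this
  rw [inner_sub_right, inner_smul_right, map_sub, inner_self_eq_norm_sq_to_K] at h0
  have e2 : RCLike.re ((E : ℂ) * ((‖T (a.sum fun _ x => x)‖ : ℂ)) ^ 2) =
      E * ‖T (a.sum fun _ x => x)‖ ^ 2 := by
    rw [← Complex.ofReal_pow, ← Complex.ofReal_mul]
    exact Complex.ofReal_re _
  replace h0 : 0 ≤ RCLike.re ((E : ℂ) * ((‖T (a.sum fun _ x => x)‖ : ℂ)) ^ 2) -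
    RCLike.re (inner ℂ (T (a.sum fun _ x => x)) (a.sum fun _ x => x)) := h0
  rw [e2] at h0
  linarith

lemma exists_ne_zero_of_lt_rank {W : Submodule ℂ H} {m : ℕ} (F : Fin m → H →ₗ[ℂ] ℂ)
    (hW : (m : Cardinal) < Module.rank ℂ W) : ∃ f ∈ W, f ≠ 0 ∧ ∀ i, F i f = 0 := by
  by_contra! hcon
  have hinj : Function.Injective ((LinearMap.pi F).comp W.subtype) := by
    rw [← LinearMap.ker_eq_bot, LinearMap.ker_eq_bot']
    intro x hx
    by_contra hne
    obtain ⟨i, hi⟩ := hcon x x.2 (fun h => hne (Subtype.ext h))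
    exact hi (congrFun hx i)
  have h := LinearMap.rank_le_of_injective _ hinj
  rw [rank_fin_fun] at h
  exact not_lt.mpr h hW

variable [CompleteSpace H]

/-- The inverse of a compact, injective, nonnegative operator on an infinite-dimensional space has
infinitely many eigenvalues. -/
lemma exists_le_rank_inverseSpan {T : H →L[ℂ] H} (hT : T.IsPositive) (hc : IsCompactOperator T)
    (hinj : ∀ x, T x = 0 → x = 0) (hH : ¬ FiniteDimensional ℂ H) (j : ℕ) :
    ∃ E : ℝ, (j : Cardinal) ≤ Module.rank ℂ (inverseSpan T E) := by
  let Y : Submodule ℂ H := ⨆ n : ℕ, inverseSpan T n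
  have hdir : Directed (· ≤ ·) fun n : ℕ => inverseSpan T (n : ℝ) :=
    Monotone.directed_le fun m n h => inverseSpan_mono T (by exact_mod_cast h)
  have hY : Yᗮ = ⊥ := by
    rw [eq_bot_iff, ← ContinuousLinearMap.orthogonalComplement_iSup_eigenspaces_eq_bot hc hT.1]
    refine Submodule.orthogonal_le (iSup_le fun μ => ?_)
    by_cases hμ : Module.End.HasEigenvalue (T : Module.End ℂ H) μ
    · intro x hx
      have hx' : T x = μ • x := Module.End.mem_eigenspace_iff.mp hx
      have hre : ((μ.re : ℝ) : ℂ) = μ := Complex.conj_eq_iff_re.mp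
        (LinearMap.IsSymmetric.conj_eigenvalue_eq_self hT.1 hμ)
      rcases eq_or_ne μ 0 with h0 | h0
      · rw [hinj x (by rw [hx', h0, zero_smul])]
        exact Submodule.zero_mem _
      · have hmem : x ∈ inverseEigenspace T (μ.re)⁻¹ := by
          rw [mem_inverseEigenspace, hx', smul_smul, Complex.ofReal_inv, hre, inv_mul_cancel₀ h0,
            one_smul]
        refine (Submodule.mem_iSup_of_directed _ hdir).mpr ⟨⌈(μ.re)⁻¹⌉₊, ?_⟩
        exact inverseEigenspace_le_inverseSpan T (Nat.le_ceil _) hmem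
    · rw [Module.End.hasEigenvalue_iff, not_not] at hμ
      rw [hμ]
      exact bot_le
  have hYinf : ¬ FiniteDimensional ℂ Y := by
    intro hfin
    have : Y = ⊤ := Submodule.orthogonal_eq_bot_iff.mp hY
    rw [this] at hfin
    exact hH (Module.Finite.equiv (Submodule.topEquiv : (⊤ : Submodule ℂ H) ≃ₗ[ℂ] H))
  have hrank : (j : Cardinal) ≤ Module.rank ℂ Y := by
    have : Cardinal.aleph0 ≤ Module.rank ℂ Y := by
      by_contra hlt
      exact hYinf (Module.rank_lt_aleph0_iff.mp (not_le.mp hlt))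
    exact (Cardinal.natCast_lt_aleph0 (n := j)).le.trans this
  obtain ⟨s, hs, hli⟩ := le_rank_iff_exists_linearIndependent_finset.mp hrank
  have hex : ∀ x : Y, ∃ n : ℕ, (x : H) ∈ inverseSpan T (n : ℝ) := fun x =>
    (Submodule.mem_iSup_of_directed _ hdir).mp x.2
  choose n hn using hex
  refine ⟨((s.sup n : ℕ) : ℝ), ?_⟩
  have hmem : ∀ x : s, ((x : Y) : H) ∈ inverseSpan T ((s.sup n : ℕ) : ℝ) := fun x =>
    inverseSpan_mono T (by exact_mod_cast Finset.le_sup (f := n) x.2) (hn x)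
  have hli2 : LinearIndependent ℂ fun x : s =>
      (⟨((x : Y) : H), hmem x⟩ : inverseSpan T ((s.sup n : ℕ) : ℝ)) := by
    have h1 : LinearIndependent ℂ fun x : s => ((x : Y) : H) :=
      hli.map' Y.subtype (Submodule.ker_subtype Y)
    exact LinearIndependent.of_comp (Submodule.subtype _) h1
  have := hli2.cardinal_le_rank
  simpa [hs] using this

/-- The operator of the form `(g, g') ↦ ⟪g, g'⟫ + ⟪B g, M B g'⟫`. -/
def formOp (B M : H →L[ℂ] H) : H →L[ℂ] H := 1 + B.adjoint ∘L M ∘L B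

/-- The solution operator of `⟪g, g'⟫ + ⟪B g, M ψ⟫ = ⟪B g, f⟫` for all `g`, where `ψ = B g'`; it
maps `f` to `ψ`. -/
def solutionOp (B M : H →L[ℂ] H) : H →L[ℂ] H :=
  B ∘L Ring.inverse (formOp B M) ∘L B.adjoint

lemma inner_formOp (B M : H →L[ℂ] H) (x y : H) :
    inner ℂ x (formOp B M y) = inner ℂ x y + inner ℂ (B x) (M (B y)) := by
  simp [formOp, ContinuousLinearMap.adjoint_inner_right]

lemma isPositive_formOp {B M : H →L[ℂ] H} (hM : M.IsPositive) : (formOp B M).IsPositive :=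
  ContinuousLinearMap.isPositive_one.add (hM.adjoint_conj B)

lemma norm_sq_le_re_inner_formOp {B M : H →L[ℂ] H} (hM : M.IsPositive) (x : H) :
    ‖x‖ ^ 2 ≤ RCLike.re (inner ℂ x (formOp B M x)) := by
  rw [inner_formOp, map_add, inner_self_eq_norm_sq]
  have := hM.re_inner_nonneg_right (B x)
  linarith

lemma isUnit_formOp {B M : H →L[ℂ] H} (hM : M.IsPositive) : IsUnit (formOp B M) := by
  refine ContinuousLinearMap.isUnit_of_forall_le_norm_inner_map _ (c := 1) one_pos fun x => ?_
  rw [NNReal.coe_one, mul_one, norm_inner_symm]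
  exact (norm_sq_le_re_inner_formOp hM x).trans (RCLike.re_le_norm _)

lemma formOp_inverse_apply {B M : H →L[ℂ] H} (hM : M.IsPositive) (x : H) :
    formOp B M (Ring.inverse (formOp B M) x) = x := by
  have h := Ring.mul_inverse_cancel _ (isUnit_formOp (B := B) hM)
  exact congrArg (fun A : H →L[ℂ] H => A x) h

lemma inverse_formOp_apply {B M : H →L[ℂ] H} (hM : M.IsPositive) (x : H) :
    Ring.inverse (formOp B M) (formOp B M x) = x := by
  have h := Ring.inverse_mul_cancel _ (isUnit_formOp (B := B) hM)
  exact congrArg (fun A : H →L[ℂ] H => A x) h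

lemma isPositive_inverse_formOp {B M : H →L[ℂ] H} (hM : M.IsPositive) :
    (Ring.inverse (formOp B M)).IsPositive := by
  refine ⟨fun x y => ?_, fun x => ?_⟩
  · have h := (isPositive_formOp (B := B) hM).1 (Ring.inverse (formOp B M) x)
      (Ring.inverse (formOp B M) y)
    simp only [ContinuousLinearMap.coe_coe, formOp_inverse_apply hM] at h ⊢
    exact h.symm
  · have h := (isPositive_formOp (B := B) hM).re_inner_nonneg_right (Ring.inverse (formOp B M) x)
    rw [formOp_inverse_apply hM] at h
    exact h

lemma isPositive_solutionOp {B M : H →L[ℂ] H} (hM : M.IsPositive) : (solutionOp B M).IsPositive :=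
  (isPositive_inverse_formOp hM).conj_adjoint B

lemma isCompactOperator_solutionOp {B : H →L[ℂ] H} (M : H →L[ℂ] H) (hB : IsCompactOperator B) :
    IsCompactOperator (solutionOp B M) :=
  hB.comp_clm (Ring.inverse (formOp B M) ∘L B.adjoint)

lemma inner_solutionOp {B M : H →L[ℂ] H} (hM : M.IsPositive) (f : H) :
    inner ℂ (solutionOp B M f) f = inner ℂ (Ring.inverse (formOp B M) (B.adjoint f))
      (formOp B M (Ring.inverse (formOp B M) (B.adjoint f))) := by
  rw [formOp_inverse_apply hM, ContinuousLinearMap.adjoint_inner_right]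
  rfl

lemma solutionOp_injective {B M : H →L[ℂ] H} (hM : M.IsPositive)
    (hB : ∀ x, B.adjoint x = 0 → x = 0) (f : H) (hf : solutionOp B M f = 0) : f = 0 := by
  have h1 := inner_solutionOp (B := B) hM f
  rw [hf, inner_zero_left] at h1
  have h2 := norm_sq_le_re_inner_formOp (B := B) hM (Ring.inverse (formOp B M) (B.adjoint f))
  rw [← h1, map_zero] at h2
  have h3 : Ring.inverse (formOp B M) (B.adjoint f) = 0 := by
    simpa using le_antisymm h2 (by positivity)
  refine hB f ?_
  rw [← formOp_inverse_apply (B := B) hM (B.adjoint f), h3, map_zero]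

/-- The Rayleigh quotient of any vector bounds the lowest eigenvalue from above. -/
lemma exists_inverseEigenspace_ne_bot {B M : H →L[ℂ] H} (hM : M.IsPositive)
    (hB : IsCompactOperator B) {g : H} (hg : B g ≠ 0) :
    ∃ E : ℝ, 0 < E ∧ inverseEigenspace (solutionOp B M) E ≠ ⊥ ∧
      E * ‖B g‖ ^ 2 ≤ RCLike.re (inner ℂ g (formOp B M g)) := by
  set T := solutionOp B M with hTdef
  have hT : T.IsPositive := isPositive_solutionOp hM
  let k := Ring.inverse (formOp B M) (B.adjoint (B g))
  have hkA : formOp B M k = B.adjoint (B g) := formOp_inverse_apply hM _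
  have hBk : B k = T (B g) := rfl
  have hgk : inner ℂ g (formOp B M k) = ((‖B g‖ : ℂ)) ^ 2 := by
    rw [hkA, ContinuousLinearMap.adjoint_inner_right, inner_self_eq_norm_sq_to_K]
    rfl
  have hkg : inner ℂ k (formOp B M g) = ((‖B g‖ : ℂ)) ^ 2 := by
    have h : inner ℂ (formOp B M k) g = inner ℂ k (formOp B M g) :=
      (isPositive_formOp (B := B) hM).1 k g
    rw [← h, hkA, ContinuousLinearMap.adjoint_inner_left, inner_self_eq_norm_sq_to_K]
    rfl
  have hkk : RCLike.re (inner ℂ k (formOp B M k)) ≤ ‖T‖ * ‖B g‖ ^ 2 := by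
    rw [hkA, ContinuousLinearMap.adjoint_inner_right, hBk]
    calc RCLike.re (inner ℂ (T (B g)) (B g)) ≤ ‖T (B g)‖ * ‖B g‖ :=
          (RCLike.re_le_norm _).trans (norm_inner_le_norm _ _)
      _ ≤ (‖T‖ * ‖B g‖) * ‖B g‖ :=
          mul_le_mul_of_nonneg_right (T.le_opNorm _) (norm_nonneg _)
      _ = _ := by ring
  have hBg : 0 < ‖B g‖ := norm_pos_iff.mpr hg
  -- the form is nonnegative at `g - t k`; the choice `t = 1 / ‖T‖` is optimal
  have hquad : ∀ t : ℝ, 2 * t * ‖B g‖ ^ 2 - t ^ 2 * (‖T‖ * ‖B g‖ ^ 2) ≤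
      RCLike.re (inner ℂ g (formOp B M g)) := by
    intro t
    have h := (isPositive_formOp (B := B) hM).re_inner_nonneg_right (g - (t : ℂ) • k)
    have e : inner ℂ (g - (t : ℂ) • k) (formOp B M (g - (t : ℂ) • k)) =
        inner ℂ g (formOp B M g) - ((2 * t * ‖B g‖ ^ 2 : ℝ) : ℂ) +
          ((t ^ 2 : ℝ) : ℂ) * inner ℂ k (formOp B M k) := by
      rw [map_sub, map_smul]
      simp only [inner_sub_left, inner_sub_right, inner_smul_left, inner_smul_right, hgk, hkg,
        Complex.conj_ofReal]
      push_cast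
      ring
    rw [e, map_add, map_sub] at h
    have e1 : RCLike.re (((2 * t * ‖B g‖ ^ 2 : ℝ) : ℂ)) = 2 * t * ‖B g‖ ^ 2 :=
      Complex.ofReal_re _
    have e2 : RCLike.re (((t ^ 2 : ℝ) : ℂ) * inner ℂ k (formOp B M k)) =
        t ^ 2 * RCLike.re (inner ℂ k (formOp B M k)) := Complex.re_ofReal_mul _ _
    rw [e1, e2] at h
    have := mul_le_mul_of_nonneg_left hkk (sq_nonneg t)
    linarith
  have hT0 : 0 < ‖T‖ := by
    rcases (norm_nonneg T).eq_or_lt with h | h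
    · exfalso
      let q := RCLike.re (inner ℂ g (formOp B M g))
      have h2 := hquad ((q + 1) / ‖B g‖ ^ 2)
      rw [← h] at h2
      have e : 2 * ((q + 1) / ‖B g‖ ^ 2) * ‖B g‖ ^ 2 = 2 * (q + 1) := by
        field_simp
      rw [e, zero_mul, mul_zero] at h2
      have h3 : 0 ≤ q := (sq_nonneg _).trans (norm_sq_le_re_inner_formOp (B := B) hM g)
      change 2 * (q + 1) - 0 ≤ q at h2
      linarith
    · exact h
  have hne : Nontrivial H := ⟨B g, 0, hg⟩
  obtain ⟨z, hz, hzn⟩ := spectrum.exists_nnnorm_eq_spectralRadius T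
  rw [ContinuousLinearMap.spectralRadius_eq_nnnorm T hT.isSelfAdjoint] at hzn
  have hzn' : ‖z‖ = ‖T‖ := by
    have := ENNReal.coe_inj.mp hzn
    exact congrArg NNReal.toReal this
  have hz0 : z ≠ 0 := by
    rw [← norm_pos_iff, hzn']
    exact hT0
  have hev := ((isCompactOperator_solutionOp M hB).hasEigenvalue_iff_mem_spectrum hz0).mpr hz
  have hre : ((z.re : ℝ) : ℂ) = z := Complex.conj_eq_iff_re.mp
    (LinearMap.IsSymmetric.conj_eigenvalue_eq_self hT.1 hev)
  have hev' : Module.End.HasEigenvalue (T : Module.End ℂ H) ((z.re : ℝ) : ℂ) := by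
    rw [hre]
    exact hev
  have hzpos : 0 ≤ z.re := eigenvalue_nonneg_of_nonneg hev' fun x => hT.re_inner_nonneg_right x
  have hzr : z.re = ‖T‖ := by
    rw [← hzn', ← hre, Complex.norm_real, Real.norm_of_nonneg hzpos, Complex.ofReal_re]
  refine ⟨‖T‖⁻¹, inv_pos.mpr hT0, ?_, ?_⟩
  · obtain ⟨x, hx, hx0⟩ := hev'.exists_hasEigenvector
    have hx' : T x = ((z.re : ℝ) : ℂ) • x := Module.End.mem_eigenspace_iff.mp hx
    refine (Submodule.ne_bot_iff _).mpr ⟨x, ?_, hx0⟩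
    rw [mem_inverseEigenspace, hx', smul_smul, hzr, ← Complex.ofReal_mul,
      inv_mul_cancel₀ hT0.ne', Complex.ofReal_one, one_smul]
  · have h := hquad ‖T‖⁻¹
    have e : 2 * ‖T‖⁻¹ * ‖B g‖ ^ 2 - ‖T‖⁻¹ ^ 2 * (‖T‖ * ‖B g‖ ^ 2) = ‖T‖⁻¹ * ‖B g‖ ^ 2 := by
      field_simp
      ring
    rwa [e] at h

end Abstract

/-! ### The Dirichlet operator and its eigenvalues -/

section DirichletOperator

/-- Potentials that are measurable, nonnegative, and bounded on the interval. -/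
structure IsBoundedPotential (L : ℝ) (V : ℝ → ℝ) : Prop where
  measurable : Measurable V
  nonneg : ∀ x, 0 ≤ V x
  bounded : ∃ K, ∀ x ∈ box L, V x ≤ K

variable {L : ℝ} {V : ℝ → ℝ}

lemma IsBoundedPotential.memLp (hV : IsBoundedPotential L V) :
    MemLp (fun x => (V x : ℂ)) ∞ (volume.restrict (box L)) := by
  obtain ⟨K, hK⟩ := hV.bounded
  refine memLp_top_of_bound (Complex.measurable_ofReal.comp hV.measurable).aestronglyMeasurable K ?_
  filter_upwards [ae_restrict_mem (measurableSet_box L)] with x hx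
  rw [Complex.norm_real, Real.norm_of_nonneg (hV.nonneg x)]
  exact hK x hx

/-- Multiplication by a bounded potential. -/
def mulOp (hV : IsBoundedPotential L V) : L2 L →L[ℂ] L2 L :=
  (ContinuousLinearMap.mul ℂ ℂ).holderL (volume.restrict (box L)) ∞ 2 2 (hV.memLp.toLp _)

lemma coeFn_mulOp (hV : IsBoundedPotential L V) (g : L2 L) :
    mulOp hV g =ᵐ[volume.restrict (box L)] fun x => (V x : ℂ) * g x := by
  filter_upwards [(ContinuousLinearMap.mul ℂ ℂ).coeFn_holder (r := 2) (hV.memLp.toLp _) g,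
    hV.memLp.coeFn_toLp] with x h1 h2
  rw [mulOp, ContinuousLinearMap.holderL_apply_apply, h1, h2, ContinuousLinearMap.mul_apply']

lemma re_inner_mulOp (hV : IsBoundedPotential L V) (g : L2 L) :
    RCLike.re (inner ℂ g (mulOp hV g)) = ∫ x in box L, V x * ‖g x‖ ^ 2 := by
  rw [L2.inner_def, ← integral_re (L2.integrable_inner g (mulOp hV g))]
  refine integral_congr_ae ?_
  filter_upwards [coeFn_mulOp hV g] with x hx
  rw [hx, ← smul_eq_mul, inner_smul_right, inner_self_eq_norm_sq_to_K]
  change RCLike.re ((V x : ℂ) * (‖g x‖ : ℂ) ^ 2) = _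
  rw [← Complex.ofReal_pow, ← Complex.ofReal_mul]
  exact Complex.ofReal_re _

lemma isPositive_mulOp (hV : IsBoundedPotential L V) : (mulOp hV).IsPositive := by
  refine ⟨fun f g => ?_, fun g => ?_⟩
  · simp only [ContinuousLinearMap.coe_coe]
    rw [L2.inner_def, L2.inner_def]
    refine integral_congr_ae ?_
    filter_upwards [coeFn_mulOp hV f, coeFn_mulOp hV g] with x h1 h2
    rw [h1, h2, ← smul_eq_mul, ← smul_eq_mul, inner_smul_left, inner_smul_right,
      Complex.conj_ofReal]
  · have h : 0 ≤ RCLike.re (inner ℂ g (mulOp hV g)) := by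
      rw [re_inner_mulOp]
      exact integral_nonneg fun x => mul_nonneg (hV.nonneg x) (by positivity)
    rwa [ContinuousLinearMap.reApplyInnerSelf, ← inner_re_symm]

/-- The orthogonal projection onto the functions of mean zero. -/
def meanZeroProj (L : ℝ) : L2 L →L[ℂ] L2 L := (ℂ ∙ one L)ᗮ.starProjection

lemma meanZeroProj_eq_self {g : L2 L} (hg : inner ℂ (one L) g = 0) : meanZeroProj L g = g :=
  Submodule.starProjection_eq_self_iff.mpr
    (Submodule.mem_orthogonal_singleton_iff_inner_right.mpr hg)

lemma meanZeroProj_one : meanZeroProj L (one L) = 0 := by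
  rw [meanZeroProj, Submodule.starProjection_apply_eq_zero_iff]
  exact Submodule.le_orthogonal_orthogonal _ (Submodule.mem_span_singleton_self _)

/-- The operator that maps `g` to the primitive of its mean-zero part; its range is `H¹₀`. -/
def dirichletPrimitive (L : ℝ) : L2 L →L[ℂ] L2 L := primitive L ∘L meanZeroProj L

lemma dirichletPrimitive_apply {g : L2 L} (hg : inner ℂ (one L) g = 0) :
    dirichletPrimitive L g = primitive L g := by
  rw [dirichletPrimitive, ContinuousLinearMap.comp_apply, meanZeroProj_eq_self hg]

lemma inner_one_adjoint (f : L2 L) : inner ℂ (one L) ((dirichletPrimitive L).adjoint f) = 0 := by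
  rw [ContinuousLinearMap.adjoint_inner_right, dirichletPrimitive, ContinuousLinearMap.comp_apply,
    meanZeroProj_one, map_zero, inner_zero_left]

lemma isCompactOperator_dirichletPrimitive (hL : 0 < L) :
    IsCompactOperator (dirichletPrimitive L) :=
  (isCompactOperator_primitive hL).comp_clm (meanZeroProj L)

lemma inner_test_adjoint {p : L2 L × L2 L} (hp : p ∈ testGraph L) (f : L2 L) :
    inner ℂ p.2 ((dirichletPrimitive L).adjoint f) = inner ℂ p.1 f := by
  rw [ContinuousLinearMap.adjoint_inner_right, dirichletPrimitive_apply
    (inner_one_of_mem_testGraph hp), ← fst_eq_primitive_of_mem_testGraph hp]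

lemma adjoint_dirichletPrimitive_injective (f : L2 L) (hf : (dirichletPrimitive L).adjoint f = 0) :
    f = 0 :=
  eq_zero_of_forall_inner_eq_zero fun p hp => by
    rw [← inner_test_adjoint hp, hf, inner_zero_right]

/-- The inverse of the Dirichlet operator. -/
def dirichletInverse (hV : IsBoundedPotential L V) : L2 L →L[ℂ] L2 L :=
  solutionOp (dirichletPrimitive L) (mulOp hV)

lemma inner_one_inverse_formOp (hV : IsBoundedPotential L V) (f : L2 L) :
    inner ℂ (one L) (Ring.inverse (formOp (dirichletPrimitive L) (mulOp hV))
      ((dirichletPrimitive L).adjoint f)) = 0 := by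
  have h := formOp_inverse_apply (B := dirichletPrimitive L) (isPositive_mulOp hV)
    ((dirichletPrimitive L).adjoint f)
  set g := Ring.inverse (formOp (dirichletPrimitive L) (mulOp hV))
    ((dirichletPrimitive L).adjoint f)
  have h2 : g = (dirichletPrimitive L).adjoint (f - mulOp hV (dirichletPrimitive L g)) := by
    rw [map_sub, ← h]
    simp [formOp]
  rw [h2]
  exact inner_one_adjoint _

lemma mem_schrodingerGraph_iff (hL : 0 < L) (hV : IsBoundedPotential L V) {p : L2 L × L2 L} :
    p ∈ schrodingerGraph L V ↔ dirichletInverse hV p.2 = p.1 := by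
  have hM := isPositive_mulOp hV
  constructor
  · rintro ⟨g, w, h1, h2, h3⟩
    obtain ⟨h4, h5⟩ := (mem_sobolevGraph_iff hL).mp h1
    simp only at h4 h5
    have hw : w = mulOp hV p.1 := by
      refine Lp.ext ?_
      filter_upwards [h2, coeFn_mulOp hV p.1] with x hx hx'
      rw [hx, hx']
    have hBg : dirichletPrimitive L g = p.1 := by rw [dirichletPrimitive_apply h5, h4]
    -- the weak equation extends from test functions to all functions of mean zero
    have hall : ∀ χ : L2 L, inner ℂ (one L) χ = 0 →
        inner ℂ χ (g + (dirichletPrimitive L).adjoint (w - p.2)) = 0 := by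
      intro χ hχ
      refine forall_of_testGraph hL (A := {χ | inner ℂ χ
        (g + (dirichletPrimitive L).adjoint (w - p.2)) = 0})
        (isClosed_eq (continuous_id.inner continuous_const) continuous_const) (fun q hq => ?_) hχ
      rw [Set.mem_ofPred_eq, inner_add_right, inner_test_adjoint hq, inner_sub_right, ← h3 q hq]
      ring
    have hz : g + (dirichletPrimitive L).adjoint (w - p.2) = 0 := by
      refine inner_self_eq_zero.mp (hall _ ?_)
      rw [inner_add_right, h5, inner_one_adjoint, add_zero]
    have hform : formOp (dirichletPrimitive L) (mulOp hV) g =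
        (dirichletPrimitive L).adjoint p.2 := by
      have e : formOp (dirichletPrimitive L) (mulOp hV) g =
          g + (dirichletPrimitive L).adjoint (mulOp hV (dirichletPrimitive L g)) := by simp [formOp]
      rw [e, hBg, ← hw, ← sub_eq_zero, ← hz, map_sub]
      abel
    rw [dirichletInverse, solutionOp, ContinuousLinearMap.comp_apply,
      ContinuousLinearMap.comp_apply, ← hform, inverse_formOp_apply hM, hBg]
  · intro hp
    set g := Ring.inverse (formOp (dirichletPrimitive L) (mulOp hV))
      ((dirichletPrimitive L).adjoint p.2) with hg
    have hone : inner ℂ (one L) g = 0 := inner_one_inverse_formOp hV p.2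
    have hBg : dirichletPrimitive L g = p.1 := hp
    have hJg : primitive L g = p.1 := by rw [← dirichletPrimitive_apply hone, hBg]
    refine ⟨g, mulOp hV p.1, (mem_sobolevGraph_iff hL).mpr ⟨hJg.symm, hone⟩, coeFn_mulOp hV p.1,
      fun q hq => ?_⟩
    rw [← inner_test_adjoint hq p.2, ← formOp_inverse_apply (B := dirichletPrimitive L) hM
      ((dirichletPrimitive L).adjoint p.2), ← hg, inner_formOp, hBg,
      dirichletPrimitive_apply (inner_one_of_mem_testGraph hq),
      ← fst_eq_primitive_of_mem_testGraph hq]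

lemma eigenspace_eq (hL : 0 < L) (hV : IsBoundedPotential L V) (E : ℝ) :
    eigenspace L V E = inverseEigenspace (dirichletInverse hV) E := by
  ext x
  have h : x ∈ eigenspace L V E ↔ (x, (E : ℂ) • x) ∈ schrodingerGraph L V := Iff.rfl
  rw [h, mem_schrodingerGraph_iff hL hV, mem_inverseEigenspace, map_smul]

lemma eigenvalueCount_eq (hL : 0 < L) (hV : IsBoundedPotential L V) (E : ℝ) :
    eigenvalueCount L V E = Module.rank ℂ (inverseSpan (dirichletInverse hV) E) := by
  have h : eigenspace L V = inverseEigenspace (dirichletInverse hV) :=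
    funext (eigenspace_eq hL hV)
  rw [eigenvalueCount, inverseSpan, h]

lemma not_finiteDimensional_L2 (hL : 0 < L) : ¬ FiniteDimensional ℂ (L2 L) := by
  intro hfin
  let s : ℕ → Set ℝ := fun n => Ioc (L / (n + 3)) (L / (n + 2))
  let v : ℕ → L2 L := fun n => indicatorConstLp 2 (measurableSet_Ioc (a := L / (n + 3))
    (b := L / (n + 2))) (measure_ne_top (volume.restrict (box L)) _) 1
  have hinner : ∀ m n, inner ℂ (v m) (v n) =
      (((volume.restrict (box L)).real (s m ∩ s n) : ℝ) : ℂ) := fun m n =>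
    L2.inner_indicatorConstLp_one_indicatorConstLp_one _ _
  have hdisj : ∀ m n, m < n → s m ∩ s n = ∅ := by
    intro m n hmn
    rw [← disjoint_iff_inter_eq_empty]
    refine disjoint_left.mpr fun x hx hx' => ?_
    have h1 : L / ((n : ℝ) + 2) ≤ L / ((m : ℝ) + 3) := by
      refine div_le_div_of_nonneg_left hL.le (by positivity) ?_
      have : (m : ℝ) + 1 ≤ n := by exact_mod_cast hmn
      linarith
    exact not_lt.mpr (hx'.2.trans h1) hx.1
  have hli : LinearIndependent ℂ v := by
    refine linearIndependent_of_ne_zero_of_inner_eq_zero (𝕜 := ℂ) (fun n h0 => ?_) fun m n hmn => ?_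
    · have h1 := hinner n n
      have hsub : Ioo (L / ((n : ℝ) + 3)) (L / ((n : ℝ) + 2)) ⊆ s n ∩ box L := by
        intro x hx
        refine ⟨⟨hx.1, hx.2.le⟩, ?_, ?_⟩
        · have : 0 < L / ((n : ℝ) + 3) := by positivity
          linarith [hx.1]
        · refine hx.2.trans_le ?_
          exact div_le_div_of_nonneg_left hL.le (by norm_num) (by linarith [n.cast_nonneg (α := ℝ)])
      have hlt : L / ((n : ℝ) + 3) < L / ((n : ℝ) + 2) :=
        div_lt_div_of_pos_left hL (by positivity) (by linarith)
      rw [h0, inner_zero_left, inter_self] at h1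
      have h2 : (volume.restrict (box L)).real (s n) = 0 := by exact_mod_cast h1.symm
      rw [measureReal_restrict_apply measurableSet_Ioc] at h2
      have h3 : volume.real (Ioo (L / ((n : ℝ) + 3)) (L / ((n : ℝ) + 2))) ≤ 0 := by
        rw [← h2]
        exact measureReal_mono hsub ((measure_mono inter_subset_right).trans_lt
          (by simp [box])).ne
      rw [Real.volume_real_Ioo_of_le hlt.le] at h3
      linarith
    · change inner ℂ (v m) (v n) = 0
      rw [hinner]
      rcases lt_or_gt_of_ne hmn with h | h
      · simp [hdisj m n h]
      · rw [inter_comm]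
        simp [hdisj n m h]
  exact not_finite_iff_infinite.mpr (inferInstanceAs (Infinite ℕ)) hli.finite

/-- The Rayleigh quotient of any function in `H¹₀` is an upper bound for the lowest eigenvalue. -/
lemma eigenvalue_one_le (hL : 0 < L) (hV : IsBoundedPotential L V) {g : L2 L}
    (hg : inner ℂ (one L) g = 0) (hne : primitive L g ≠ 0) {r : ℝ}
    (hr : ‖g‖ ^ 2 + ∫ x in box L, V x * ‖primitive L g x‖ ^ 2 ≤ r * ‖primitive L g‖ ^ 2) :
    eigenvalue L V 1 ≤ r := by
  have hB := dirichletPrimitive_apply hg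
  obtain ⟨E, hE0, hE1, hE2⟩ := exists_inverseEigenspace_ne_bot (isPositive_mulOp hV)
    (isCompactOperator_dirichletPrimitive hL) (g := g) (by rwa [hB])
  rw [inner_formOp, hB, map_add, inner_self_eq_norm_sq, re_inner_mulOp] at hE2
  have hEr : E ≤ r :=
    le_of_mul_le_mul_right (hE2.trans hr) (by have := norm_pos_iff.mpr hne; positivity)
  refine le_trans (csInf_le ⟨0, fun F hF => ?_⟩ ?_) hEr
  · by_contra! hF0
    have hbot : inverseSpan (dirichletInverse hV) F = ⊥ := by
      rw [eq_bot_iff]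
      refine iSup_le fun G x hx => ?_
      exact eq_zero_of_mem_inverseEigenspace (isPositive_solutionOp (isPositive_mulOp hV))
        (G.2.trans hF0.le) hx
    have h1 : ((1 : ℕ) : Cardinal) ≤ eigenvalueCount L V F := hF
    rw [eigenvalueCount_eq hL hV, hbot] at h1
    simp at h1
  · change ((1 : ℕ) : Cardinal) ≤ eigenvalueCount L V E
    rw [eigenvalueCount_eq hL hV, Nat.cast_one, Cardinal.one_le_iff_pos,
      rank_pos_iff_exists_ne_zero]
    obtain ⟨x, hx, hx0⟩ := (Submodule.ne_bot_iff _).mp hE1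
    exact ⟨⟨x, inverseEigenspace_le_inverseSpan _ le_rfl hx⟩, fun h => hx0 (congrArg Subtype.val h)⟩

/-- A lower bound for the quadratic form on the functions that vanish at `m` given points is a lower
bound for the `(m + 1)`-st eigenvalue. The values at the points enter as a penalty term, so that
the bound has to be checked for test functions only. -/
lemma le_eigenvalue (hL : 0 < L) (hV : IsBoundedPotential L V) {m j : ℕ} (hm : m < j)
    (x : Fin m → ℝ) {r C : ℝ}
    (h : ∀ p ∈ testGraph L, r * ‖p.1‖ ^ 2 ≤ ‖p.2‖ ^ 2 + (∫ y in box L, V y * ‖p.1 y‖ ^ 2) +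
      C * ∑ i, ‖(inner ℂ (below L (x i)) p.2 : ℂ)‖ ^ 2) :
    r ≤ eigenvalue L V j := by
  have hM := isPositive_mulOp hV
  have hT : (dirichletInverse hV).IsPositive := isPositive_solutionOp hM
  have hinj := solutionOp_injective hM (adjoint_dirichletPrimitive_injective (L := L))
  obtain ⟨E0, hE0⟩ := exists_le_rank_inverseSpan hT
    (isCompactOperator_solutionOp (mulOp hV) (isCompactOperator_dirichletPrimitive hL)) hinj
    (not_finiteDimensional_L2 hL) j
  refine le_csInf ⟨E0, by
    change (j : Cardinal) ≤ eigenvalueCount L V E0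
    rwa [eigenvalueCount_eq hL hV]⟩ fun E hE => ?_
  replace hE : (j : Cardinal) ≤ eigenvalueCount L V E := hE
  rw [eigenvalueCount_eq hL hV] at hE
  let D : L2 L →L[ℂ] L2 L := Ring.inverse (formOp (dirichletPrimitive L) (mulOp hV)) ∘L
    (dirichletPrimitive L).adjoint
  obtain ⟨f, hfW, hf0, hfx⟩ := exists_ne_zero_of_lt_rank (m := m)
    (fun i => ((innerSL ℂ (below L (x i)) ∘L D : L2 L →L[ℂ] ℂ) : L2 L →ₗ[ℂ] ℂ))
    (lt_of_lt_of_le (by exact_mod_cast hm) hE)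
  have hfx' : ∀ i, inner ℂ (below L (x i)) (D f) = 0 := hfx
  have hone : inner ℂ (one L) (D f) = 0 := inner_one_inverse_formOp hV f
  have hJ : primitive L (D f) = dirichletInverse hV f := by
    rw [← dirichletPrimitive_apply hone]
    rfl
  have hA : IsClosed {g : L2 L | r * ‖primitive L g‖ ^ 2 ≤ ‖g‖ ^ 2 +
      RCLike.re (inner ℂ (primitive L g) (mulOp hV (primitive L g))) +
      C * ∑ i, ‖(inner ℂ (below L (x i)) g : ℂ)‖ ^ 2} := by
    refine isClosed_le (by fun_prop) ?_
    fun_prop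
  have hmain := forall_of_testGraph hL hA (fun p hp => by
    rw [Set.mem_ofPred_eq, ← fst_eq_primitive_of_mem_testGraph hp, re_inner_mulOp]
    exact h p hp) hone
  rw [Set.mem_ofPred_eq, hJ] at hmain
  simp_rw [hfx'] at hmain
  have hform : RCLike.re (inner ℂ (dirichletInverse hV f) f) = ‖D f‖ ^ 2 +
      RCLike.re (inner ℂ (dirichletInverse hV f) (mulOp hV (dirichletInverse hV f))) := by
    have h1 := inner_solutionOp (B := dirichletPrimitive L) hM f
    rw [inner_formOp] at h1
    rw [dirichletInverse, h1, map_add, inner_self_eq_norm_sq]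
    rfl
  have hle := re_inner_le_of_mem_inverseSpan hT hfW
  have hpos : 0 < ‖dirichletInverse hV f‖ ^ 2 := by
    have : 0 < ‖dirichletInverse hV f‖ := norm_pos_iff.mpr fun h0 => hf0 (hinj f h0)
    positivity
  refine le_of_mul_le_mul_right ?_ hpos
  simp only [norm_zero, ne_eq, OfNat.ofNat_ne_zero, not_false_eq_true, zero_pow,
    Finset.sum_const_zero, mul_zero, add_zero] at hmain
  linarith

end DirichletOperator

/-! ### Upper bound for the lowest eigenvalue -/

lemma norm_sq_eq_integral {L : ℝ} (f : L2 L) : ‖f‖ ^ 2 = ∫ x in box L, ‖f x‖ ^ 2 := by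
  rw [← @inner_self_eq_norm_sq ℂ, L2.inner_def, ← integral_re (L2.integrable_inner f f)]
  refine integral_congr_ae (ae_of_all _ fun x => ?_)
  exact inner_self_eq_norm_sq _

/-- If the potential vanishes on an interval of length `ℓ`, the lowest eigenvalue is at most
`(π / ℓ)²`; the trial function is a sine arc on this interval. -/
lemma eigenvalue_one_le_of_eq_zero {L : ℝ} {V : ℝ → ℝ} (hL : 0 < L)
    (hV : IsBoundedPotential L V) {α β : ℝ} (hαβ : α < β) (hα : -(L / 2) ≤ α) (hβ : β ≤ L / 2)
    (h0 : ∀ x ∈ Ioo α β, V x = 0) : eigenvalue L V 1 ≤ (Real.pi / (β - α)) ^ 2 := by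
  set k : ℝ := Real.pi / (β - α) with hk
  have hd : 0 < β - α := sub_pos.mpr hαβ
  have hk0 : 0 < k := div_pos Real.pi_pos hd
  have hkd : k * (β - α) = Real.pi := div_mul_cancel₀ _ hd.ne'
  have hsub : Ioo α β ⊆ box L := Ioo_subset_Ioo hα hβ
  let G : ℝ → ℂ := (Ioo α β).indicator fun x => ((k * Real.cos (k * (x - α)) : ℝ) : ℂ)
  have hGm : MemLp G 2 (volume.restrict (box L)) := by
    refine MemLp.of_bound (C := k) ?_ (ae_of_all _ fun x => ?_)
    · exact (Measurable.indicator (by fun_prop) measurableSet_Ioo).aestronglyMeasurable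
    · by_cases hx : x ∈ Ioo α β
      · simp only [G, indicator_of_mem hx, Complex.norm_real, norm_mul, Real.norm_of_nonneg hk0.le]
        exact mul_le_of_le_one_right hk0.le (Real.abs_cos_le_one _)
      · simp only [G, indicator_of_notMem hx, norm_zero]
        exact hk0.le
  let g : L2 L := hGm.toLp G
  have hgae : g =ᵐ[volume.restrict (box L)] G := hGm.coeFn_toLp
  have hsin : ∀ x ∈ Icc α β,
      ∫ y in α..x, k * Real.cos (k * (y - α)) = Real.sin (k * (x - α)) := by
    intro x _
    have hderiv : ∀ y ∈ uIcc α x, HasDerivAt (fun y => Real.sin (k * (y - α)))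
        (k * Real.cos (k * (y - α))) y := by
      intro y _
      have h1 : HasDerivAt (fun y => k * (y - α)) (k * 1) y :=
        ((hasDerivAt_id y).sub_const α).const_mul k
      refine h1.sin.congr_deriv ?_
      ring
    rw [intervalIntegral.integral_eq_sub_of_hasDerivAt hderiv
      (Continuous.intervalIntegrable (by fun_prop) _ _)]
    simp
  have hprim : ∀ x, inner ℂ (below L x) g =
      (Ioo α β).indicator (fun x => ((Real.sin (k * (x - α)) : ℝ) : ℂ)) x := by
    intro x
    have h1 : inner ℂ (below L x) g = ∫ y in Iio x ∩ Ioo α β,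
        ((k * Real.cos (k * (y - α)) : ℝ) : ℂ) := by
      rw [inner_below, setIntegral_congr_ae measurableSet_Iio (hgae.mono fun y hy _ => hy),
        setIntegral_indicator measurableSet_Ioo, Measure.restrict_restrict
        (measurableSet_Iio.inter measurableSet_Ioo),
        inter_eq_left.mpr (inter_subset_right.trans hsub)]
    rw [h1]
    by_cases hx : x ∈ Ioo α β
    · have e : Iio x ∩ Ioo α β = Ioo α x := by
        ext y
        simp only [mem_inter_iff, mem_Iio, mem_Ioo]
        exact ⟨fun h => ⟨h.2.1, h.1⟩, fun h => ⟨h.2, h.1, h.2.trans hx.2⟩⟩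
      rw [indicator_of_mem hx, e, integral_complex_ofReal, ← integral_Ioc_eq_integral_Ioo,
        ← intervalIntegral.integral_of_le hx.1.le, hsin x (Ioo_subset_Icc_self hx)]
    · rw [indicator_of_notMem hx]
      rcases le_or_gt x α with h | h
      · have e : Iio x ∩ Ioo α β = ∅ := by
          ext y
          simp only [mem_inter_iff, mem_Iio, mem_Ioo, mem_empty_iff_false, iff_false]
          rintro ⟨h2, h3, -⟩
          linarith
        simp [e]
      · have hxβ : β ≤ x := not_lt.mp fun h' => hx ⟨h, h'⟩
        have e : Iio x ∩ Ioo α β = Ioo α β :=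
          inter_eq_right.mpr fun y hy => hy.2.trans_le hxβ
        rw [e, integral_complex_ofReal, ← integral_Ioc_eq_integral_Ioo,
          ← intervalIntegral.integral_of_le hαβ.le, hsin β (right_mem_Icc.mpr hαβ.le), hkd,
          Real.sin_pi, Complex.ofReal_zero]
  have hone : inner ℂ (one L) g = 0 := by
    rw [one, hprim, indicator_of_notMem]
    exact fun h => not_lt.mpr hβ h.2
  have hJ : primitive L g =ᵐ[volume.restrict (box L)]
      (Ioo α β).indicator (fun x => ((Real.sin (k * (x - α)) : ℝ) : ℂ)) :=
    (coeFn_primitive g).trans (Eventually.of_forall hprim)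
  have hset : ∀ F : ℝ → ℝ, Continuous F → ∫ x in box L, (Ioo α β).indicator F x =
      ∫ x in α..β, F x := by
    intro F _
    rw [setIntegral_indicator measurableSet_Ioo, inter_eq_right.mpr hsub,
      ← integral_Ioc_eq_integral_Ioo, ← intervalIntegral.integral_of_le hαβ.le]
  have hnJ : ‖primitive L g‖ ^ 2 = ∫ x in α..β, Real.sin (k * (x - α)) ^ 2 := by
    rw [norm_sq_eq_integral, ← hset _ (by fun_prop)]
    refine integral_congr_ae (hJ.mono fun x hx => ?_)
    simp only [hx]
    by_cases h : x ∈ Ioo α β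
    · simp only [indicator_of_mem h, Complex.norm_real, Real.norm_eq_abs, sq_abs]
    · simp [indicator_of_notMem h]
  have hng : ‖g‖ ^ 2 = ∫ x in α..β, k ^ 2 * Real.cos (k * (x - α)) ^ 2 := by
    rw [norm_sq_eq_integral, ← hset _ (by fun_prop)]
    refine integral_congr_ae (hgae.mono fun x hx => ?_)
    simp only [hx, G]
    by_cases h : x ∈ Ioo α β
    · simp only [indicator_of_mem h, Complex.norm_real, Real.norm_eq_abs, sq_abs, mul_pow]
    · simp [indicator_of_notMem h]
  have hVJ : ∫ x in box L, V x * ‖primitive L g x‖ ^ 2 = 0 := by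
    refine (integral_congr_ae (g := fun _ => (0 : ℝ)) (hJ.mono fun x hx => ?_)).trans (by simp)
    simp only [hx]
    by_cases h : x ∈ Ioo α β
    · simp [h0 x h]
    · simp [indicator_of_notMem h]
  -- `k² cos² - k² sin²` is the derivative of `k sin cos`, which vanishes at both end points
  have hcs : ∫ x in α..β, (k ^ 2 * Real.cos (k * (x - α)) ^ 2 -
      k ^ 2 * Real.sin (k * (x - α)) ^ 2) = 0 := by
    have hderiv : ∀ y ∈ uIcc α β, HasDerivAt
        (fun y => k * (Real.sin (k * (y - α)) * Real.cos (k * (y - α))))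
        (k ^ 2 * Real.cos (k * (y - α)) ^ 2 - k ^ 2 * Real.sin (k * (y - α)) ^ 2) y := by
      intro y _
      have h1 : HasDerivAt (fun y => k * (y - α)) (k * 1) y :=
        ((hasDerivAt_id y).sub_const α).const_mul k
      refine ((h1.sin.fun_mul h1.cos).const_mul k).congr_deriv ?_
      ring
    rw [intervalIntegral.integral_eq_sub_of_hasDerivAt hderiv
      (Continuous.intervalIntegrable (by fun_prop) _ _), hkd]
    simp
  rw [intervalIntegral.integral_sub (Continuous.intervalIntegrable (by fun_prop) _ _)
    (Continuous.intervalIntegrable (by fun_prop) _ _), ← hng,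
    intervalIntegral.integral_const_mul, ← hnJ] at hcs
  have hpos : 0 < ‖primitive L g‖ ^ 2 := by
    rw [hnJ]
    refine intervalIntegral.intervalIntegral_pos_of_pos_on
      (Continuous.intervalIntegrable (by fun_prop) _ _) (fun x hx => ?_) hαβ
    have h1 : 0 < k * (x - α) := mul_pos hk0 (sub_pos.mpr hx.1)
    have h2 : k * (x - α) < Real.pi := by
      rw [← hkd]
      exact mul_lt_mul_of_pos_left (by linarith [hx.2]) hk0
    have := Real.sin_pos_of_pos_of_lt_pi h1 h2
    positivity
  refine eigenvalue_one_le hL hV hone (fun h => ?_) ?_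
  · rw [h, norm_zero] at hpos
    norm_num at hpos
  · rw [hVJ]
    linarith

/-! ### Lower bounds for the quadratic form -/

/-- The density of the quadratic form of `-d²/dx² + V` at a real function `f`. -/
def energyDensity (V f : ℝ → ℝ) (x : ℝ) : ℝ := deriv f x ^ 2 + V x * f x ^ 2

lemma integrable_sq {f : ℝ → ℝ} (h1 : Continuous f) (h2 : HasCompactSupport f) :
    Integrable fun y => f y ^ 2 := by
  have h3 : HasCompactSupport fun y => f y ^ 2 :=
    h2.mono fun y hy h => hy (by simp only [h]; norm_num)
  exact (h1.pow 2).integrable_of_hasCompactSupport h3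

lemma integrable_mul_sq {L : ℝ} {V f : ℝ → ℝ} (hV : IsBoundedPotential L V) (h1 : Continuous f)
    (h2 : HasCompactSupport f) (h3 : tsupport f ⊆ box L) : Integrable fun y => V y * f y ^ 2 := by
  obtain ⟨K, hK⟩ := hV.bounded
  have : IntegrableOn (fun y => V y * f y ^ 2) (box L) volume := by
    refine Integrable.bdd_mul (c := K) ((integrable_sq h1 h2).restrict)
      hV.measurable.aestronglyMeasurable ?_
    filter_upwards [ae_restrict_mem (measurableSet_box L)] with y hy
    rw [Real.norm_of_nonneg (hV.nonneg y)]
    exact hK y hy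
  refine (integrableOn_iff_integrable_of_support_subset fun y hy => ?_).mp this
  by_contra hne
  exact hy (by simp [image_eq_zero_of_notMem_tsupport fun h => hne (h3 h)])

/-- The lower bound for eigenvalues in terms of real functions. -/
lemma le_eigenvalue_of_real {L : ℝ} {V : ℝ → ℝ} (hL : 0 < L) (hV : IsBoundedPotential L V)
    {m j : ℕ} (hm : m < j) (x : Fin m → ℝ) {r C : ℝ}
    (h : ∀ f : ℝ → ℝ, ContDiff ℝ 1 f → HasCompactSupport f → tsupport f ⊆ box L →
      r * ∫ y, f y ^ 2 ≤ (∫ y, energyDensity V f y) + C * ∑ i, f (x i) ^ 2) :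
    r ≤ eigenvalue L V j := by
  refine le_eigenvalue hL hV hm x (C := C) fun p hp => ?_
  obtain ⟨φ, h1, h2, h3, h4, h5⟩ := hp
  have hbelow : ∀ i, inner ℂ (below L (x i)) p.2 = φ (x i) := fun i =>
    inner_below_of_deriv h1 h2 h3 h5 _
  simp_rw [hbelow]
  have hd : ∀ y, HasDerivAt φ (deriv φ y) y := fun y => (h1.differentiable (by simp) y).hasDerivAt
  let a : ℝ → ℝ := fun y => (φ y).re
  let b : ℝ → ℝ := fun y => (φ y).im
  have ha1 : ContDiff ℝ 1 a := (Complex.reCLM.contDiff.comp h1).of_le (by simp)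
  have hb1 : ContDiff ℝ 1 b := (Complex.imCLM.contDiff.comp h1).of_le (by simp)
  have hda : ∀ y, deriv a y = (deriv φ y).re := fun y =>
    ((Complex.reCLM.hasFDerivAt.comp_hasDerivAt y (hd y))).deriv
  have hdb : ∀ y, deriv b y = (deriv φ y).im := fun y =>
    ((Complex.imCLM.hasFDerivAt.comp_hasDerivAt y (hd y))).deriv
  have hats : tsupport a ⊆ tsupport φ := closure_mono fun y hy h => hy (by simp [a, h])
  have hbts : tsupport b ⊆ tsupport φ := closure_mono fun y hy h => hy (by simp [b, h])
  have ha2 : HasCompactSupport a := h2.of_isClosed_subset (isClosed_tsupport _) hats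
  have hb2 : HasCompactSupport b := h2.of_isClosed_subset (isClosed_tsupport _) hbts
  have hcφ : Continuous φ := h1.continuous
  have hcdφ : Continuous (deriv φ) := h1.continuous_deriv (by simp)
  have hz : ∀ y, y ∉ box L → φ y = 0 ∧ deriv φ y = 0 := fun y hy =>
    ⟨image_eq_zero_of_notMem_tsupport fun h => hy (h3 h), by
      by_contra hne
      exact hy (h3 (support_deriv_subset hne))⟩
  have e1 : ‖p.1‖ ^ 2 = (∫ y, a y ^ 2) + ∫ y, b y ^ 2 := by
    rw [norm_sq_eq_integral, ← integral_add (integrable_sq ha1.continuous ha2)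
      (integrable_sq hb1.continuous hb2),
      ← setIntegral_eq_integral_of_forall_compl_eq_zero (s := box L)
      (f := fun y => a y ^ 2 + b y ^ 2) (fun y hy => by simp [a, b, (hz y hy).1])]
    refine integral_congr_ae (h4.mono fun y hy => ?_)
    simp only [hy, a, b, Complex.sq_norm, Complex.normSq_apply]
    ring
  have e2 : ‖p.2‖ ^ 2 = ∫ y, (deriv a y ^ 2 + deriv b y ^ 2) := by
    rw [norm_sq_eq_integral, ← setIntegral_eq_integral_of_forall_compl_eq_zero (s := box L)
      (f := fun y => deriv a y ^ 2 + deriv b y ^ 2) (fun y hy => by simp [hda, hdb, (hz y hy).2])]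
    refine integral_congr_ae (h5.mono fun y hy => ?_)
    simp only [hy, hda, hdb, Complex.sq_norm, Complex.normSq_apply]
    ring
  have e3 : ∫ y in box L, V y * ‖p.1 y‖ ^ 2 = (∫ y, V y * a y ^ 2) + ∫ y, V y * b y ^ 2 := by
    rw [← integral_add (integrable_mul_sq hV ha1.continuous ha2 (hats.trans h3))
      (integrable_mul_sq hV hb1.continuous hb2 (hbts.trans h3)),
      ← setIntegral_eq_integral_of_forall_compl_eq_zero (s := box L)
      (f := fun y => V y * a y ^ 2 + V y * b y ^ 2) (fun y hy => by simp [a, b, (hz y hy).1])]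
    refine integral_congr_ae (h4.mono fun y hy => ?_)
    simp only [hy, a, b, Complex.sq_norm, Complex.normSq_apply]
    ring
  have e4 : ∑ i, ‖φ (x i)‖ ^ 2 = (∑ i, a (x i) ^ 2) + ∑ i, b (x i) ^ 2 := by
    rw [← Finset.sum_add_distrib]
    refine Finset.sum_congr rfl fun i _ => ?_
    simp only [a, b, Complex.sq_norm, Complex.normSq_apply]
    ring
  have hia := integrable_sq (ha1.continuous_deriv le_rfl) ha2.deriv
  have hib := integrable_sq (hb1.continuous_deriv le_rfl) hb2.deriv
  have Ha := h a ha1 ha2 (hats.trans h3)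
  have Hb := h b hb1 hb2 (hbts.trans h3)
  simp only [energyDensity] at Ha Hb
  rw [integral_add hia (integrable_mul_sq hV ha1.continuous ha2 (hats.trans h3))] at Ha
  rw [integral_add hib (integrable_mul_sq hV hb1.continuous hb2 (hbts.trans h3))] at Hb
  rw [e1, e2, e3, e4, integral_add hia hib]
  linarith

lemma tan_le_inv {θ η : ℝ} (hθ : 0 ≤ θ) (hη : 0 < η) (h : θ ≤ Real.pi / 2 - η) :
    Real.tan θ ≤ η⁻¹ := by
  rcases hθ.eq_or_lt with rfl | hθ0
  · rw [Real.tan_zero]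
    positivity
  · have h1 : Real.tan (Real.pi / 2 - θ) = (Real.tan θ)⁻¹ := Real.tan_pi_div_two_sub θ
    have h2 : Real.pi / 2 - θ ≤ Real.tan (Real.pi / 2 - θ) :=
      Real.le_tan (by linarith) (by linarith)
    rw [h1] at h2
    have h3 : η ≤ (Real.tan θ)⁻¹ := by linarith
    exact (le_inv_comm₀ hη (inv_pos.mp (hη.trans_le h3))).mp h3

/-- A Riccati estimate: if the length of the interval is less than a quarter of the wave length
`2π / k` by `A`, a boundary term of strength `1 / A` at one end compensates `-k²`. The function
`w = k tan (k (β - x))` satisfies `w' + w² + k² = 0`, so that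
`f'² - k² f² = (f' - w f)² + (w f²)'`. -/
lemma riccati_left {f : ℝ → ℝ} (hf : ContDiff ℝ 1 f) {k A α β : ℝ} (hk : 0 < k) (hA : 0 < A)
    (hαβ : α ≤ β) (h : β - α ≤ Real.pi / (2 * k) - A) :
    k ^ 2 * ∫ x in α..β, f x ^ 2 ≤ (∫ x in α..β, deriv f x ^ 2) + f α ^ 2 / A := by
  have hkA : k * (β - α) ≤ Real.pi / 2 - k * A := by
    calc k * (β - α) ≤ k * (Real.pi / (2 * k) - A) := mul_le_mul_of_nonneg_left h hk.le
      _ = _ := by field_simp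
  have hkA0 : 0 < k * A := mul_pos hk hA
  let w : ℝ → ℝ := fun x => k * Real.tan (k * (β - x))
  have hcos : ∀ x ∈ Icc α β, 0 < Real.cos (k * (β - x)) := by
    intro x hx
    have h1 : 0 ≤ k * (β - x) := mul_nonneg hk.le (by linarith [hx.2])
    have h2 : k * (β - x) ≤ k * (β - α) := mul_le_mul_of_nonneg_left (by linarith [hx.1]) hk.le
    exact Real.cos_pos_of_mem_Ioo ⟨by linarith [Real.pi_pos], by linarith⟩
  have hw : ∀ x ∈ Icc α β, HasDerivAt w (-k ^ 2 - w x ^ 2) x := by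
    intro x hx
    have h1 : HasDerivAt (fun x => k * (β - x)) (k * (0 - 1)) x :=
      ((hasDerivAt_const x β).fun_sub (hasDerivAt_id x)).const_mul k
    have h2 := ((Real.hasDerivAt_tan (hcos x hx).ne').comp x h1).const_mul k
    refine h2.congr_deriv ?_
    have h3 : 1 / Real.cos (k * (β - x)) ^ 2 = 1 + Real.tan (k * (β - x)) ^ 2 := by
      rw [Real.tan_eq_sin_div_cos, div_pow]
      have := hcos x hx
      field_simp
      linarith [Real.sin_sq_add_cos_sq (k * (β - x))]
    rw [h3]
    simp only [w]
    ring
  have hf' : ∀ x, HasDerivAt f (deriv f x) x := fun x =>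
    (hf.differentiable (by simp) x).hasDerivAt
  have hcf := hf.continuous
  have hcf' : Continuous (deriv f) := hf.continuous_deriv le_rfl
  have hcw : ContinuousOn w (Icc α β) := fun x hx => (hw x hx).continuousAt.continuousWithinAt
  let G' : ℝ → ℝ := fun x => (-k ^ 2 - w x ^ 2) * f x ^ 2 + w x * (2 * f x * deriv f x)
  have hG : ∀ x ∈ uIcc α β, HasDerivAt (fun x => w x * f x ^ 2) (G' x) x := by
    intro x hx
    rw [uIcc_of_le hαβ] at hx
    refine ((hw x hx).fun_mul ((hf' x).fun_pow 2)).congr_deriv ?_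
    simp only [G']
    norm_num
  have hcG : ContinuousOn G' (uIcc α β) := by
    rw [uIcc_of_le hαβ]
    simp only [G']
    fun_prop
  have hint := intervalIntegral.integral_eq_sub_of_hasDerivAt hG hcG.intervalIntegrable
  have hw0 : w β = 0 := by simp [w]
  have hmono : ∫ x in α..β, (k ^ 2 * f x ^ 2 + G' x) ≤ ∫ x in α..β, deriv f x ^ 2 := by
    refine intervalIntegral.integral_mono_on hαβ ?_ ?_ fun x _ => ?_
    · exact ((Continuous.intervalIntegrable (by fun_prop) _ _)).add hcG.intervalIntegrable
    · exact Continuous.intervalIntegrable (by fun_prop) _ _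
    · simp only [G']
      nlinarith [sq_nonneg (deriv f x - w x * f x)]
  rw [intervalIntegral.integral_add (Continuous.intervalIntegrable (by fun_prop) _ _)
    hcG.intervalIntegrable, intervalIntegral.integral_const_mul, hint, hw0] at hmono
  have hwα : w α ≤ A⁻¹ := by
    have h1 := tan_le_inv (mul_nonneg hk.le (sub_nonneg.mpr hαβ)) hkA0 hkA
    calc w α ≤ k * (k * A)⁻¹ := mul_le_mul_of_nonneg_left h1 hk.le
      _ = A⁻¹ := by field_simp
  have h2 : w α * f α ^ 2 ≤ f α ^ 2 / A := by
    rw [div_eq_inv_mul]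
    exact mul_le_mul_of_nonneg_right hwα (sq_nonneg _)
  linarith

lemma riccati_right {f : ℝ → ℝ} (hf : ContDiff ℝ 1 f) {k B α β : ℝ} (hk : 0 < k) (hB : 0 < B)
    (hαβ : α ≤ β) (h : β - α ≤ Real.pi / (2 * k) - B) :
    k ^ 2 * ∫ x in α..β, f x ^ 2 ≤ (∫ x in α..β, deriv f x ^ 2) + f β ^ 2 / B := by
  have h1 := riccati_left (f := fun x => f (-x)) (hf.comp contDiff_neg) hk hB
    (neg_le_neg hαβ) (by linarith)
  have h2 : ∀ x, deriv (fun x => f (-x)) x = -deriv f (-x) := fun x => deriv_comp_neg f x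
  simp_rw [h2, neg_sq] at h1
  rw [intervalIntegral.integral_comp_neg (fun x => f x ^ 2),
    intervalIntegral.integral_comp_neg (fun x => deriv f x ^ 2), neg_neg, neg_neg] at h1
  exact h1

/-- The Riccati estimate with boundary terms of strengths `1 / A` and `1 / B` at the two ends. -/
lemma riccati {f : ℝ → ℝ} (hf : ContDiff ℝ 1 f) {k A B α β : ℝ} (hk : 0 < k) (hA : 0 < A)
    (hB : 0 < B) (hA' : A ≤ Real.pi / (2 * k)) (hB' : B ≤ Real.pi / (2 * k))
    (hαβ : α ≤ β) (h : β - α ≤ Real.pi / k - A - B) :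
    k ^ 2 * ∫ x in α..β, f x ^ 2 ≤
      (∫ x in α..β, deriv f x ^ 2) + f α ^ 2 / A + f β ^ 2 / B := by
  have hpi : Real.pi / k = Real.pi / (2 * k) + Real.pi / (2 * k) := by
    field_simp
    ring
  let γ := max α (β - (Real.pi / (2 * k) - B))
  have h1 : α ≤ γ := le_max_left _ _
  have h2 : γ ≤ β := max_le hαβ (by linarith)
  have h3 : β - γ ≤ Real.pi / (2 * k) - B := by
    have := le_max_right α (β - (Real.pi / (2 * k) - B))
    linarith
  have h4 : γ - α ≤ Real.pi / (2 * k) - A := by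
    rw [sub_le_iff_le_add]
    exact max_le (by linarith) (by linarith)
  have hcf := hf.continuous
  have hcf' : Continuous (deriv f) := hf.continuous_deriv le_rfl
  have i1 : ∀ a b : ℝ, IntervalIntegrable (fun x => f x ^ 2) volume a b := fun a b =>
    Continuous.intervalIntegrable (by fun_prop) _ _
  have i2 : ∀ a b : ℝ, IntervalIntegrable (fun x => deriv f x ^ 2) volume a b := fun a b =>
    Continuous.intervalIntegrable (by fun_prop) _ _
  rw [← intervalIntegral.integral_add_adjacent_intervals (i1 α γ) (i1 γ β),
    ← intervalIntegral.integral_add_adjacent_intervals (i2 α γ) (i2 γ β)]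
  have h5 := riccati_left hf hk hA h1 h4
  have h6 := riccati_right hf hk hB h2 h3
  linarith

/-- Potentials that are nonnegative and locally integrable. -/
structure IsLocalPotential (V : ℝ → ℝ) : Prop where
  nonneg : ∀ x, 0 ≤ V x
  intervalIntegrable : ∀ a b : ℝ, IntervalIntegrable V volume a b

lemma energyDensity_nonneg {V : ℝ → ℝ} (hV : IsLocalPotential V) (f : ℝ → ℝ) (x : ℝ) :
    0 ≤ energyDensity V f x :=
  add_nonneg (sq_nonneg _) (mul_nonneg (hV.nonneg x) (sq_nonneg _))

lemma intervalIntegrable_energyDensity {V f : ℝ → ℝ} (hV : IsLocalPotential V)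
    (hf : ContDiff ℝ 1 f) (a b : ℝ) : IntervalIntegrable (energyDensity V f) volume a b := by
  have hcf' : Continuous (deriv f) := hf.continuous_deriv le_rfl
  refine IntervalIntegrable.add (Continuous.intervalIntegrable (by fun_prop) _ _) ?_
  exact (hV.intervalIntegrable a b).mul_continuousOn (hf.continuous.pow 2).continuousOn

lemma sq_sub_le_mul_integral {f : ℝ → ℝ} (hf : ContDiff ℝ 1 f) {x y : ℝ} (hxy : x ≤ y) :
    (f y - f x) ^ 2 ≤ (y - x) * ∫ z in x..y, deriv f z ^ 2 := by
  have hcf' : Continuous (deriv f) := hf.continuous_deriv le_rfl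
  have hint : ∫ z in x..y, deriv f z = f y - f x :=
    intervalIntegral.integral_deriv_eq_sub (fun z _ => hf.differentiable (by simp) z)
      (hcf'.intervalIntegrable _ _)
  rcases hxy.eq_or_lt with rfl | hlt
  · simp
  set c := (f y - f x) / (y - x) with hc
  have h0 : 0 ≤ ∫ z in x..y, (deriv f z - c) ^ 2 :=
    intervalIntegral.integral_nonneg hxy fun z _ => sq_nonneg _
  have e : ∫ z in x..y, (deriv f z - c) ^ 2 =
      (∫ z in x..y, deriv f z ^ 2) - 2 * c * (f y - f x) + c ^ 2 * (y - x) := by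
    have e1 : ∀ z, (deriv f z - c) ^ 2 = deriv f z ^ 2 - 2 * c * deriv f z + c ^ 2 := by
      intro z
      ring
    simp_rw [e1]
    rw [intervalIntegral.integral_add (Continuous.intervalIntegrable (by fun_prop) _ _)
      (Continuous.intervalIntegrable (by fun_prop) _ _), intervalIntegral.integral_sub
      (Continuous.intervalIntegrable (by fun_prop) _ _)
      (Continuous.intervalIntegrable (by fun_prop) _ _), intervalIntegral.integral_const_mul, hint,
      intervalIntegral.integral_const, smul_eq_mul]
    ring
  rw [e] at h0
  have hd : 0 < y - x := sub_pos.mpr hlt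
  have hcd : c * (y - x) = f y - f x := div_mul_cancel₀ _ hd.ne'
  have h2 := mul_nonneg hd.le h0
  have e2 : (y - x) * ((∫ z in x..y, deriv f z ^ 2) - 2 * c * (f y - f x) + c ^ 2 * (y - x)) =
      (y - x) * (∫ z in x..y, deriv f z ^ 2) - 2 * (c * (y - x)) * (f y - f x) +
        (c * (y - x)) ^ 2 := by ring
  rw [e2, hcd] at h2
  nlinarith

/-- On an interval of length `a` that carries a mass of at least `m` of the potential, the form
dominates `f² / (a + 1 / m)` pointwise. -/
lemma sq_le_mul_integral_energyDensity {V f : ℝ → ℝ} (hV : IsLocalPotential V)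
    (hf : ContDiff ℝ 1 f) {m p q t : ℝ} (hm : 0 < m) (hmass : m ≤ ∫ x in p..q, V x)
    (ht : t ∈ Icc p q) : f t ^ 2 ≤ (q - p + m⁻¹) * ∫ x in p..q, energyDensity V f x := by
  have hpq : p < q := by
    refine lt_of_le_of_ne (ht.1.trans ht.2) ?_
    rintro rfl
    rw [intervalIntegral.integral_same] at hmass
    linarith
  have hcf := hf.continuous
  have hcf' : Continuous (deriv f) := hf.continuous_deriv le_rfl
  set D := ∫ z in p..q, deriv f z ^ 2 with hD
  have hD0 : 0 ≤ D := intervalIntegral.integral_nonneg hpq.le fun z _ => sq_nonneg _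
  have hdiff : ∀ x ∈ Icc p q, (f t - f x) ^ 2 ≤ (q - p) * D := by
    intro x hx
    have hsub : ∀ {a b : ℝ}, p ≤ a → a ≤ b → b ≤ q → (b - a) * ∫ z in a..b, deriv f z ^ 2 ≤
        (q - p) * D := by
      intro a b ha hab hb
      refine mul_le_mul (by linarith) ?_
        (intervalIntegral.integral_nonneg hab fun z _ => sq_nonneg _) (by linarith)
      exact intervalIntegral.integral_mono_interval ha hab hb (ae_of_all _ fun z => sq_nonneg _)
        (Continuous.intervalIntegrable (by fun_prop) _ _)
    rcases le_total x t with h | h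
    · exact (sq_sub_le_mul_integral hf h).trans (hsub hx.1 h ht.2)
    · rw [← neg_sq, neg_sub]
      exact (sq_sub_le_mul_integral hf h).trans (hsub ht.1 h hx.2)
  -- the weight `ε` balances the two terms optimally
  set ε := m * (q - p) with hε
  have hε0 : 0 < ε := mul_pos hm (sub_pos.mpr hpq)
  have hpt : ∀ x ∈ Icc p q, f t ^ 2 - (1 + ε⁻¹) * ((q - p) * D) ≤ (1 + ε) * f x ^ 2 := by
    intro x hx
    have h1 : f t ^ 2 ≤ (1 + ε) * f x ^ 2 + (1 + ε⁻¹) * (f t - f x) ^ 2 := by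
      have h2 : 0 ≤ (ε * f x - (f t - f x)) ^ 2 / ε := by positivity
      have h3 : (ε * f x - (f t - f x)) ^ 2 / ε =
          ε * f x ^ 2 - 2 * f x * (f t - f x) + ε⁻¹ * (f t - f x) ^ 2 := by
        field_simp
        ring
      nlinarith
    have h4 := mul_le_mul_of_nonneg_left (hdiff x hx) (show 0 ≤ 1 + ε⁻¹ by positivity)
    linarith
  set X := f t ^ 2 - (1 + ε⁻¹) * ((q - p) * D) with hX
  have hV2 : IntervalIntegrable (fun x => V x * f x ^ 2) volume p q :=
    (hV.intervalIntegrable p q).mul_continuousOn (hf.continuous.pow 2).continuousOn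
  have hVX : X * m ≤ (1 + ε) * ∫ x in p..q, V x * f x ^ 2 := by
    have h0 : 0 ≤ ∫ x in p..q, V x * f x ^ 2 :=
      intervalIntegral.integral_nonneg hpq.le fun x _ => mul_nonneg (hV.nonneg x) (sq_nonneg _)
    rcases le_or_gt X 0 with hX0 | hX0
    · exact (mul_nonpos_of_nonpos_of_nonneg hX0 hm.le).trans (by positivity)
    · refine (mul_le_mul_of_nonneg_left hmass hX0.le).trans ?_
      rw [← intervalIntegral.integral_const_mul, ← intervalIntegral.integral_const_mul]
      refine intervalIntegral.integral_mono_on hpq.le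
        ((hV.intervalIntegrable p q).const_mul _) (hV2.const_mul _) fun x hx => ?_
      have := mul_le_mul_of_nonneg_left (hpt x hx) (hV.nonneg x)
      linarith
  have hsplit : ∫ x in p..q, energyDensity V f x = D + ∫ x in p..q, V x * f x ^ 2 :=
    intervalIntegral.integral_add (Continuous.intervalIntegrable (by fun_prop) _ _) hV2
  rw [hsplit]
  have e1 : (1 + ε⁻¹) * ((q - p) * D) = (q - p + m⁻¹) * D := by
    rw [hε]
    have : 0 < q - p := sub_pos.mpr hpq
    field_simp
  have e2 : (q - p + m⁻¹) * ∫ x in p..q, V x * f x ^ 2 =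
      ((1 + ε) * ∫ x in p..q, V x * f x ^ 2) / m := by
    rw [hε]
    field_simp
    ring
  have h5 : X ≤ ((1 + ε) * ∫ x in p..q, V x * f x ^ 2) / m := by
    rw [le_div_iff₀ hm]
    exact hVX
  rw [mul_add, e2]
  linarith

lemma integrable_energyDensity {V f : ℝ → ℝ} (hV : IsLocalPotential V) (hf : ContDiff ℝ 1 f)
    (hf' : HasCompactSupport f) : Integrable (energyDensity V f) := by
  obtain ⟨r, hr⟩ := hf'.isCompact.isBounded.subset_closedBall 0
  rw [Real.closedBall_eq_Icc] at hr
  rcases lt_or_ge r 0 with h0 | h0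
  · have hz : f = 0 := by
      funext x
      refine image_eq_zero_of_notMem_tsupport fun h => ?_
      have := hr h
      linarith [this.1, this.2]
    have : energyDensity V f = fun _ => 0 := by
      funext x
      simp [energyDensity, hz]
    rw [this]
    exact integrable_zero _ _ _
  · have h1 := (intervalIntegrable_iff_integrableOn_Icc_of_le (by linarith)).mp
      (intervalIntegrable_energyDensity hV hf (0 - r) (0 + r))
    refine (integrableOn_iff_integrable_of_support_subset fun x hx => ?_).mp h1
    by_contra hne
    have hx1 : f x = 0 := image_eq_zero_of_notMem_tsupport fun h => hne (hr h)
    have hx2 : deriv f x = 0 := by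
      by_contra h
      exact hne (hr (support_deriv_subset h))
    exact hx (by simp [energyDensity, hx1, hx2])

/-- The form bounds the `L²`-norm on the set of the points that have mass of the potential within
distance `R`: the pointwise bound is integrated over these points. -/
lemma setIntegral_sq_le {V f : ℝ → ℝ} (hV : IsLocalPotential V) (hf : ContDiff ℝ 1 f)
    (hf' : HasCompactSupport f) {m R : ℝ} (hm : 0 < m) (hR : 0 < R) {S : Set ℝ}
    (hS : MeasurableSet S) (hmass : ∀ x ∈ S, m ≤ ∫ y in (x - R)..(x + R), V y) :
    ∫ x in S, f x ^ 2 ≤ (2 * R + m⁻¹) * (2 * R) * ∫ x, energyDensity V f x := by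
  let χ : ℝ → ℝ := (Icc (-R) R).indicator fun _ => 1
  have hχ : Integrable χ := (integrable_indicator_iff measurableSet_Icc).mpr (by simp)
  have he := integrable_energyDensity hV hf hf'
  have hconv : ∀ x, convolution χ (energyDensity V f) (ContinuousLinearMap.mul ℝ ℝ) volume x =
      ∫ y in (x - R)..(x + R), energyDensity V f y := by
    intro x
    have e1 : ∀ t, ContinuousLinearMap.mul ℝ ℝ (χ t) (energyDensity V f (x - t)) =
        (Icc (-R) R).indicator (fun t => energyDensity V f (x - t)) t := by
      intro t
      by_cases h : t ∈ Icc (-R) R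
      · simp [χ, indicator_of_mem h]
      · simp [χ, indicator_of_notMem h]
    rw [convolution]
    simp_rw [e1]
    rw [integral_indicator measurableSet_Icc, integral_Icc_eq_integral_Ioc,
      ← intervalIntegral.integral_of_le (by linarith),
      intervalIntegral.integral_comp_sub_left (fun y => energyDensity V f y) x, sub_neg_eq_add]
  have hci : Integrable (fun x => ∫ y in (x - R)..(x + R), energyDensity V f y) := by
    have := hχ.integrable_convolution (ContinuousLinearMap.mul ℝ ℝ) he
    exact this.congr (Eventually.of_forall hconv)
  have hctot : ∫ x, ∫ y in (x - R)..(x + R), energyDensity V f y =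
      2 * R * ∫ x, energyDensity V f x := by
    have h1 := integral_convolution (ContinuousLinearMap.mul ℝ ℝ) (μ := volume) (ν := volume) hχ he
    simp_rw [hconv] at h1
    rw [h1]
    have h2 : ∫ x, χ x = 2 * R := by
      rw [integral_indicator measurableSet_Icc]
      simp
      rw [max_eq_left (by linarith)]
      ring
    simp [h2]
  have hc0 : ∀ x, 0 ≤ ∫ y in (x - R)..(x + R), energyDensity V f y := fun x =>
    intervalIntegral.integral_nonneg (by linarith) fun y _ => energyDensity_nonneg hV f y
  calc ∫ x in S, f x ^ 2
      ≤ ∫ x in S, (2 * R + m⁻¹) * ∫ y in (x - R)..(x + R), energyDensity V f y := by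
        refine setIntegral_mono_on (integrable_sq hf.continuous hf').integrableOn
          (hci.const_mul _).integrableOn hS fun x hx => ?_
        have := sq_le_mul_integral_energyDensity hV hf hm (hmass x hx) (t := x)
          ⟨by linarith, by linarith⟩
        rwa [show x + R - (x - R) = 2 * R by ring] at this
    _ ≤ ∫ x, (2 * R + m⁻¹) * ∫ y in (x - R)..(x + R), energyDensity V f y := by
        refine setIntegral_le_integral (hci.const_mul _) (ae_of_all _ fun x => ?_)
        exact mul_nonneg (by positivity) (hc0 x)
    _ = _ := by
        rw [integral_const_mul, hctot]
        ring

/-! ### Summation over the gaps between obstacles -/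

lemma le_add_sum_of_step {n : ℕ} {O : Finset ℕ} (hO : O ⊆ Finset.Icc 1 n) {Φ c : ℕ → ℝ}
    (h : ∀ i ∈ insert 0 O, Φ (i + run n O i + 1) ≤ Φ i + c i) :
    Φ (n + 1) ≤ Φ 0 + ∑ i ∈ insert 0 O, c i := by
  have key : ∀ k, k ∈ insert 0 (insert (n + 1) O) →
      Φ k ≤ Φ 0 + ∑ i ∈ insert 0 O with i < k, c i := by
    intro k
    induction k using Nat.strong_induction_on with
    | _ k ih =>
      intro hk
      rcases Nat.eq_zero_or_pos k with rfl | hk0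
      · simp
      · have hkO : k ∈ insert (n + 1) O := by
          rcases Finset.mem_insert.mp hk with h0 | h'
          · omega
          · exact h'
        have hkn : k ≤ n + 1 := by
          rcases Finset.mem_insert.mp hkO with h' | h'
          · omega
          · have := (Finset.mem_Icc.mp (hO h')).2
            omega
        obtain ⟨i, hi, him⟩ := Finset.exists_max_image ((insert 0 O).filter (· < k)) id
          ⟨0, by simp [hk0]⟩
        obtain ⟨hi0, hik⟩ := Finset.mem_filter.mp hi
        have hrun : run n O i = k - i - 1 := by
          refine run_eq ?_ fun r hr hmem => ?_
          · rwa [show i + (k - i - 1) + 1 = k by omega]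
          · rcases Finset.mem_insert.mp hmem with h' | h'
            · omega
            · have := him (i + r + 1) (Finset.mem_filter.mpr
                ⟨Finset.mem_insert_of_mem h', by omega⟩)
              simp only [id_eq] at this
              omega
        have hstep := h i hi0
        rw [hrun, show i + (k - i - 1) + 1 = k by omega] at hstep
        have hi1 : i ∈ insert 0 (insert (n + 1) O) := by
          rcases Finset.mem_insert.mp hi0 with h' | h'
          · simp [h']
          · simp [h']
        have hsum : ∑ x ∈ insert 0 O with x < k, c x =
            (∑ x ∈ insert 0 O with x < i, c x) + c i := by
          have e : (insert 0 O).filter (· < k) = insert i ((insert 0 O).filter (· < i)) := by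
            ext x
            rw [Finset.mem_filter, Finset.mem_insert (b := i), Finset.mem_filter]
            constructor
            · rintro ⟨hx, hxk⟩
              have := him x (Finset.mem_filter.mpr ⟨hx, hxk⟩)
              simp only [id_eq] at this
              rcases this.eq_or_lt with h' | h'
              · exact Or.inl h'
              · exact Or.inr ⟨hx, h'⟩
            · rintro (rfl | ⟨hx, hxi⟩)
              · exact ⟨hi0, hik⟩
              · exact ⟨hx, hxi.trans hik⟩
          rw [e, Finset.sum_insert (by simp), add_comm]
        rw [hsum]
        have := ih i hik hi1
        linarith
  have h1 := key (n + 1) (by simp)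
  have h2 : (insert 0 O).filter (· < n + 1) = insert 0 O :=
    Finset.filter_true_of_mem fun x hx => Nat.lt_succ_of_le (le_of_mem_insert_zero hO hx)
  rwa [h2] at h1

/-- The contribution of one gap and of the obstacle intervals next to it. -/
lemma gap_step {V f F : ℝ → ℝ} (hV : IsLocalPotential V) (hf : ContDiff ℝ 1 f)
    {k A B P l r₁ r₂ l₁ l₂ : ℝ} (hr : l ≤ r₁) (hr' : r₁ ≤ r₂) (hl : l₁ ≤ l₂) (hll : l ≤ l₂)
    (hFf : ∀ x, F x ≤ f x ^ 2)
    (hFi : ∀ a b : ℝ, IntervalIntegrable F volume a b)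
    (hz : ∀ x ∈ Icc l r₂, F x = 0) (hz' : ∀ x ∈ Icc l₁ l₂, F x = 0)
    (hA : f r₂ ^ 2 / A ≤ ∫ x in r₁..r₂, energyDensity V f x)
    (hB : f l₁ ^ 2 / B ≤ ∫ x in l₁..l₂, energyDensity V f x) (hP : 0 ≤ P)
    (hgap : r₂ ≤ l₁ → k ^ 2 * ∫ x in r₂..l₁, f x ^ 2 ≤
      (∫ x in r₂..l₁, deriv f x ^ 2) + f r₂ ^ 2 / A + f l₁ ^ 2 / B + P) :
    k ^ 2 * ∫ x in l..l₂, F x ≤ (∫ x in l..l₂, energyDensity V f x) + P := by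
  have he : ∀ a b : ℝ, IntervalIntegrable (energyDensity V f) volume a b :=
    intervalIntegrable_energyDensity hV hf
  have he0 : ∀ {a b : ℝ}, a ≤ b → 0 ≤ ∫ x in a..b, energyDensity V f x := fun h =>
    intervalIntegral.integral_nonneg h fun x _ => energyDensity_nonneg hV f x
  have hzero : ∀ {a b : ℝ}, a ≤ b → (∀ x ∈ Icc a b, F x = 0) → ∫ x in a..b, F x = 0 := by
    intro a b hab h
    rw [intervalIntegral.integral_congr (g := fun _ => (0 : ℝ))
      (fun x hx => h x (by rwa [uIcc_of_le hab] at hx))]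
    simp
  rcases le_or_gt r₂ l₁ with h | h
  · have hcf' : Continuous (deriv f) := hf.continuous_deriv le_rfl
    have hcf := hf.continuous
    have h1 : ∫ x in l..l₂, F x = ∫ x in r₂..l₁, F x := by
      rw [← intervalIntegral.integral_add_adjacent_intervals (hFi l r₂) (hFi r₂ l₂),
        ← intervalIntegral.integral_add_adjacent_intervals (hFi r₂ l₁) (hFi l₁ l₂),
        hzero (hr.trans hr') hz, hzero hl hz']
      ring
    have h2 : ∫ x in r₂..l₁, F x ≤ ∫ x in r₂..l₁, f x ^ 2 :=
      intervalIntegral.integral_mono_on h (hFi _ _)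
        (Continuous.intervalIntegrable (by fun_prop) _ _) fun x _ => hFf x
    have h3 : ∫ x in r₂..l₁, deriv f x ^ 2 ≤ ∫ x in r₂..l₁, energyDensity V f x :=
      intervalIntegral.integral_mono_on h (Continuous.intervalIntegrable (by fun_prop) _ _)
        (he _ _) fun x _ => le_add_of_nonneg_right (mul_nonneg (hV.nonneg x) (sq_nonneg _))
    have h4 : ∫ x in l..l₂, energyDensity V f x = (∫ x in l..r₁, energyDensity V f x) +
        (∫ x in r₁..r₂, energyDensity V f x) + (∫ x in r₂..l₁, energyDensity V f x) +
        ∫ x in l₁..l₂, energyDensity V f x := by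
      rw [intervalIntegral.integral_add_adjacent_intervals (he _ _) (he _ _),
        intervalIntegral.integral_add_adjacent_intervals (he _ _) (he _ _),
        intervalIntegral.integral_add_adjacent_intervals (he _ _) (he _ _)]
    have h5 := hgap h
    have h6 := mul_le_mul_of_nonneg_left h2 (sq_nonneg k)
    rw [h1, h4]
    linarith [he0 hr]
  · have h1 : ∫ x in l..l₂, F x = 0 := by
      refine hzero hll fun x hx => ?_
      rcases le_total x r₂ with h' | h'
      · exact hz x ⟨hx.1, h'⟩
      · exact hz' x ⟨by linarith, hx.2⟩
    rw [h1, mul_zero]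
    linarith [he0 hll]

/-- The left end of the `k`-th of the cells of length `h` that fill the box from the left. -/
def cellPos (L h : ℝ) (k : ℕ) : ℝ := -(L / 2) + ((k : ℝ) - 1) * h

/-- The point where the gap after position `i` begins: the right end of the right obstacle interval
of the cell `i`, or, for `i = 0`, a point to the left of the box. -/
def gapStart (L h w r : ℝ) (i : ℕ) : ℝ := if i = 0 then -(L / 2) - w else cellPos L h i + r

/-- The point where the gap before position `j` ends: the left end of the left obstacle interval
of the cell `j`, or, for `j = n + 1`, a point to the right of the box. -/
def gapEnd (L h w s : ℝ) (n j : ℕ) : ℝ := if j = n + 1 then L / 2 + w else cellPos L h j + s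

/-- Occupied cells that carry mass of the potential: every occupied cell `k` comes with intervals
`[s₁, s₂]` and `[r₁, r₂]` relative to its position, the first to the left of the second, on each of
which the potential has mass at least `m`. -/
structure IsObstacleRow (L h w m s₁ s₂ r₁ r₂ : ℝ) (n : ℕ) (O : Finset ℕ) (V : ℝ → ℝ) : Prop where
  box_pos : 0 < L
  cell_pos : 0 < h
  mass_pos : 0 < m
  width_pos : 0 < w
  subset : O ⊆ Finset.Icc 1 n
  fits : n * h ≤ L
  neg_le : -w ≤ s₁
  left_lt : s₁ < s₂
  le : s₂ ≤ r₁
  right_lt : r₁ < r₂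
  le_width : r₂ ≤ w
  left_mass : ∀ k ∈ O, m ≤ ∫ x in (cellPos L h k + s₁)..(cellPos L h k + s₂), V x
  right_mass : ∀ k ∈ O, m ≤ ∫ x in (cellPos L h k + r₁)..(cellPos L h k + r₂), V x

/-- The length of the gap after position `i`. -/
def gapLength (L h w s r : ℝ) (n : ℕ) (O : Finset ℕ) (i : ℕ) : ℝ :=
  gapEnd L h w s n (i + run n O i + 1) - gapStart L h w r i

/-- The middle of the gap after position `i`. -/
def gapMiddle (L h w s r : ℝ) (n : ℕ) (O : Finset ℕ) (i : ℕ) : ℝ :=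
  (gapStart L h w r i + gapEnd L h w s n (i + run n O i + 1)) / 2

/-- A lower bound for the quadratic form if all gaps are short, except for the gaps after the
positions in `K`, which become short when they are cut in the middle. -/
lemma IsObstacleRow.form_lower_bound {L h w m s₁ s₂ r₁ r₂ : ℝ} {n : ℕ} {O : Finset ℕ} {V : ℝ → ℝ}
    (H : IsObstacleRow L h w m s₁ s₂ r₁ r₂ n O V) (hV : IsLocalPotential V) {k : ℝ} (hk : 0 < k)
    (hA : r₂ - r₁ + m⁻¹ ≤ Real.pi / (2 * k)) (hB : s₂ - s₁ + m⁻¹ ≤ Real.pi / (2 * k))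
    (K : Finset ℕ) (hKO : K ⊆ insert 0 O)
    (hgap : ∀ i ∈ insert 0 O,
      gapLength L h w s₁ r₂ n O i ≤ Real.pi / k - (r₂ - r₁ + m⁻¹) - (s₂ - s₁ + m⁻¹) ∨
      i ∈ K ∧ gapLength L h w s₁ r₂ n O i / 2 ≤
        Real.pi / k - (r₂ - r₁ + m⁻¹) - (s₂ - s₁ + m⁻¹))
    {f : ℝ → ℝ} (hf : ContDiff ℝ 1 f) (hf' : HasCompactSupport f) (hfb : tsupport f ⊆ box L) :
    k ^ 2 * ∫ x, f x ^ 2 ≤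
      (1 + k ^ 2 * ((4 * w + m⁻¹) * (4 * w))) * (∫ x, energyDensity V f x) +
      ((r₂ - r₁ + m⁻¹)⁻¹ + (s₂ - s₁ + m⁻¹)⁻¹) *
        ∑ i ∈ K, f (gapMiddle L h w s₁ r₂ n O i) ^ 2 := by
  have hm := H.mass_pos
  have hh := H.cell_pos
  have hw := H.width_pos
  have hL := H.box_pos
  have hfits := H.fits
  have h1w := H.neg_le
  have h12 := H.left_lt
  have h23 := H.le
  have h34 := H.right_lt
  have h4w := H.le_width
  have hm' : 0 < m⁻¹ := inv_pos.mpr hm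
  set A := r₂ - r₁ + m⁻¹ with hAdef
  set B := s₂ - s₁ + m⁻¹ with hBdef
  have hA0 : 0 < A := by linarith
  have hB0 : 0 < B := by linarith
  have hzero : ∀ x, x ∉ box L → f x = 0 := fun x hx =>
    image_eq_zero_of_notMem_tsupport fun h => hx (hfb h)
  have hleft : f (-(L / 2) - w) = 0 := hzero _ fun h => by linarith [h.1]
  have hright : f (L / 2 + w) = 0 := hzero _ fun h => by linarith [h.2]
  -- the points near an obstacle
  let N : Set ℝ := ⋃ k ∈ O, Icc (cellPos L h k - w) (cellPos L h k + w)
  have hN : MeasurableSet N :=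
    Finset.measurableSet_biUnion O fun _ _ => measurableSet_Icc
  have hmemN : ∀ {k x}, k ∈ O → cellPos L h k - w ≤ x → x ≤ cellPos L h k + w → x ∈ N :=
    fun {k x} hk h1 h2 => mem_iUnion₂.mpr ⟨k, hk, h1, h2⟩
  have hfi := integrable_sq hf.continuous hf'
  have hNbound : ∫ x in N, f x ^ 2 ≤
      (4 * w + m⁻¹) * (4 * w) * ∫ x, energyDensity V f x := by
    have := setIntegral_sq_le hV hf hf' hm (R := 2 * w) (by linarith) hN fun x hx => by
      obtain ⟨k, hkO, hx1, hx2⟩ := mem_iUnion₂.mp hx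
      refine (H.left_mass k hkO).trans ?_
      exact intervalIntegral.integral_mono_interval (by linarith) (by linarith) (by linarith)
        (ae_of_all _ hV.nonneg) (hV.intervalIntegrable _ _)
    rwa [show 2 * (2 * w) = 4 * w by ring] at this
  let F : ℝ → ℝ := Nᶜ.indicator fun x => f x ^ 2
  have hF0 : ∀ x, 0 ≤ F x := fun x => indicator_nonneg (fun x _ => sq_nonneg _) x
  have hFf : ∀ x, F x ≤ f x ^ 2 := fun x => indicator_le_self' (fun x _ => sq_nonneg _) x
  have hFint : Integrable F := hfi.indicator hN.compl
  have hFN : ∀ x ∈ N, F x = 0 := fun x hx => indicator_of_notMem (notMem_compl_iff.mpr hx) _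
  have hFb : ∀ x, f x = 0 → F x = 0 := fun x hx =>
    le_antisymm ((hFf x).trans (by rw [hx]; norm_num)) (hF0 x)
  have htotal : ∫ x, f x ^ 2 = (∫ x in N, f x ^ 2) + ∫ x, F x := by
    rw [integral_indicator hN.compl, integral_add_compl hN hfi]
  -- the left end of the piece that belongs to position `i`
  let l : ℕ → ℝ := fun i => if i = 0 then -(L / 2) - w else
    if i = n + 1 then L / 2 + w else cellPos L h i + s₂
  let pen : ℕ → ℝ := fun i => if i ∈ K then
    (A⁻¹ + B⁻¹) * f (gapMiddle L h w s₁ r₂ n O i) ^ 2 else 0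
  have hpen0 : ∀ i, 0 ≤ pen i := by
    intro i
    simp only [pen]
    split_ifs
    · positivity
    · exact le_rfl
  have hei := integrable_energyDensity hV hf hf'
  have hcell : ∀ k ∈ O, 1 ≤ k ∧ k ≤ n ∧ -(L / 2) ≤ cellPos L h k ∧ cellPos L h k ≤ L / 2 := by
    intro k hkO
    obtain ⟨h1, h2⟩ := Finset.mem_Icc.mp (H.subset hkO)
    have h3 : (1 : ℝ) ≤ k := by exact_mod_cast h1
    have h4 : (k : ℝ) ≤ n := by exact_mod_cast h2
    refine ⟨h1, h2, ?_, ?_⟩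
    · unfold cellPos
      have := mul_nonneg (sub_nonneg.mpr h3) hh.le
      linarith
    · unfold cellPos
      have : ((k : ℝ) - 1) * h ≤ n * h := mul_le_mul_of_nonneg_right (by linarith) hh.le
      linarith
  have hstep : ∀ i ∈ insert 0 O, k ^ 2 * ∫ x in (l i)..(l (i + run n O i + 1)), F x ≤
      (∫ x in (l i)..(l (i + run n O i + 1)), energyDensity V f x) + pen i := by
    intro i hi
    have hin := le_of_mem_insert_zero H.subset hi
    have hjmem := run_spec O hin
    have hg := hgap i hi
    unfold gapLength at hg
    set j := i + run n O i + 1 with hj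
    have hj0 : j ≠ 0 := by omega
    -- the obstacle to the left of the gap
    obtain ⟨ρ, hρ1, hρ2, hρz, hρA, hρl⟩ : ∃ ρ, l i ≤ ρ ∧ ρ ≤ gapStart L h w r₂ i ∧
        (∀ x ∈ Icc (l i) (gapStart L h w r₂ i), F x = 0) ∧
        f (gapStart L h w r₂ i) ^ 2 / A ≤
          (∫ x in ρ..(gapStart L h w r₂ i), energyDensity V f x) ∧
        (i = 0 ∧ l i = -(L / 2) - w ∨
          i ∈ O ∧ l i = cellPos L h i + s₂) := by
      rcases Finset.mem_insert.mp hi with h0 | hiO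
      · have e1 : l i = -(L / 2) - w := by simp [l, h0]
        have e2 : gapStart L h w r₂ i = -(L / 2) - w := by simp [gapStart, h0]
        refine ⟨-(L / 2) - w, e1.le, e2.ge, fun x hx => hFb x ?_, ?_, Or.inl ⟨h0, e1⟩⟩
        · rw [e1, e2] at hx
          rw [le_antisymm hx.2 hx.1, hleft]
        · rw [e2, hleft, intervalIntegral.integral_same]
          norm_num
      · obtain ⟨c1, c2, c3, c4⟩ := hcell i hiO
        have e1 : l i = cellPos L h i + s₂ := by
          simp only [l]
          rw [if_neg (by omega), if_neg (by omega)]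
        have e2 : gapStart L h w r₂ i = cellPos L h i + r₂ := by
          rw [gapStart, if_neg (by omega)]
        refine ⟨cellPos L h i + r₁, by linarith, by linarith, fun x hx => hFN x ?_, ?_,
          Or.inr ⟨hiO, e1⟩⟩
        · exact hmemN hiO (by linarith [hx.1]) (by linarith [hx.2])
        · rw [e2, div_le_iff₀ hA0, mul_comm]
          have := sq_le_mul_integral_energyDensity hV hf hm (H.right_mass i hiO)
            (t := cellPos L h i + r₂) ⟨by linarith, le_rfl⟩
          rwa [add_sub_add_left_eq_sub] at this
    -- the obstacle to the right of the gap
    obtain ⟨hγ2, hγz, hγB, hγl⟩ : gapEnd L h w s₁ n j ≤ l j ∧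
        (∀ x ∈ Icc (gapEnd L h w s₁ n j) (l j), F x = 0) ∧
        f (gapEnd L h w s₁ n j) ^ 2 / B ≤
          (∫ x in (gapEnd L h w s₁ n j)..(l j), energyDensity V f x) ∧
        (j = n + 1 ∧ l j = L / 2 + w ∨ j ∈ O ∧ l j = cellPos L h j + s₂) := by
      rcases Finset.mem_insert.mp hjmem with h0 | hjO
      · have e1 : l j = L / 2 + w := by
          simp only [l]
          rw [if_neg hj0, if_pos h0]
        have e2 : gapEnd L h w s₁ n j = L / 2 + w := by rw [gapEnd, if_pos h0]
        refine ⟨by rw [e1, e2], fun x hx => hFb x ?_, ?_, Or.inl ⟨h0, e1⟩⟩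
        · rw [e1, e2] at hx
          rw [le_antisymm hx.2 hx.1, hright]
        · rw [e1, e2, hright, intervalIntegral.integral_same]
          norm_num
      · obtain ⟨c1, c2, c3, c4⟩ := hcell j hjO
        have e1 : l j = cellPos L h j + s₂ := by
          simp only [l]
          rw [if_neg (by omega), if_neg (by omega)]
        have e2 : gapEnd L h w s₁ n j = cellPos L h j + s₁ := by
          rw [gapEnd, if_neg (by omega)]
        refine ⟨by linarith, fun x hx => hFN x ?_, ?_, Or.inr ⟨hjO, e1⟩⟩
        · exact hmemN hjO (by linarith [hx.1]) (by linarith [hx.2])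
        · rw [e1, e2, div_le_iff₀ hB0, mul_comm]
          have := sq_le_mul_integral_energyDensity hV hf hm (H.left_mass j hjO)
            (t := cellPos L h j + s₁) ⟨le_rfl, by linarith⟩
          rwa [add_sub_add_left_eq_sub] at this
    have hll : l i ≤ l j := by
      rcases hρl with ⟨h0, e⟩ | ⟨hiO, e⟩
      · rcases hγl with ⟨h0', e'⟩ | ⟨hjO, e'⟩
        · rw [e, e']
          linarith
        · have := (hcell j hjO).2.2.1
          rw [e, e']
          linarith
      · rcases hγl with ⟨h0', e'⟩ | ⟨hjO, e'⟩
        · have := (hcell i hiO).2.2.2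
          rw [e, e']
          linarith
        · rw [e, e']
          have hij : (i : ℝ) ≤ j := by
            exact_mod_cast (by omega : i ≤ j)
          have := mul_le_mul_of_nonneg_right (sub_le_sub_right hij 1) hh.le
          unfold cellPos
          linarith
    refine gap_step hV hf hρ1 hρ2 hγ2 hll hFf (fun a b => hFint.intervalIntegrable) hρz hγz
      hρA hγB (hpen0 i) fun hle => ?_
    rcases hg with hg | ⟨hiK, hg⟩
    · have := riccati hf hk hA0 hB0 hA hB hle hg
      linarith [hpen0 i]
    · set z := gapMiddle L h w s₁ r₂ n O i with hz
      have hz' : z = (gapStart L h w r₂ i + gapEnd L h w s₁ n j) / 2 := rfl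
      have i1 := riccati hf hk hA0 hB0 hA hB (α := gapStart L h w r₂ i) (β := z)
        (by linarith) (by linarith)
      have i2 := riccati hf hk hA0 hB0 hA hB (α := z) (β := gapEnd L h w s₁ n j)
        (by linarith) (by linarith)
      have hcf := hf.continuous
      have hcf' : Continuous (deriv f) := hf.continuous_deriv le_rfl
      have c1 : ∀ a b : ℝ, IntervalIntegrable (fun x => f x ^ 2) volume a b := fun a b =>
        Continuous.intervalIntegrable (by fun_prop) _ _
      have c2 : ∀ a b : ℝ, IntervalIntegrable (fun x => deriv f x ^ 2) volume a b := fun a b =>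
        Continuous.intervalIntegrable (by fun_prop) _ _
      rw [← intervalIntegral.integral_add_adjacent_intervals (c1 _ z) (c1 z _),
        ← intervalIntegral.integral_add_adjacent_intervals (c2 _ z) (c2 z _)]
      have e : pen i = f z ^ 2 / A + f z ^ 2 / B := by
        simp only [pen, if_pos hiK, ← hz]
        ring
      rw [e]
      linarith
  have htele := le_add_sum_of_step H.subset (c := pen)
    (Φ := fun i => k ^ 2 * (∫ x in (l 0)..(l i), F x) - ∫ x in (l 0)..(l i), energyDensity V f x)
    fun i hi => by
      have h1 := hstep i hi
      have e1 := intervalIntegral.integral_add_adjacent_intervals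
        (hFint.intervalIntegrable (a := l 0) (b := l i))
        (hFint.intervalIntegrable (a := l i) (b := l (i + run n O i + 1)))
      have e2 := intervalIntegral.integral_add_adjacent_intervals
        (hei.intervalIntegrable (a := l 0) (b := l i))
        (hei.intervalIntegrable (a := l i) (b := l (i + run n O i + 1)))
      rw [← e1, ← e2]
      linarith
  have hl0 : l 0 = -(L / 2) - w := by simp [l]
  have hln : l (n + 1) = L / 2 + w := by simp [l]
  have hpsum : ∑ i ∈ insert 0 O, pen i =
      (A⁻¹ + B⁻¹) * ∑ i ∈ K, f (gapMiddle L h w s₁ r₂ n O i) ^ 2 := by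
    rw [Finset.mul_sum, ← Finset.sum_filter, Finset.filter_mem_eq_inter,
      Finset.inter_eq_right.mpr hKO]
  have hFtot : ∫ x in (l 0)..(l (n + 1)), F x = ∫ x, F x := by
    refine intervalIntegral.integral_eq_integral_of_support_subset fun x hx => ?_
    by_contra hne
    refine hx (hFb x (hzero x fun hb => hne ?_))
    rw [hl0, hln]
    exact ⟨by linarith [hb.1], by linarith [hb.2]⟩
  have hetot : ∫ x in (l 0)..(l (n + 1)), energyDensity V f x ≤ ∫ x, energyDensity V f x := by
    rw [intervalIntegral.integral_of_le (by rw [hl0, hln]; linarith)]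
    exact setIntegral_le_integral hei (ae_of_all _ (energyDensity_nonneg hV f))
  simp only [intervalIntegral.integral_same, hFtot, hpsum] at htele
  have h7 := mul_le_mul_of_nonneg_left hNbound (sq_nonneg k)
  rw [htotal]
  linarith

/-- The corresponding lower bound for an eigenvalue. -/
lemma IsObstacleRow.le_eigenvalue {L h w m s₁ s₂ r₁ r₂ : ℝ} {n : ℕ} {O : Finset ℕ} {V : ℝ → ℝ}
    (H : IsObstacleRow L h w m s₁ s₂ r₁ r₂ n O V) (hV : IsLocalPotential V)
    (hV' : IsBoundedPotential L V) {k : ℝ} (hk : 0 < k)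
    (hA : r₂ - r₁ + m⁻¹ ≤ Real.pi / (2 * k)) (hB : s₂ - s₁ + m⁻¹ ≤ Real.pi / (2 * k))
    (K : Finset ℕ) (hKO : K ⊆ insert 0 O)
    (hgap : ∀ i ∈ insert 0 O,
      gapLength L h w s₁ r₂ n O i ≤ Real.pi / k - (r₂ - r₁ + m⁻¹) - (s₂ - s₁ + m⁻¹) ∨
      i ∈ K ∧ gapLength L h w s₁ r₂ n O i / 2 ≤
        Real.pi / k - (r₂ - r₁ + m⁻¹) - (s₂ - s₁ + m⁻¹))
    {j : ℕ} (hj : K.card < j) :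
    k ^ 2 / (1 + k ^ 2 * ((4 * w + m⁻¹) * (4 * w))) ≤ eigenvalue L V j := by
  set c := 1 + k ^ 2 * ((4 * w + m⁻¹) * (4 * w)) with hc
  have hc0 : 0 < c := by
    have := H.mass_pos
    have := H.width_pos
    positivity
  refine le_eigenvalue_of_real H.box_pos hV' hj
    (fun t => gapMiddle L h w s₁ r₂ n O (K.equivFin.symm t))
    (C := ((r₂ - r₁ + m⁻¹)⁻¹ + (s₂ - s₁ + m⁻¹)⁻¹) / c) fun f hf hf' hfb => ?_
  have h1 := H.form_lower_bound hV hk hA hB K hKO hgap hf hf' hfb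
  have h2 : ∑ t, f (gapMiddle L h w s₁ r₂ n O (K.equivFin.symm t)) ^ 2 =
      ∑ i ∈ K, f (gapMiddle L h w s₁ r₂ n O i) ^ 2 := by
    rw [Equiv.sum_comp K.equivFin.symm
      (fun i : K => f (gapMiddle L h w s₁ r₂ n O i) ^ 2),
      Finset.sum_coe_sort K (fun i => f (gapMiddle L h w s₁ r₂ n O i) ^ 2)]
  rw [h2, div_mul_eq_mul_div, div_le_iff₀ hc0]
  refine h1.trans (le_of_eq ?_)
  rw [← hc, add_mul _ _ c, mul_right_comm, div_mul_cancel₀ _ hc0.ne', mul_comm c]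

/-! ### The spectral gap of a row of obstacles -/

/-- The gap between an obstacle row with `(longRuns n O D).card < j` and its ground state energy.
The longest run of `R` empty cells contains an interval of length `l = R * h - (Cl + Cr)` without
potential, which bounds the first eigenvalue by `(π / l) ^ 2`. All gaps after positions outside
`longRuns n O D` are, with the corrections for the penetrable obstacles at their ends, shorter than
`l - δ`, and this bounds the `j`-th eigenvalue from below by about `(π / (l - δ)) ^ 2`. -/
lemma IsObstacleRow.eigenvalue_gap {L h w m s₁ s₂ r₁ r₂ : ℝ} {n : ℕ} {O : Finset ℕ} {V : ℝ → ℝ}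
    (H : IsObstacleRow L h w m s₁ s₂ r₁ r₂ n O V) (hV : IsLocalPotential V)
    (hV' : IsBoundedPotential L V) {Cl Cr : ℝ} (hCl : 0 ≤ Cl) (hCr : 0 ≤ Cr)
    (hV0 : ∀ i k : ℕ, i + k ≤ n → (∀ r < k, i + r + 1 ∉ O) →
      ∀ x ∈ Ioo (cellPos L h (i + 1) + Cr) (cellPos L h (i + k + 1) - Cl), V x = 0)
    (hL : L ≤ (n + 1) * h) {R D j : ℕ} (hle : ∀ i ∈ insert 0 O, run n O i ≤ R)
    (hex : ∃ i ∈ insert 0 O, run n O i = R) (hfirst : 2 * run n O 0 ≤ R)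
    (hlast : ∀ i ∈ insert 0 O, i + run n O i = n → 2 * run n O i ≤ R)
    {δ : ℝ} (hδ : 0 < δ)
    (hD : δ + (r₂ - r₁ + m⁻¹) + (s₂ - s₁ + m⁻¹) + (Cl + s₁) + (Cr + h - r₂) ≤ D * h)
    (hR : 4 * h + 4 * w + 2 * (Cl + Cr) + 2 * ((r₂ - r₁ + m⁻¹) + (s₂ - s₁ + m⁻¹) + δ) ≤ R * h)
    (hR' : δ ^ 2 + (4 * w + m⁻¹) * (4 * w) * Real.pi ^ 2 ≤ δ * (R * h - (Cl + Cr)))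
    (hj : (longRuns n O D).card < j) :
    eigenvalue L V 1 ≤ (Real.pi / (R * h - (Cl + Cr))) ^ 2 ∧
    Real.pi ^ 2 * δ / (R * h - (Cl + Cr)) ^ 3 ≤ eigenvalue L V j - eigenvalue L V 1 := by
  have hm' : 0 < m⁻¹ := inv_pos.mpr H.mass_pos
  have hh := H.cell_pos
  have hw := H.width_pos
  have hfits := H.fits
  have h1w := H.neg_le
  have h12 := H.left_lt
  have h23 := H.le
  have h34 := H.right_lt
  have h4w := H.le_width
  set l := (R : ℝ) * h - (Cl + Cr) with hl
  have hlδ : 0 < l - δ := by linarith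
  have hpi := Real.pi_pos
  have hE1 : eigenvalue L V 1 ≤ (Real.pi / l) ^ 2 := by
    obtain ⟨i, hi, hiR⟩ := hex
    have hin := le_of_mem_insert_zero H.subset hi
    have hir : i + R ≤ n := by
      have := run_spec O hin
      rw [hiR] at this
      rcases Finset.mem_insert.mp this with h' | h'
      · omega
      · have := (Finset.mem_Icc.mp (H.subset h')).2
        omega
    have hsub : cellPos L h (i + R + 1) - Cl - (cellPos L h (i + 1) + Cr) = l := by
      unfold cellPos
      push_cast
      rw [hl]
      ring
    have := eigenvalue_one_le_of_eq_zero H.box_pos hV' (α := cellPos L h (i + 1) + Cr)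
      (β := cellPos L h (i + R + 1) - Cl) (by linarith) ?_ ?_ ?_
    · rwa [hsub] at this
    · unfold cellPos
      push_cast
      have : (0 : ℝ) ≤ i * h := by positivity
      linarith
    · unfold cellPos
      push_cast
      have : ((i : ℝ) + R) * h ≤ n * h :=
        mul_le_mul_of_nonneg_right (by exact_mod_cast hir) hh.le
      linarith
    · exact hV0 i R hir fun r hr hmem =>
        notMem_of_lt_run (by rwa [hiR]) (Finset.mem_insert_of_mem hmem)
  refine ⟨hE1, ?_⟩
  have hk : 0 < Real.pi / (l - δ) := by positivity
  have hk2 : Real.pi / (2 * (Real.pi / (l - δ))) = (l - δ) / 2 := by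
    field_simp
  have hk1 : Real.pi / (Real.pi / (l - δ)) = l - δ := by
    field_simp
  have hEj : (Real.pi / (l - δ)) ^ 2 / (1 + (Real.pi / (l - δ)) ^ 2 *
      ((4 * w + m⁻¹) * (4 * w))) ≤ eigenvalue L V j := by
    refine H.le_eigenvalue hV hV' hk (by rw [hk2]; linarith) (by rw [hk2]; linarith)
      (longRuns n O D) (fun i hi => (mem_longRuns.mp hi).1) (fun i hi => ?_) hj
    rw [hk1]
    have hin := le_of_mem_insert_zero H.subset hi
    have hjmem := run_spec O hin
    have hRi : (run n O i : ℝ) ≤ R := by exact_mod_cast hle i hi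
    have hRi' : (run n O i : ℝ) * h ≤ R * h := mul_le_mul_of_nonneg_right hRi hh.le
    unfold gapLength gapEnd gapStart
    -- gaps at the boundary of the box
    have hbd : ∀ g : ℝ, g ≤ (run n O i + 2) * h + 2 * w → 2 * run n O i ≤ R →
        g ≤ l - δ - (r₂ - r₁ + m⁻¹) - (s₂ - s₁ + m⁻¹) := by
      intro g hg h2
      have : (2 * (run n O i : ℝ)) * h ≤ R * h :=
        mul_le_mul_of_nonneg_right (by exact_mod_cast h2) hh.le
      linarith
    by_cases hj1 : i + run n O i + 1 = n + 1
    · rw [if_pos hj1]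
      refine Or.inl (hbd _ ?_ (hlast i hi (by omega)))
      have hn : (n : ℝ) = i + run n O i := by exact_mod_cast (by omega : n = i + run n O i)
      rw [hn] at hL
      split_ifs with h0
      · rw [h0, Nat.cast_zero] at hL
        rw [h0]
        linarith
      · unfold cellPos
        linarith
    · rw [if_neg hj1]
      by_cases h0 : i = 0
      · rw [if_pos h0]
        refine Or.inl (hbd _ ?_ (by rwa [h0]))
        unfold cellPos
        rw [h0]
        push_cast
        linarith
      · rw [if_neg h0]
        unfold cellPos
        push_cast
        by_cases hil : i ∈ longRuns n O D
        · refine Or.inr ⟨hil, ?_⟩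
          linarith
        · left
          rw [mem_longRuns] at hil
          push Not at hil
          obtain ⟨k, hk, hkD⟩ := hil hi
          have h3 : (run n O i : ℝ) + D ≤ R := by exact_mod_cast hkD.trans (hle k hk)
          have h4 := mul_le_mul_of_nonneg_right h3 hh.le
          linarith
  set C := (4 * w + m⁻¹) * (4 * w) with hC
  have hl0 : 0 < l := by linarith
  have hC0 : 0 ≤ C := by positivity
  have e1 : (Real.pi / (l - δ)) ^ 2 / (1 + (Real.pi / (l - δ)) ^ 2 * C) =
      Real.pi ^ 2 / ((l - δ) ^ 2 + C * Real.pi ^ 2) := by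
    field_simp
  have e2 : Real.pi ^ 2 / (l * (l - δ)) ≤ Real.pi ^ 2 / ((l - δ) ^ 2 + C * Real.pi ^ 2) := by
    apply div_le_div_of_nonneg_left (by positivity) (by positivity)
    linarith
  have e3 : Real.pi ^ 2 / (l * (l - δ)) - (Real.pi / l) ^ 2 =
      Real.pi ^ 2 * δ / (l ^ 2 * (l - δ)) := by
    field_simp
    ring
  have e4 : Real.pi ^ 2 * δ / l ^ 3 ≤ Real.pi ^ 2 * δ / (l ^ 2 * (l - δ)) := by
    apply div_le_div_of_nonneg_left (by positivity) (by positivity)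
    rw [pow_succ]
    exact mul_le_mul_of_nonneg_left (by linarith) (by positivity)
  rw [e1] at hEj
  linarith

/-! ### The potential of a locally finite configuration -/

section potential

variable {Ω : Type*} {M : Ω → Measure ℝ} {ω : Ω} {u : ℝ → ℝ} {Cl Cr : ℝ}

lemma IsSingleSitePotential.eq_zero (hu : IsSingleSitePotential u Cl Cr) {x : ℝ}
    (hx : x ∉ Icc (-Cl) Cr) : u x = 0 :=
  image_eq_zero_of_notMem_tsupport (by rwa [hu.support_eq])

lemma IsSingleSitePotential.integrableOn (hu : IsSingleSitePotential u Cl Cr) {s : Set ℝ}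
    (hs : volume s ≠ ∞) : IntegrableOn u s := by
  obtain ⟨K, hK⟩ := hu.bounded
  exact Measure.integrableOn_of_bounded hs hu.measurable.aestronglyMeasurable (M := K)
    (ae_of_all _ fun x => by rw [Real.norm_of_nonneg (hu.nonneg x)]; exact hK x)

lemma IsSingleSitePotential.intervalIntegrable (hu : IsSingleSitePotential u Cl Cr) (a b : ℝ) :
    IntervalIntegrable u volume a b :=
  ⟨hu.integrableOn measure_Ioc_lt_top.ne, hu.integrableOn measure_Ioc_lt_top.ne⟩

lemma IsSingleSitePotential.integrable_translate (hu : IsSingleSitePotential u Cl Cr)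
    [IsLocallyFiniteMeasure (M ω)] (x : ℝ) : Integrable (fun y => u (x - y)) (M ω) := by
  obtain ⟨K, hK⟩ := hu.bounded
  have hmeas : Measurable fun y => u (x - y) :=
    hu.measurable.comp (measurable_const.sub measurable_id)
  have : IntegrableOn (fun y => u (x - y)) (Icc (x - Cr) (x + Cl)) (M ω) :=
    Measure.integrableOn_of_bounded isCompact_Icc.measure_lt_top.ne hmeas.aestronglyMeasurable
      (M := K) (ae_of_all _ fun y => by rw [Real.norm_of_nonneg (hu.nonneg _)]; exact hK _)
  refine (integrableOn_iff_integrable_of_support_subset fun y hy => ?_).mp this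
  by_contra hne
  refine hy (hu.eq_zero fun h => hne ⟨?_, ?_⟩)
  · linarith [h.2]
  · linarith [h.1]

lemma potential_nonneg (hu : IsSingleSitePotential u Cl Cr) (x : ℝ) : 0 ≤ potential u M ω x :=
  integral_nonneg fun _ => hu.nonneg _

lemma measurable_potential (hu : IsSingleSitePotential u Cl Cr) [IsLocallyFiniteMeasure (M ω)] :
    Measurable (potential u M ω) := by
  have h : StronglyMeasurable fun z : ℝ × ℝ => u (z.1 - z.2) :=
    (hu.measurable.comp (measurable_fst.sub measurable_snd)).stronglyMeasurable
  exact (h.integral_prod_right' (ν := M ω)).measurable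

lemma exists_potential_le (hu : IsSingleSitePotential u Cl Cr) [IsLocallyFiniteMeasure (M ω)]
    (a b : ℝ) : ∃ K, ∀ x ∈ Icc a b, potential u M ω x ≤ K := by
  obtain ⟨K, hK⟩ := hu.bounded
  refine ⟨∫ _ in Icc (a - Cr) (b + Cl), K ∂(M ω), fun x hx => ?_⟩
  have h1 : potential u M ω x = ∫ y in Icc (a - Cr) (b + Cl), u (x - y) ∂(M ω) := by
    refine (setIntegral_eq_integral_of_forall_compl_eq_zero fun y hy => ?_).symm
    refine hu.eq_zero fun h => hy ⟨?_, ?_⟩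
    · linarith [h.2, hx.1]
    · linarith [h.1, hx.2]
  rw [h1]
  exact setIntegral_mono (hu.integrable_translate x).integrableOn
    (integrableOn_const isCompact_Icc.measure_lt_top.ne) fun y => hK _

lemma isLocalPotential_potential (hu : IsSingleSitePotential u Cl Cr)
    [IsLocallyFiniteMeasure (M ω)] : IsLocalPotential (potential u M ω) := by
  refine ⟨potential_nonneg hu, fun a b => ?_⟩
  obtain ⟨K, hK⟩ := exists_potential_le (M := M) (ω := ω) hu (min a b) (max a b)
  rw [intervalIntegrable_iff]
  refine Measure.integrableOn_of_bounded measure_Ioc_lt_top.ne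
    (measurable_potential hu).aestronglyMeasurable (M := K) ?_
  filter_upwards [ae_restrict_mem measurableSet_uIoc] with x hx
  rw [Real.norm_of_nonneg (potential_nonneg hu x)]
  exact hK x (Ioc_subset_Icc_self hx)

lemma isBoundedPotential_potential (hu : IsSingleSitePotential u Cl Cr)
    [IsLocallyFiniteMeasure (M ω)] (L : ℝ) : IsBoundedPotential L (potential u M ω) := by
  refine ⟨measurable_potential hu, potential_nonneg hu, ?_⟩
  obtain ⟨K, hK⟩ := exists_potential_le (M := M) (ω := ω) hu (-(L / 2)) (L / 2)
  exact ⟨K, fun x hx => hK x (Ioo_subset_Icc_self hx)⟩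

lemma potential_eq_zero (hu : IsSingleSitePotential u Cl Cr) {p q : ℝ} (h : M ω (Ico p q) = 0)
    {x : ℝ} (hx : x ∈ Ioo (p + Cr) (q - Cl)) : potential u M ω x = 0 := by
  refine integral_eq_zero_of_ae (measure_mono_null (fun y hy => ?_) h)
  by_contra hne
  refine hy (hu.eq_zero fun h' => hne ⟨?_, ?_⟩)
  · linarith [h'.2, hx.1]
  · linarith [h'.1, hx.2]

/-- Wherever the points in the cell `[p, p + h)` lie, the interval `[p + a, p + h + b]` contains
the translates of `[a, b]` by them, hence at least one full copy of the mass of `u` on `[a, b]`. -/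
lemma le_integral_potential (hu : IsSingleSitePotential u Cl Cr) [IsLocallyFiniteMeasure (M ω)]
    {p h a b : ℝ} (hh : 0 < h) (hab : a ≤ b) (h1 : 1 ≤ M ω (Ico p (p + h))) :
    ∫ x in a..b, u x ≤ ∫ x in (p + a)..(p + h + b), potential u M ω x := by
  have hle : p + a ≤ p + h + b := by linarith
  have hVi := (isLocalPotential_potential (M := M) (ω := ω) hu).intervalIntegrable (p + a)
    (p + h + b)
  rw [← ENNReal.ofReal_le_ofReal_iff
    (intervalIntegral.integral_nonneg hle fun x _ => potential_nonneg hu x)]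
  have e1 : ENNReal.ofReal (∫ x in (p + a)..(p + h + b), potential u M ω x) =
      ∫⁻ x in Ioc (p + a) (p + h + b), ∫⁻ y, ENNReal.ofReal (u (x - y)) ∂(M ω) := by
    rw [intervalIntegral.integral_of_le hle, ofReal_integral_eq_lintegral_ofReal
      ((intervalIntegrable_iff_integrableOn_Ioc_of_le hle).mp hVi)
      (ae_of_all _ (potential_nonneg hu))]
    refine lintegral_congr fun x => ?_
    exact ofReal_integral_eq_lintegral_ofReal (hu.integrable_translate x)
      (ae_of_all _ fun y => hu.nonneg _)
  have hmeas : Measurable fun z : ℝ × ℝ => ENNReal.ofReal (u (z.1 - z.2)) :=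
    (hu.measurable.comp (measurable_fst.sub measurable_snd)).ennreal_ofReal
  rw [e1, lintegral_lintegral_swap hmeas.aemeasurable]
  calc ENNReal.ofReal (∫ x in a..b, u x)
      ≤ ENNReal.ofReal (∫ x in a..b, u x) * M ω (Ico p (p + h)) := le_mul_of_one_le_right' h1
    _ = ∫⁻ _ in Ico p (p + h), ENNReal.ofReal (∫ x in a..b, u x) ∂(M ω) := by
        rw [setLIntegral_const]
    _ ≤ ∫⁻ y in Ico p (p + h), ∫⁻ x in Ioc (p + a) (p + h + b),
          ENNReal.ofReal (u (x - y)) ∂(volume) ∂(M ω) := by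
        refine setLIntegral_mono' (measurableSet_Ico (a := p) (b := p + h)) fun y hy => ?_
        have hle' : p + a - y ≤ p + h + b - y := by linarith
        rw [← ofReal_integral_eq_lintegral_ofReal
          (f := fun x => u (x - y)) ?_ (ae_of_all _ fun x => hu.nonneg _),
          ← intervalIntegral.integral_of_le hle,
          intervalIntegral.integral_comp_sub_right (fun x => u x)]
        · exact ENNReal.ofReal_le_ofReal (intervalIntegral.integral_mono_interval
            (by linarith [hy.1]) hab (by linarith [hy.2]) (ae_of_all _ hu.nonneg)
            (hu.intervalIntegrable _ _))
        · obtain ⟨K, hK⟩ := hu.bounded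
          exact Measure.integrableOn_of_bounded measure_Ioc_lt_top.ne
            (hu.measurable.comp (measurable_id.sub_const y)).aestronglyMeasurable (M := K)
            (ae_of_all _ fun x => by rw [Real.norm_of_nonneg (hu.nonneg _)]; exact hK _)
    _ ≤ ∫⁻ y, ∫⁻ x in Ioc (p + a) (p + h + b), ENNReal.ofReal (u (x - y)) ∂(volume) ∂(M ω) :=
        setLIntegral_le_lintegral _ _

end potential

/-! ### Poisson random measures on bounded sets -/

section Poisson

variable {Ω : Type*} [MeasurableSpace Ω] {P : Measure Ω} {ν : ℝ}
  {M : Ω → Measure ℝ}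

lemma IsPoissonRandomMeasure.measurable_apply (hM : IsPoissonRandomMeasure P ν M) {B : Set ℝ}
    (hB : MeasurableSet B) : Measurable fun ω => M ω B :=
  (Measure.measurable_coe hB).comp hM.measurable

lemma IsPoissonRandomMeasure.ae_exists_nat [IsProbabilityMeasure P]
    (hM : IsPoissonRandomMeasure P ν M) (hν : 0 < ν)
    {B : Set ℝ} (hB : MeasurableSet B) (hB' : Bornology.IsBounded B) :
    ∀ᵐ ω ∂P, ∃ m : ℕ, M ω B = m := by
  have hmeas : ∀ m : ℕ, MeasurableSet {ω | M ω B = m} := fun m =>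
    hM.measurable_apply hB (measurableSet_singleton _)
  have hset : {ω | ∃ m : ℕ, M ω B = m} = ⋃ m : ℕ, {ω | M ω B = m} := by
    ext ω
    simp
  have hone : P {ω | ∃ m : ℕ, M ω B = m} = 1 := by
    rw [hset, measure_iUnion (fun m m' hmm => ?_) hmeas]
    · set x := ν * (volume B).toReal with hx
      have hx0 : 0 ≤ x := by positivity
      have hs : HasSum (fun m : ℕ => Real.exp (-x) * x ^ m / (m.factorial : ℝ)) 1 := by
        have := (NormedSpace.expSeries_div_hasSum_exp (𝔸 := ℝ) x).mul_left (Real.exp (-x))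
        rw [← congrFun Real.exp_eq_exp_ℝ x, ← Real.exp_add, neg_add_cancel, Real.exp_zero] at this
        simpa only [mul_div_assoc] using this
      simp_rw [hM.law B hB hB']
      rw [← ENNReal.ofReal_tsum_of_nonneg (fun m => by positivity) hs.summable, hs.tsum_eq,
        ENNReal.ofReal_one]
    · refine Set.disjoint_left.mpr fun ω h h' => hmm ?_
      have : (m : ℝ≥0∞) = m' := h.symm.trans h'
      exact_mod_cast this
  exact (prob_compl_eq_zero_iff (hset ▸ MeasurableSet.iUnion hmeas)).mpr hone

lemma IsPoissonRandomMeasure.measure_eq_zero (hM : IsPoissonRandomMeasure P ν M)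
    {a b : ℝ} (hab : a ≤ b) :
    P {ω | M ω (Ico a b) = 0} = ENNReal.ofReal (Real.exp (-(ν * (b - a)))) := by
  have := hM.law (Ico a b) measurableSet_Ico (Metric.isBounded_Ico a b) 0
  rw [Nat.cast_zero] at this
  rw [this, Real.volume_Ico, ENNReal.toReal_ofReal (by linarith)]
  simp

lemma IsPoissonRandomMeasure.ae_isLocallyFiniteMeasure [IsProbabilityMeasure P]
    (hM : IsPoissonRandomMeasure P ν M)
    (hν : 0 < ν) : ∀ᵐ ω ∂P, IsLocallyFiniteMeasure (M ω) := by
  have : ∀ᵐ ω ∂P, ∀ k : ℕ, ∃ m : ℕ, M ω (Icc (-(k : ℝ)) k) = m :=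
    ae_all_iff.mpr fun k => hM.ae_exists_nat hν measurableSet_Icc (Metric.isBounded_Icc _ _)
  filter_upwards [this] with ω hω
  refine ⟨fun x => ?_⟩
  obtain ⟨k, hk⟩ := exists_nat_gt |x|
  obtain ⟨m, hm⟩ := hω k
  refine ⟨Icc (-(k : ℝ)) k, Icc_mem_nhds ?_ ?_, by rw [hm]; exact ENNReal.natCast_lt_top m⟩
  · exact (abs_lt.mp hk).1
  · exact (abs_lt.mp hk).2

end Poisson

/-! ### The occupied cells -/

section occupied

variable {Ω : Type*} [MeasurableSpace Ω] {P : Measure Ω} {ν : ℝ} {M : Ω → Measure ℝ}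
  {L h : ℝ} {n : ℕ} {ω : Ω}

open Classical in
/-- The cells among the first `n` ones that contain a point of the configuration `μ`. -/
def occupied (μ : Measure ℝ) (L h : ℝ) (n : ℕ) : Finset ℕ :=
  (Finset.Icc 1 n).filter fun k => μ (Ico (cellPos L h k) (cellPos L h (k + 1))) ≠ 0

lemma mem_occupied {μ : Measure ℝ} {k : ℕ} : k ∈ occupied μ L h n ↔
    (1 ≤ k ∧ k ≤ n) ∧ μ (Ico (cellPos L h k) (cellPos L h (k + 1))) ≠ 0 := by
  rw [occupied, Finset.mem_filter, Finset.mem_Icc]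

lemma occupied_subset (μ : Measure ℝ) (L h : ℝ) (n : ℕ) : occupied μ L h n ⊆ Finset.Icc 1 n :=
  Finset.filter_subset _ _

lemma cellPos_add (L h : ℝ) (i k : ℕ) : cellPos L h (i + k) = cellPos L h i + k * h := by
  unfold cellPos
  push_cast
  ring

lemma cellPos_mono (L : ℝ) (hh : 0 ≤ h) : Monotone (cellPos L h) := by
  intro i j hij
  obtain ⟨k, rfl⟩ := Nat.exists_eq_add_of_le hij
  rw [cellPos_add]
  have : 0 ≤ (k : ℝ) * h := by positivity
  linarith

lemma IsPoissonRandomMeasure.measure_cells_eq_zero (hM : IsPoissonRandomMeasure P ν M)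
    (hh : 0 ≤ h) (i k : ℕ) : P {ω | M ω (Ico (cellPos L h i) (cellPos L h (i + k))) = 0} =
      ENNReal.ofReal (Real.exp (-(ν * h)) ^ k) := by
  rw [hM.measure_eq_zero (cellPos_mono L hh (Nat.le_add_right _ _)), cellPos_add,
    ← Real.exp_nat_mul]
  congr 2
  ring

lemma IsPoissonRandomMeasure.measure_cells_ne_zero [IsProbabilityMeasure P]
    (hM : IsPoissonRandomMeasure P ν M) (hh : 0 ≤ h) (i k : ℕ) :
    P {ω | M ω (Ico (cellPos L h i) (cellPos L h (i + k))) ≠ 0} =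
      ENNReal.ofReal (1 - Real.exp (-(ν * h)) ^ k) := by
  have h1 : MeasurableSet {ω | M ω (Ico (cellPos L h i) (cellPos L h (i + k))) = 0} :=
    hM.measurable_apply measurableSet_Ico (measurableSet_singleton _)
  have h2 := prob_compl_eq_one_sub (μ := P) h1
  rw [hM.measure_cells_eq_zero hh, ← ENNReal.ofReal_one,
    ← ENNReal.ofReal_sub _ (by positivity)] at h2
  exact h2

/-- The occupied cells form a Bernoulli string. -/
lemma IsPoissonRandomMeasure.measure_occupied_eq [IsProbabilityMeasure P]
    (hM : IsPoissonRandomMeasure P ν M) (hν : 0 ≤ ν) (hh : 0 ≤ h) {S : Finset ℕ}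
    (hS : S ⊆ Finset.Icc 1 n) : P {ω | occupied (M ω) L h n = S} =
      ENNReal.ofReal (weight (Real.exp (-(ν * h))) n S) := by
  classical
  set p := Real.exp (-(ν * h)) with hp
  have hp1 : p ≤ 1 := Real.exp_le_one_iff.mpr (by have := mul_nonneg hν hh; linarith)
  have hp0 : 0 ≤ p := (Real.exp_pos _).le
  let B : Fin n → Set ℝ := fun k => Ico (cellPos L h (k + 1)) (cellPos L h (k + 1 + 1))
  have hBm : ∀ k, MeasurableSet (B k) := fun k => measurableSet_Ico
  have hBd : ∀ i j, i ≠ j → Disjoint (B i) (B j) := by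
    have key : ∀ i j : Fin n, i < j → Disjoint (B i) (B j) := fun i j hij =>
      Set.disjoint_left.mpr fun x hx hx' => by
        have := cellPos_mono L hh (show (i : ℕ) + 1 + 1 ≤ j + 1 by
          have := Fin.lt_def.mp hij
          omega)
        linarith [hx.2, hx'.1]
    intro i j hij
    rcases lt_or_gt_of_ne hij with h' | h'
    · exact key i j h'
    · exact (key j i h').symm
  let T : Fin n → Set ℝ≥0∞ := fun k => if (k : ℕ) + 1 ∈ S then {0}ᶜ else {0}
  have hT : ∀ k, MeasurableSet (T k) := by
    intro k
    simp only [T]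
    split_ifs
    · exact (measurableSet_singleton _).compl
    · exact measurableSet_singleton _
  have hset : {ω | occupied (M ω) L h n = S} =
      ⋂ k ∈ (Finset.univ : Finset (Fin n)), (fun ω => M ω (B k)) ⁻¹' T k := by
    ext ω
    simp only [mem_ofPred_eq, Finset.mem_univ, iInter_true, mem_iInter, mem_preimage]
    constructor
    · rintro rfl k
      simp only [T, mem_occupied]
      split_ifs with hk
      · exact hk.2
      · by_contra h0
        exact hk ⟨⟨by omega, k.2⟩, h0⟩
    · intro H
      ext k
      by_cases hk : k ∈ Finset.Icc 1 n
      · obtain ⟨k1, k2⟩ := Finset.mem_Icc.mp hk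
        have := H ⟨k - 1, by omega⟩
        simp only [T, B, Nat.sub_add_cancel k1] at this
        rw [mem_occupied]
        split_ifs at this with hkS
        · exact ⟨fun _ => hkS, fun _ => ⟨⟨k1, k2⟩, this⟩⟩
        · exact ⟨fun h' => absurd this h'.2, fun h' => absurd h' hkS⟩
      · exact ⟨fun h' => absurd (occupied_subset _ _ _ _ h') hk, fun h' => absurd (hS h') hk⟩
  rw [hset, (hM.indep n B hBm hBd).measure_inter_preimage_eq_mul Finset.univ (fun k _ => hT k)]
  have hfac : ∀ k : Fin n, P ((fun ω => M ω (B k)) ⁻¹' T k) =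
      ENNReal.ofReal (if (k : ℕ) + 1 ∈ S then 1 - p else p) := by
    intro k
    simp only [T]
    split_ifs
    · have := hM.measure_cells_ne_zero (L := L) hh (k + 1) 1
      rwa [pow_one] at this
    · have := hM.measure_cells_eq_zero (L := L) hh (k + 1) 1
      rwa [pow_one] at this
  rw [Finset.prod_congr rfl fun k _ => hfac k, ← ENNReal.ofReal_prod_of_nonneg fun k _ => by
    split_ifs <;> linarith]
  congr 1
  rw [Fin.prod_univ_eq_prod_range (fun k => if k + 1 ∈ S then 1 - p else p) n,
    Finset.range_eq_Ico, Finset.prod_Ico_add' (fun k => if k ∈ S then 1 - p else p) 0 n 1,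
    show Finset.Ico (0 + 1) (n + 1) = Finset.Icc 1 n by ext; simp,
    Finset.prod_ite, Finset.prod_const, Finset.prod_const, Finset.filter_mem_eq_inter,
    Finset.inter_eq_right.mpr hS, ← Finset.sdiff_eq_filter, Finset.card_sdiff_of_subset hS,
    Nat.card_Icc, Nat.add_sub_cancel, weight]

lemma measurableSet_occupied (hM : IsPoissonRandomMeasure P ν M) (S : Finset ℕ) :
    MeasurableSet {ω | occupied (M ω) L h n = S} := by
  classical
  have : {ω | occupied (M ω) L h n = S} = ⋂ k : ℕ, {ω | k ∈ occupied (M ω) L h n ↔ k ∈ S} := by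
    ext ω
    simp [Finset.ext_iff]
  rw [this]
  refine MeasurableSet.iInter fun k => ?_
  have hk : MeasurableSet {ω | k ∈ occupied (M ω) L h n} := by
    simp only [mem_occupied]
    refine (MeasurableSet.const _).inter ?_
    exact hM.measurable_apply measurableSet_Ico (measurableSet_singleton _).compl
  exact hk.iff (MeasurableSet.const _)

/-- The probability of an event that depends on the occupied cells only. -/
lemma IsPoissonRandomMeasure.measure_occupied [IsProbabilityMeasure P]
    (hM : IsPoissonRandomMeasure P ν M) (hν : 0 ≤ ν) (hh : 0 ≤ h) (Q : Finset ℕ → Prop)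
    [DecidablePred Q] : P {ω | Q (occupied (M ω) L h n)} =
      ENNReal.ofReal (∑ S ∈ (Finset.Icc 1 n).powerset with Q S,
        weight (Real.exp (-(ν * h))) n S) := by
  have hp1 : Real.exp (-(ν * h)) ≤ 1 :=
    Real.exp_le_one_iff.mpr (by have := mul_nonneg hν hh; linarith)
  have hset : {ω | Q (occupied (M ω) L h n)} =
      ⋃ S ∈ (Finset.Icc 1 n).powerset.filter Q, {ω | occupied (M ω) L h n = S} := by
    ext ω
    simp only [mem_ofPred_eq, mem_iUnion, exists_prop, Finset.mem_filter, Finset.mem_powerset]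
    constructor
    · exact fun hQ => ⟨_, ⟨occupied_subset _ _ _ _, hQ⟩, rfl⟩
    · rintro ⟨S, ⟨-, hQ⟩, rfl⟩
      exact hQ
  rw [hset, measure_biUnion_finset (fun S _ S' _ hne => Set.disjoint_left.mpr fun ω h h' =>
    hne (h.symm.trans h')) fun S _ => measurableSet_occupied hM S,
    ENNReal.ofReal_sum_of_nonneg fun S _ => weight_nonneg (Real.exp_pos _).le hp1 _ _]
  exact Finset.sum_congr rfl fun S hS =>
    hM.measure_occupied_eq hν hh (Finset.mem_powerset.mp (Finset.mem_filter.mp hS).1)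

lemma measure_Ico_eq_zero {μ : Measure ℝ} {i k : ℕ} (hik : i + k ≤ n)
    (h0 : ∀ r < k, i + r + 1 ∉ occupied μ L h n) :
    μ (Ico (cellPos L h (i + 1)) (cellPos L h (i + k + 1))) = 0 := by
  induction k with
  | zero => simp
  | succ k ih =>
    have h1 := ih (by omega) fun r hr => h0 r (by omega)
    have h2 : μ (Ico (cellPos L h (i + k + 1)) (cellPos L h (i + k + 1 + 1))) = 0 := by
      by_contra hne
      exact h0 k (by omega) (mem_occupied.mpr ⟨⟨by omega, by omega⟩, hne⟩)
    refine measure_mono_null ?_ (measure_union_null h1 h2)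
    rw [← add_assoc]
    exact Ico_subset_Ico_union_Ico

lemma IsPoissonRandomMeasure.measure_forall_notMem_le (hM : IsPoissonRandomMeasure P ν M)
    (hh : 0 ≤ h) {i k : ℕ} (hik : i + k ≤ n) :
    P {ω | ∀ r < k, i + r + 1 ∉ occupied (M ω) L h n} ≤
      ENNReal.ofReal (Real.exp (-(ν * h)) ^ k) := by
  rw [← hM.measure_cells_eq_zero (L := L) hh (i + 1) k]
  refine measure_mono fun ω hω => ?_
  have := measure_Ico_eq_zero hik hω
  rwa [add_right_comm] at this

/-- If some `r` successive cells are empty, then there is a run of length at least `r`. -/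
lemma exists_le_run {O : Finset ℕ} {i r : ℕ} (hir : i + r ≤ n)
    (h0 : ∀ t < r, i + t + 1 ∉ O) : ∃ k ∈ insert 0 O, r ≤ run n O k := by
  obtain ⟨k, hk, hmax⟩ := Finset.exists_max_image ((insert 0 O).filter (· ≤ i)) id
    ⟨0, by simp⟩
  obtain ⟨hk0, hki⟩ := Finset.mem_filter.mp hk
  refine ⟨k, hk0, ?_⟩
  by_contra! hlt
  have hspec := run_spec O (hki.trans (by omega : i ≤ n))
  rcases Finset.mem_insert.mp hspec with h' | h'
  · omega
  · rcases le_or_gt (k + run n O k + 1) i with h1 | h1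
    · have := hmax _ (Finset.mem_filter.mpr ⟨Finset.mem_insert_of_mem h', h1⟩)
      simp only [id_eq] at this
      omega
    · refine h0 (k + run n O k - i) (by omega) ?_
      rwa [show i + (k + run n O k - i) + 1 = k + run n O k + 1 by omega]

/-- Since disjoint blocks of cells are independent, short runs everywhere are unlikely. -/
lemma IsPoissonRandomMeasure.measure_forall_run_lt_le [IsProbabilityMeasure P]
    (hM : IsPoissonRandomMeasure P ν M) (hν : 0 ≤ ν) (hh : 0 ≤ h) {r T : ℕ} (hT : T * r ≤ n) :
    P {ω | ∀ i ∈ insert 0 (occupied (M ω) L h n), run n (occupied (M ω) L h n) i < r} ≤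
      ENNReal.ofReal (Real.exp (-(T * Real.exp (-(ν * h)) ^ r))) := by
  set p := Real.exp (-(ν * h)) with hp
  have hp1 : p ≤ 1 := Real.exp_le_one_iff.mpr (by have := mul_nonneg hν hh; linarith)
  have hp0 : 0 ≤ p := (Real.exp_pos _).le
  let B : Fin T → Set ℝ := fun k => Ico (cellPos L h (k * r + 1)) (cellPos L h (k * r + 1 + r))
  have hBd : ∀ i j, i ≠ j → Disjoint (B i) (B j) := by
    have key : ∀ i j : Fin T, i < j → Disjoint (B i) (B j) := fun i j hij =>
      Set.disjoint_left.mpr fun x hx hx' => by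
        have h1 : ((i : ℕ) + 1) * r ≤ j * r := Nat.mul_le_mul_right r (Fin.lt_def.mp hij)
        have := cellPos_mono L hh (show (i : ℕ) * r + 1 + r ≤ j * r + 1 by linarith)
        linarith [hx.2, hx'.1]
    intro i j hij
    rcases lt_or_gt_of_ne hij with h' | h'
    · exact key i j h'
    · exact (key j i h').symm
  have hsub : {ω | ∀ i ∈ insert 0 (occupied (M ω) L h n), run n (occupied (M ω) L h n) i < r} ⊆
      ⋂ k ∈ (Finset.univ : Finset (Fin T)), (fun ω => M ω (B k)) ⁻¹' {0}ᶜ := by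
    intro ω hω
    simp only [Finset.mem_univ, iInter_true, mem_iInter, mem_preimage]
    intro k hk
    by_cases hall : ∀ t < r, (k : ℕ) * r + t + 1 ∉ occupied (M ω) L h n
    · have h1 : ((k : ℕ) + 1) * r ≤ T * r := Nat.mul_le_mul_right r k.2
      obtain ⟨i, hi, hir⟩ := exists_le_run (n := n) (by linarith) hall
      exact absurd (hω i hi) (by omega)
    · push Not at hall
      obtain ⟨t, ht, htm⟩ := hall
      refine (mem_occupied.mp htm).2 (measure_mono_null (Ico_subset_Ico ?_ ?_) hk)
      · exact cellPos_mono L hh (by omega)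
      · exact cellPos_mono L hh (by omega)
  refine (measure_mono hsub).trans ?_
  rw [(hM.indep T B (fun _ => measurableSet_Ico) hBd).measure_inter_preimage_eq_mul Finset.univ
    (fun k _ => (measurableSet_singleton _).compl)]
  have hfac : ∀ k : Fin T, P ((fun ω => M ω (B k)) ⁻¹' {0}ᶜ) = ENNReal.ofReal (1 - p ^ r) :=
    fun k => hM.measure_cells_ne_zero (L := L) hh (k * r + 1) r
  have hpr : p ^ r ≤ 1 := pow_le_one₀ hp0 hp1
  rw [Finset.prod_congr rfl fun k _ => hfac k, Finset.prod_const, Finset.card_univ,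
    Fintype.card_fin, ← ENNReal.ofReal_pow (by linarith)]
  refine ENNReal.ofReal_le_ofReal ?_
  rw [← mul_neg, Real.exp_nat_mul]
  exact pow_le_pow_left₀ (by linarith) (Real.one_sub_le_exp_neg _) _

end occupied

/-! ### The gap for typical configurations -/

/-- Two disjoint intervals `[s₁, s₂]` and `[r₁, r₂]`, separated by at least the length `h` of a
cell, on each of which the single-site potential `u` has mass at least `m`. -/
structure IsMassPair (u : ℝ → ℝ) (h w m s₁ s₂ r₁ r₂ : ℝ) : Prop where
  cell_pos : 0 < h
  mass_pos : 0 < m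
  width_pos : 0 < w
  neg_le : -w ≤ s₁
  left_le : s₁ ≤ s₂
  le : s₂ + h ≤ r₁
  right_le : r₁ ≤ r₂
  le_width : r₂ + h ≤ w
  left_mass : m ≤ ∫ x in s₁..s₂, u x
  right_mass : m ≤ ∫ x in r₁..r₂, u x

section gap

variable {Ω : Type*} {M : Ω → Measure ℝ} {ω : Ω} {u : ℝ → ℝ}
  {Cl Cr L h w m s₁ s₂ r₁ r₂ : ℝ} {n : ℕ}

lemma IsMassPair.isObstacleRow (H : IsMassPair u h w m s₁ s₂ r₁ r₂)
    (hu : IsSingleSitePotential u Cl Cr) [IsLocallyFiniteMeasure (M ω)]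
    (hnat : ∀ k : ℕ, ∃ l : ℕ, M ω (Ico (cellPos L h k) (cellPos L h (k + 1))) = l)
    (hL : 0 < L) (hn : n * h ≤ L) :
    IsObstacleRow L h w m s₁ (s₂ + h) r₁ (r₂ + h) n (occupied (M ω) L h n) (potential u M ω) := by
  have hh := H.cell_pos
  have hone : ∀ k ∈ occupied (M ω) L h n,
      1 ≤ M ω (Ico (cellPos L h k) (cellPos L h k + h)) := by
    intro k hk
    have hne := (mem_occupied.mp hk).2
    obtain ⟨l, hl⟩ := hnat k
    rw [cellPos_add, Nat.cast_one, one_mul] at hl hne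
    rw [hl] at hne ⊢
    exact_mod_cast Nat.one_le_iff_ne_zero.mpr (by exact_mod_cast hne)
  refine ⟨hL, hh, H.mass_pos, H.width_pos, occupied_subset _ _ _ _, hn, H.neg_le, ?_, H.le, ?_,
    H.le_width, fun k hk => ?_, fun k hk => ?_⟩
  · linarith [H.left_le]
  · linarith [H.right_le]
  · refine H.left_mass.trans ((le_integral_potential hu hh H.left_le (hone k hk)).trans_eq ?_)
    rw [add_assoc, add_comm h]
  · refine H.right_mass.trans ((le_integral_potential hu hh H.right_le (hone k hk)).trans_eq ?_)
    rw [add_assoc, add_comm h]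

/-- The bounds on the first and the `j`-th eigenvalue for a configuration whose longest run of empty
cells is between `a` and `b` cells long, the runs at the boundary of the box being short. -/
lemma IsMassPair.eigenvalue_gap (H : IsMassPair u h w m s₁ s₂ r₁ r₂)
    (hu : IsSingleSitePotential u Cl Cr) [IsLocallyFiniteMeasure (M ω)]
    (hnat : ∀ k : ℕ, ∃ l : ℕ, M ω (Ico (cellPos L h k) (cellPos L h (k + 1))) = l)
    (hL : 0 < L) (hn : n * h ≤ L) (hn' : L ≤ (n + 1) * h) {O : Finset ℕ}
    (hO : occupied (M ω) L h n = O) {a b D j : ℕ}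
    (ha : ∃ i ∈ insert 0 O, a ≤ run n O i) (hb : ∀ i ∈ insert 0 O, run n O i ≤ b)
    (hfirst : 2 * run n O 0 ≤ a)
    (hlast : ∀ i ∈ insert 0 O, i + run n O i = n → 2 * run n O i ≤ a)
    {δ : ℝ} (hδ : 0 < δ)
    (hD : δ + (r₂ + h - r₁ + m⁻¹) + (s₂ + h - s₁ + m⁻¹) + (Cl + s₁) + (Cr - r₂) ≤ D * h)
    (ha1 : 4 * h + 4 * w + 2 * (Cl + Cr) +
      2 * ((r₂ + h - r₁ + m⁻¹) + (s₂ + h - s₁ + m⁻¹) + δ) ≤ a * h)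
    (ha2 : δ ^ 2 + (4 * w + m⁻¹) * (4 * w) * Real.pi ^ 2 ≤ δ * (a * h - (Cl + Cr)))
    (hj : (longRuns n O D).card < j) :
    eigenvalue L (potential u M ω) 1 ≤ (Real.pi / (a * h - (Cl + Cr))) ^ 2 ∧
    Real.pi ^ 2 * δ / (b * h) ^ 3 ≤
      eigenvalue L (potential u M ω) j - eigenvalue L (potential u M ω) 1 := by
  have hh := H.cell_pos
  have hm' : 0 < m⁻¹ := inv_pos.mpr H.mass_pos
  have hw := H.width_pos
  have hCl := hu.left_pos
  have hCr := hu.right_pos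
  have h12 := H.left_le
  have h34 := H.right_le
  have hrow := H.isObstacleRow hu hnat hL hn
  rw [hO] at hrow
  obtain ⟨i, hi, hmax⟩ := Finset.exists_max_image (insert 0 O) (run n O) ⟨0, by simp⟩
  have haR : a ≤ run n O i := by
    obtain ⟨k, hk, hak⟩ := ha
    exact hak.trans (hmax k hk)
  have haR' : (a : ℝ) * h ≤ run n O i * h :=
    mul_le_mul_of_nonneg_right (by exact_mod_cast haR) hh.le
  have hRb : (run n O i : ℝ) * h ≤ b * h :=
    mul_le_mul_of_nonneg_right (by exact_mod_cast hb i hi) hh.le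
  have key := hrow.eigenvalue_gap (isLocalPotential_potential hu)
    (isBoundedPotential_potential hu L)
    hCl.le hCr.le (fun i k hik h0 x hx => potential_eq_zero hu
      (measure_Ico_eq_zero hik (by rwa [hO])) hx) hn' (R := run n O i) (D := D) (j := j) hmax
    ⟨i, hi, rfl⟩ (hfirst.trans haR) (fun k hk hkn => (hlast k hk hkn).trans haR) hδ (by linarith)
    (by linarith) (ha2.trans (mul_le_mul_of_nonneg_left (by linarith) hδ.le)) hj
  have hpi := Real.pi_pos
  have hpos : 0 < (a : ℝ) * h - (Cl + Cr) := by linarith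
  refine ⟨key.1.trans ?_, le_trans ?_ key.2⟩
  · refine pow_le_pow_left₀ (div_nonneg hpi.le (by linarith)) ?_ 2
    exact div_le_div_of_nonneg_left hpi.le hpos (by linarith)
  · refine div_le_div_of_nonneg_left (by positivity) (pow_pos (by linarith) 3) ?_
    exact pow_le_pow_left₀ (by linarith) (by linarith) 3

end gap

section bad

variable {Ω : Type*} [MeasurableSpace Ω] {P : Measure Ω} {ν : ℝ} {M : Ω → Measure ℝ}
  {L h : ℝ} {n : ℕ}

lemma add_run_le {O : Finset ℕ} (hO : O ⊆ Finset.Icc 1 n) {i : ℕ} (hi : i ∈ insert 0 O) :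
    i + run n O i ≤ n := by
  rcases Finset.mem_insert.mp (run_spec O (le_of_mem_insert_zero hO hi)) with h' | h'
  · omega
  · have := (Finset.mem_Icc.mp (hO h')).2
    omega

lemma notMem_of_le_run {O : Finset ℕ} {i r t : ℕ} (h : r ≤ run n O i) (ht : t < r) :
    i + t + 1 ∉ O := fun h' =>
  notMem_of_lt_run (ht.trans_le h) (Finset.mem_insert_of_mem h')

/-- A long run at the left boundary, a long run at the right boundary, and a very long run anywhere
are unlikely. -/
lemma IsPoissonRandomMeasure.measure_bad_le (hM : IsPoissonRandomMeasure P ν M) (hh : 0 ≤ h)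
    (r b : ℕ) :
    P {ω | r ≤ run n (occupied (M ω) L h n) 0 ∨
      (∃ i ∈ insert 0 (occupied (M ω) L h n), i + run n (occupied (M ω) L h n) i = n ∧
        r ≤ run n (occupied (M ω) L h n) i) ∨
      ∃ i ∈ insert 0 (occupied (M ω) L h n), b ≤ run n (occupied (M ω) L h n) i} ≤
    ENNReal.ofReal (2 * Real.exp (-(ν * h)) ^ r + (n + 1) * Real.exp (-(ν * h)) ^ b) := by
  set p := Real.exp (-(ν * h)) with hp
  have hp0 : 0 ≤ p := (Real.exp_pos _).le
  let A : ℕ → ℕ → Set Ω := fun i k => {ω | i + k ≤ n ∧ ∀ t < k, i + t + 1 ∉ occupied (M ω) L h n}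
  have hA : ∀ i k, P (A i k) ≤ ENNReal.ofReal (p ^ k) := by
    intro i k
    by_cases hik : i + k ≤ n
    · exact (measure_mono fun ω hω => hω.2).trans (hM.measure_forall_notMem_le hh hik)
    · have : A i k = ∅ := by
        ext ω
        simp [A, hik]
      rw [this, measure_empty]
      exact zero_le
  refine (measure_mono (t := A 0 r ∪ (A (n - r) r ∪ ⋃ i ∈ Finset.range (n + 1), A i b))
    fun ω hω => ?_).trans ?_
  · have hO := occupied_subset (M ω) L h n
    rcases hω with h1 | ⟨i, hi, hin, hir⟩ | ⟨i, hi, hib⟩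
    · have := add_run_le hO (Finset.mem_insert_self 0 _)
      exact Or.inl ⟨by omega, fun t ht => notMem_of_le_run h1 ht⟩
    · refine Or.inr (Or.inl ⟨by omega, fun t ht => ?_⟩)
      have := notMem_of_le_run (t := n - r - i + t) (le_refl (run n (occupied (M ω) L h n) i))
        (by omega)
      rwa [show i + (n - r - i + t) + 1 = n - r + t + 1 by omega] at this
    · have := add_run_le hO hi
      refine Or.inr (Or.inr (mem_iUnion₂.mpr ⟨i, Finset.mem_range.mpr (by omega), ?_⟩))
      exact ⟨by omega, fun t ht => notMem_of_le_run hib ht⟩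
  · have h3 : P (⋃ i ∈ Finset.range (n + 1), A i b) ≤ ENNReal.ofReal ((n + 1) * p ^ b) := by
      refine (measure_biUnion_finset_le _ _).trans ((Finset.sum_le_sum fun i _ => hA i b).trans ?_)
      rw [Finset.sum_const, Finset.card_range, nsmul_eq_mul, ENNReal.ofReal_mul (by positivity)]
      refine mul_le_mul_left (le_of_eq ?_) _
      rw [← Nat.cast_add_one, ENNReal.ofReal_natCast]
    refine (measure_union_le _ _).trans ((add_le_add (hA 0 r) ((measure_union_le _ _).trans
      (add_le_add (hA _ r) h3))).trans ?_)
    rw [← ENNReal.ofReal_add (by positivity) (by positivity),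
      ← ENNReal.ofReal_add (by positivity) (by positivity)]
    exact ENNReal.ofReal_le_ofReal (by linarith)

end bad

/-! ### Asymptotics in the logarithm of the box length -/

lemma tendsto_linear_pow_mul_exp_neg (c d : ℝ) (k : ℕ) {a : ℝ} (ha : 0 < a) :
    Tendsto (fun x : ℝ => (c * x + d) ^ k * Real.exp (-(a * x))) atTop (𝓝 0) := by
  have h1 := (Polynomial.tendsto_div_exp_atTop
    ((Polynomial.C (c / a) * Polynomial.X + Polynomial.C d) ^ k)).comp
    (tendsto_id.const_mul_atTop ha)
  refine h1.congr fun x => ?_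
  simp only [Function.comp_apply, id_eq, Polynomial.eval_pow, Polynomial.eval_add,
    Polynomial.eval_mul, Polynomial.eval_C, Polynomial.eval_X]
  rw [Real.exp_neg, div_eq_mul_inv, ← mul_assoc, div_mul_cancel₀ _ ha.ne']

lemma tendsto_exp_neg_mul {a : ℝ} (ha : 0 < a) :
    Tendsto (fun x : ℝ => Real.exp (-(a * x))) atTop (𝓝 0) := by
  simpa using tendsto_linear_pow_mul_exp_neg 0 1 1 ha

/-- The number of cells of length `h` in a box of length `exp x`. -/
def cellCount (h x : ℝ) : ℕ := ⌊Real.exp x / h⌋₊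

/-- A lower bound, in cells, for the longest run of empty cells in a box of length `exp x`. The
longest run has about `x / (ν * h)` cells, so that `θ` is to be less than `1`. -/
def shortRun (ν h W θ x : ℝ) : ℕ := ⌈θ * x / (ν * h) + W / h⌉₊

/-- An upper bound, in cells, for the longest run of empty cells in a box of length `exp x`. -/
def longRun (ν h x : ℝ) : ℕ := ⌈2 * x / (ν * h)⌉₊

/-- A number of blocks of `shortRun ν h W θ x` cells that fit into a box of length `exp x`. -/
def blockCount (θ x : ℝ) : ℕ := ⌊Real.exp ((1 + θ) / 2 * x)⌋₊

/-- A bound for the probability that the runs of empty cells in a box of length `exp x` do not have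
their typical lengths. -/
def errorBound (ν h W θ x : ℝ) : ℝ :=
  2 * Real.exp (-(ν * h)) ^ (shortRun ν h W θ x / 2) +
    (cellCount h x + 1) * Real.exp (-(ν * h)) ^ longRun ν h x +
    Real.exp (-(blockCount θ x * Real.exp (-(ν * h)) ^ shortRun ν h W θ x))

section asymptotics

variable {ν h W θ : ℝ}

lemma cellCount_mul_le (hh : 0 < h) (x : ℝ) : cellCount h x * h ≤ Real.exp x := by
  rw [← le_div_iff₀ hh]
  exact Nat.floor_le (by positivity)

lemma exp_le_cellCount (hh : 0 < h) (x : ℝ) : Real.exp x ≤ (cellCount h x + 1) * h := by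
  rw [← div_le_iff₀ hh]
  exact (Nat.lt_floor_add_one _).le

lemma le_shortRun (hν : 0 < ν) (hh : 0 < h) (x : ℝ) :
    θ * x / ν + W ≤ shortRun ν h W θ x * h := by
  have h1 := mul_le_mul_of_nonneg_right (Nat.le_ceil (θ * x / (ν * h) + W / h)) hh.le
  refine le_trans (le_of_eq ?_) h1
  field_simp

lemma shortRun_le (hν : 0 < ν) (hh : 0 < h) (hW : 0 ≤ W) (hθ : 0 ≤ θ) {x : ℝ} (hx : 0 ≤ x) :
    (shortRun ν h W θ x : ℝ) ≤ θ * x / (ν * h) + W / h + 1 :=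
  (Nat.ceil_lt_add_one (by positivity)).le

lemma longRun_mul_le (hν : 0 < ν) (hh : 0 < h) {x : ℝ} (hx : 0 ≤ x) :
    longRun ν h x * h ≤ 2 / ν * x + h := by
  have h1 : (longRun ν h x : ℝ) ≤ 2 * x / (ν * h) + 1 :=
    (Nat.ceil_lt_add_one (by positivity)).le
  refine (mul_le_mul_of_nonneg_right h1 hh.le).trans (le_of_eq ?_)
  field_simp

lemma eventually_blockCount_mul_le (hν : 0 < ν) (hh : 0 < h) (hW : 0 ≤ W) (hθ : 0 ≤ θ)
    (hθ1 : θ < 1) : ∀ᶠ x in atTop, blockCount θ x * shortRun ν h W θ x ≤ cellCount h x := by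
  have h1 := (tendsto_linear_pow_mul_exp_neg (θ / (ν * h)) (W / h + 1) 1
    (a := 1 - (1 + θ) / 2) (by linarith)).add (tendsto_exp_neg_mul one_pos)
  rw [add_zero] at h1
  filter_upwards [h1.eventually_le_const (show (0 : ℝ) < 1 / h by positivity),
    eventually_ge_atTop 0] with x hx hx0
  refine Nat.le_floor ?_
  push_cast
  have hT : (blockCount θ x : ℝ) ≤ Real.exp ((1 + θ) / 2 * x) := Nat.floor_le (Real.exp_pos _).le
  have hr := shortRun_le hν hh hW hθ hx0
  refine (mul_le_mul hT hr (Nat.cast_nonneg _) (Real.exp_pos _).le).trans ?_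
  have h2 := mul_le_mul_of_nonneg_left hx (Real.exp_pos x).le
  have h3 : Real.exp x * Real.exp (-((1 - (1 + θ) / 2) * x)) = Real.exp ((1 + θ) / 2 * x) := by
    rw [← Real.exp_add]
    congr 1
    ring
  have h4 : 0 ≤ Real.exp x * Real.exp (-(1 * x)) := by positivity
  rw [mul_add, mul_left_comm, h3, pow_one, mul_one_div] at h2
  refine le_trans (le_of_eq ?_) ((le_add_of_nonneg_right h4).trans h2)
  ring

lemma tendsto_errorBound (hν : 0 < ν) (hh : 0 < h) (hW : 0 ≤ W) (hθ : 0 < θ) (hθ1 : θ < 1) :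
    Tendsto (errorBound ν h W θ) atTop (𝓝 0) := by
  set p := Real.exp (-(ν * h)) with hp
  have hp0 : 0 < p := Real.exp_pos _
  have hp1 : p < 1 := Real.exp_lt_one_iff.mpr (by have := mul_pos hν hh; linarith)
  have hνh := mul_pos hν hh
  have t1 : Tendsto (fun x => 2 * p ^ (shortRun ν h W θ x / 2)) atTop (𝓝 0) := by
    have h1 : Tendsto (fun x => shortRun ν h W θ x / 2) atTop atTop := by
      refine (Nat.tendsto_div_const_atTop two_ne_zero).comp ?_
      refine tendsto_nat_ceil_atTop.comp (tendsto_atTop_add_const_right _ _ ?_)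
      exact (tendsto_id.const_mul_atTop hθ).atTop_div_const hνh
    simpa using ((tendsto_pow_atTop_nhds_zero_of_lt_one hp0.le hp1).comp h1).const_mul 2
  have t2 : Tendsto (fun x => ((cellCount h x : ℝ) + 1) * p ^ longRun ν h x) atTop (𝓝 0) := by
    have h1 := ((tendsto_exp_neg_mul one_pos).const_mul (1 / h)).add
      (tendsto_exp_neg_mul two_pos)
    rw [mul_zero, add_zero] at h1
    refine squeeze_zero (fun x => by positivity) (fun x => ?_) h1
    have h2 : (cellCount h x : ℝ) ≤ Real.exp x / h := Nat.floor_le (by positivity)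
    have h3 : p ^ longRun ν h x ≤ Real.exp (-(2 * x)) := by
      rw [hp, ← Real.exp_nat_mul, Real.exp_le_exp]
      have := mul_le_mul_of_nonneg_right (Nat.le_ceil (2 * x / (ν * h))) hνh.le
      rw [div_mul_cancel₀ _ hνh.ne'] at this
      unfold longRun
      linarith
    refine (mul_le_mul (add_le_add_left h2 1) h3 (by positivity) (by positivity)).trans
      (le_of_eq ?_)
    have h4 : Real.exp x * Real.exp (-(2 * x)) = Real.exp (-(1 * x)) := by
      rw [← Real.exp_add]
      congr 1
      ring
    rw [add_mul, one_mul, div_mul_eq_mul_div, h4]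
    ring
  have t3 : Tendsto (fun x => Real.exp (-(blockCount θ x * p ^ shortRun ν h W θ x))) atTop
      (𝓝 0) := by
    refine Real.tendsto_exp_atBot.comp (tendsto_neg_atTop_atBot.comp ?_)
    set c := Real.exp (-(ν * (W + h))) with hc
    have h1 : Tendsto (fun x => c * (Real.exp ((1 - θ) / 2 * x) + -Real.exp (-(θ * x)))) atTop
        atTop := by
      refine Tendsto.const_mul_atTop (Real.exp_pos _) ?_
      refine (Real.tendsto_exp_atTop.comp
        (tendsto_id.const_mul_atTop (by linarith))).atTop_add (tendsto_exp_neg_mul hθ).neg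
    refine tendsto_atTop_mono' _ ?_ h1
    filter_upwards [eventually_ge_atTop 0] with x hx
    have h2 : Real.exp ((1 + θ) / 2 * x) - 1 ≤ blockCount θ x := by
      have := Nat.lt_floor_add_one (Real.exp ((1 + θ) / 2 * x))
      unfold blockCount
      linarith
    have h3 : c * Real.exp (-(θ * x)) ≤ p ^ shortRun ν h W θ x := by
      rw [hp, hc, ← Real.exp_nat_mul, ← Real.exp_add, Real.exp_le_exp]
      have := mul_le_mul_of_nonneg_right (shortRun_le hν hh hW hθ.le hx) hνh.le
      have e : (θ * x / (ν * h) + W / h + 1) * (ν * h) = θ * x + ν * (W + h) := by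
        field_simp
        ring
      rw [e] at this
      linarith
    have h4 : Real.exp ((1 - θ) / 2 * x) =
        Real.exp ((1 + θ) / 2 * x) * Real.exp (-(θ * x)) := by
      rw [← Real.exp_add]
      congr 1
      ring
    have h5 : 0 ≤ Real.exp ((1 + θ) / 2 * x) - 1 := by
      have : 0 ≤ (1 + θ) / 2 * x := by positivity
      linarith [Real.one_le_exp this]
    have h6 := mul_le_mul h2 h3 (by positivity) (Nat.cast_nonneg _)
    refine le_trans (le_of_eq ?_) h6
    rw [h4]
    ring
  have := (t1.add t2).add t3
  rw [add_zero, add_zero] at this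
  exact this

end asymptotics

section typical

variable {Ω : Type*} [MeasurableSpace Ω] {P : Measure Ω} [IsProbabilityMeasure P] {ν : ℝ}
  {M : Ω → Measure ℝ} {u : ℝ → ℝ} {Cl Cr h w m s₁ s₂ r₁ r₂ : ℝ}

/-- In a large box the gap event has, up to a small error, at least the probability that fewer than
`j` runs of empty cells come within `D` cells of the longest one. -/
lemma IsMassPair.eventually_measure_le (H : IsMassPair u h w m s₁ s₂ r₁ r₂)
    (hu : IsSingleSitePotential u Cl Cr) (hM : IsPoissonRandomMeasure P ν M) (hν : 0 < ν)
    {D j : ℕ} {δ : ℝ} (hδ : 0 < δ)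
    (hD : δ + (r₂ + h - r₁ + m⁻¹) + (s₂ + h - s₁ + m⁻¹) + (Cl + s₁) + (Cr - r₂) ≤ D * h)
    {ρ ζ₁ ζ₂ : ℝ} (hρ : 0 < ρ) (hζ₂ : 0 < ζ₂) (hζ₁ : ζ₁ < 1) :
    ∀ᶠ x in atTop,
      P {ω | (longRuns (cellCount h x)
        (occupied (M ω) (Real.exp x) h (cellCount h x)) D).card < j} ≤
      P {ω | (ρ * Real.exp x) ^ (-1 + ζ₁) ≤ eigenvalue (Real.exp x) (potential u M ω) j -
          eigenvalue (Real.exp x) (potential u M ω) 1 ∧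
        eigenvalue (Real.exp x) (potential u M ω) 1 ≤ ((1 + ζ₂) * (ν * Real.pi / x)) ^ 2} +
      ENNReal.ofReal (errorBound ν h (Cl + Cr) (1 + ζ₂)⁻¹ x) := by
  have hh := H.cell_pos
  have hW : 0 ≤ Cl + Cr := add_nonneg hu.left_pos.le hu.right_pos.le
  set θ := (1 + ζ₂)⁻¹ with hθdef
  have hθ : 0 < θ := by positivity
  have hθ1 : θ < 1 := inv_lt_one_of_one_lt₀ (by linarith)
  have hlin : Tendsto (fun x => θ * x / ν) atTop atTop :=
    (tendsto_id.const_mul_atTop hθ).atTop_div_const hν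
  have hgap := tendsto_linear_pow_mul_exp_neg (2 / ν) h 3 (a := 1 - ζ₁) (by linarith)
  have hpi := Real.pi_pos
  filter_upwards [eventually_blockCount_mul_le hν hh hW hθ.le hθ1, eventually_gt_atTop 0,
    hgap.eventually_le_const (show 0 < Real.pi ^ 2 * δ * ρ ^ (1 - ζ₁) by positivity),
    hlin.eventually_ge_atTop (4 * h + 4 * w + 2 * (Cl + Cr) +
      2 * ((r₂ + h - r₁ + m⁻¹) + (s₂ + h - s₁ + m⁻¹) + δ)),
    hlin.eventually_ge_atTop ((δ ^ 2 + (4 * w + m⁻¹) * (4 * w) * Real.pi ^ 2) / δ)]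
    with x hx1 hx0 hx2 hx3 hx4
  set n := cellCount h x with hn
  set a := shortRun ν h (Cl + Cr) θ x with ha
  set b := longRun ν h x with hb
  have hah : θ * x / ν + (Cl + Cr) ≤ a * h := le_shortRun hν hh x
  have hbh : (b : ℝ) * h ≤ 2 / ν * x + h := longRun_mul_le hν hh hx0.le
  have hbad := hM.measure_bad_le (L := Real.exp x) (n := n) hh.le (a / 2) b
  have hshort := hM.measure_forall_run_lt_le (L := Real.exp x) (n := n) hν.le hh.le (r := a) hx1
  set Bad := {ω | a / 2 ≤ run n (occupied (M ω) (Real.exp x) h n) 0 ∨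
      (∃ i ∈ insert 0 (occupied (M ω) (Real.exp x) h n),
        i + run n (occupied (M ω) (Real.exp x) h n) i = n ∧
        a / 2 ≤ run n (occupied (M ω) (Real.exp x) h n) i) ∨
      ∃ i ∈ insert 0 (occupied (M ω) (Real.exp x) h n),
        b ≤ run n (occupied (M ω) (Real.exp x) h n) i} with hBad
  set Short := {ω | ∀ i ∈ insert 0 (occupied (M ω) (Real.exp x) h n),
    run n (occupied (M ω) (Real.exp x) h n) i < a} with hShort
  set G := {ω | (ρ * Real.exp x) ^ (-1 + ζ₁) ≤ eigenvalue (Real.exp x) (potential u M ω) j -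
          eigenvalue (Real.exp x) (potential u M ω) 1 ∧
        eigenvalue (Real.exp x) (potential u M ω) 1 ≤ ((1 + ζ₂) * (ν * Real.pi / x)) ^ 2} with hG
  have hnat : ∀ᵐ ω ∂P, ∀ k : ℕ, ∃ l : ℕ,
      M ω (Ico (cellPos (Real.exp x) h k) (cellPos (Real.exp x) h (k + 1))) = l :=
    ae_all_iff.mpr fun k => hM.ae_exists_nat hν measurableSet_Ico (Metric.isBounded_Ico _ _)
  have hsub : ∀ᵐ ω ∂P,
      ω ∈ {ω | (longRuns n (occupied (M ω) (Real.exp x) h n) D).card < j} →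
        ω ∈ G ∪ (Bad ∪ Short) := by
    filter_upwards [hnat, hM.ae_isLocallyFiniteMeasure hν] with ω hω hlf hj
    by_contra hnot
    simp only [mem_union, not_or] at hnot
    obtain ⟨hnG, hnB, hnS⟩ := hnot
    simp only [hBad, mem_ofPred_eq, not_or, not_exists, not_and, not_le] at hnB
    simp only [hShort, mem_ofPred_eq, not_forall, not_lt] at hnS
    obtain ⟨hB1, hB2, hB3⟩ := hnB
    obtain ⟨i, hi, hai⟩ := hnS
    have key := H.eigenvalue_gap (n := n) hu hω (Real.exp_pos x) (cellCount_mul_le hh x)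
      (exp_le_cellCount hh x) rfl (a := a) (b := b) (D := D) (j := j) ⟨i, hi, hai⟩
      (fun k hk => (hB3 k hk).le) (by omega) (fun k hk hkn => by
        have := hB2 k hk hkn
        omega) hδ hD (by linarith) (by
        rw [mul_comm δ, ← div_le_iff₀ hδ]
        linarith) hj
    refine hnG ⟨le_trans ?_ key.2, key.1.trans ?_⟩
    · have hb0 : 0 < (b : ℝ) * h := by
        refine mul_pos ?_ hh
        exact_mod_cast (Nat.zero_le _).trans_lt (hB3 0 (Finset.mem_insert_self _ _))
      rw [le_div_iff₀ (by positivity), Real.mul_rpow hρ.le (Real.exp_pos x).le, ← Real.exp_mul]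
      have h1 : ((b : ℝ) * h) ^ 3 ≤ (2 / ν * x + h) ^ 3 := pow_le_pow_left₀ hb0.le hbh 3
      have h2 := mul_le_mul_of_nonneg_right h1 (Real.exp_pos (-((1 - ζ₁) * x))).le
      have h3 := mul_le_mul_of_nonneg_left (h2.trans hx2)
        (Real.rpow_pos_of_pos hρ (-1 + ζ₁)).le
      have h4 : ρ ^ (-1 + ζ₁) * (Real.pi ^ 2 * δ * ρ ^ (1 - ζ₁)) = Real.pi ^ 2 * δ := by
        rw [mul_left_comm, ← Real.rpow_add hρ]
        simp
      rw [h4] at h3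
      refine le_trans (le_of_eq ?_) h3
      rw [show x * (-1 + ζ₁) = -((1 - ζ₁) * x) by ring]
      ring
    · have h1 : 0 < θ * x / ν := by positivity
      have h2 : (1 + ζ₂) * (ν * Real.pi / x) = Real.pi / (θ * x / ν) := by
        rw [hθdef]
        field_simp
      rw [h2]
      refine pow_le_pow_left₀ (div_nonneg hpi.le (by linarith)) ?_ 2
      exact div_le_div_of_nonneg_left hpi.le h1 (by linarith)
  refine (measure_mono_ae hsub).trans ((measure_union_le _ _).trans
    (add_le_add_right ((measure_union_le _ _).trans ((add_le_add hbad hshort).trans_eq ?_)) _))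
  rw [← ENNReal.ofReal_add (by positivity) (by positivity)]
  rfl

/-- The probability of the gap event is asymptotically bounded from below by any lower bound for the
probability that fewer than `j` runs of empty cells come within `D` cells of the longest one. -/
lemma IsMassPair.le_liminf_measure_gapEvent (H : IsMassPair u h w m s₁ s₂ r₁ r₂)
    (hu : IsSingleSitePotential u Cl Cr) (hM : IsPoissonRandomMeasure P ν M) (hν : 0 < ν)
    {D j : ℕ} {δ : ℝ} (hδ : 0 < δ)
    (hD : δ + (r₂ + h - r₁ + m⁻¹) + (s₂ + h - s₁ + m⁻¹) + (Cl + s₁) + (Cr - r₂) ≤ D * h)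
    {ρ ζ₁ ζ₂ : ℝ} (hρ : 0 < ρ) (hζ₂ : 0 < ζ₂) (hζ₁ : ζ₁ < 1) {q : ℝ}
    (hq : ∀ n, D ≤ n → q ≤ ∑ O ∈ (Finset.Icc 1 n).powerset with (longRuns n O D).card < j,
      weight (Real.exp (-(ν * h))) n O) :
    ENNReal.ofReal q ≤
      liminf (fun N : ℕ => P (gapEvent ν ρ (potential u M) j ζ₁ ζ₂ N)) atTop := by
  have hh := H.cell_pos
  have hW : 0 ≤ Cl + Cr := add_nonneg hu.left_pos.le hu.right_pos.le
  have hθ : 0 < (1 + ζ₂)⁻¹ := by positivity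
  have hθ1 : (1 + ζ₂)⁻¹ < 1 := inv_lt_one_of_one_lt₀ (by linarith)
  have hlog : Tendsto (fun N : ℕ => Real.log (N / ρ)) atTop atTop :=
    Real.tendsto_log_atTop.comp (tendsto_natCast_atTop_atTop.atTop_div_const hρ)
  have herr := (tendsto_errorBound hν hh hW hθ hθ1).comp hlog
  have hcount : Tendsto (fun x => cellCount h x) atTop atTop :=
    tendsto_nat_floor_atTop.comp (Real.tendsto_exp_atTop.atTop_div_const hh)
  have hlim : Tendsto (fun N : ℕ => ENNReal.ofReal
      (q - errorBound ν h (Cl + Cr) (1 + ζ₂)⁻¹ (Real.log (N / ρ)))) atTop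
      (𝓝 (ENNReal.ofReal q)) := by
    have := ENNReal.tendsto_ofReal (herr.const_sub q)
    rwa [sub_zero] at this
  rw [← hlim.liminf_eq]
  refine liminf_le_liminf ?_
  filter_upwards [hlog.eventually (H.eventually_measure_le hu hM hν (j := j) hδ hD hρ hζ₂ hζ₁),
    hlog.eventually (hcount.eventually_ge_atTop D), eventually_gt_atTop 0] with N hN hND hN0
  have hNρ : 0 < (N : ℝ) / ρ := div_pos (by exact_mod_cast hN0) hρ
  rw [Real.exp_log hNρ, mul_div_cancel₀ _ hρ.ne',
    hM.measure_occupied (L := N / ρ) (n := cellCount h (Real.log (N / ρ))) hν.le hh.le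
      (fun O => (longRuns (cellCount h (Real.log (N / ρ))) O D).card < j)] at hN
  have herr0 : 0 ≤ errorBound ν h (Cl + Cr) (1 + ζ₂)⁻¹ (Real.log (N / ρ)) := by
    unfold errorBound
    positivity
  rw [ENNReal.ofReal_sub _ herr0, tsub_le_iff_right]
  exact (ENNReal.ofReal_le_ofReal (hq _ hND)).trans hN

end typical

/-! ### Mass pairs of single-site potentials -/

lemma IsSingleSitePotential.integral_pos {u : ℝ → ℝ} {Cl Cr : ℝ}
    (hu : IsSingleSitePotential u Cl Cr) {a b : ℝ} (hab : a < b) (h : ∀ x ∈ Ioo a b, u x ≠ 0) :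
    0 < ∫ x in a..b, u x :=
  intervalIntegral.intervalIntegral_pos_of_pos_on (hu.intervalIntegrable a b)
    (fun x hx => (hu.nonneg x).lt_of_ne' (h x hx)) hab

lemma IsSingleSitePotential.exists_isMassPair {u : ℝ → ℝ} {Cl Cr : ℝ}
    (hu : IsSingleSitePotential u Cl Cr) :
    ∃ h w m s₁ s₂ r₁ r₂, IsMassPair u h w m s₁ s₂ r₁ r₂ := by
  obtain ⟨U, hU, ⟨t, ht⟩, hne⟩ := hu.nonzero
  obtain ⟨η, hη, hball⟩ := Metric.isOpen_iff.mp hU t ht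
  have hpos : ∀ x, t - η < x → x < t + η → u x ≠ 0 := fun x h1 h2 => hne x (hball (by
    rw [Metric.mem_ball, Real.dist_eq, abs_lt]
    exact ⟨by linarith, by linarith⟩))
  have h1 := hu.integral_pos (a := t - η / 2) (b := t - η / 4) (by linarith) fun x hx =>
    hpos x (by linarith [hx.1]) (by linarith [hx.2])
  have h2 := hu.integral_pos (a := t) (b := t + η / 2) (by linarith) fun x hx =>
    hpos x (by linarith [hx.1]) (by linarith [hx.2])
  refine ⟨η / 4, |t| + η, min (∫ x in (t - η / 2)..(t - η / 4), u x) (∫ x in t..(t + η / 2), u x),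
    t - η / 2, t - η / 4, t, t + η / 2, by linarith, lt_min h1 h2, by positivity, ?_, by linarith,
    by linarith, by linarith, ?_, min_le_left _ _, min_le_right _ _⟩
  · linarith [neg_abs_le t]
  · linarith [le_abs_self t]

section conclusion

variable {Ω : Type*} [MeasurableSpace Ω] {P : Measure Ω} [IsProbabilityMeasure P] {ν ρ : ℝ}
  {M : Ω → Measure ℝ} {u : ℝ → ℝ} {Cl Cr : ℝ}

/-! ### The two bounds -/

/-- Any mass pair will do; the number of long runs is bounded by Markov's inequality. -/
lemma exists_le_liminf_measure_gapEvent (hν : 0 < ν) (hρ : 0 < ρ)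
    (hM : IsPoissonRandomMeasure P ν M) (hu : IsSingleSitePotential u Cl Cr)
    {ε : ℝ} (hε : 0 < ε) :
    ∃ j : ℕ, 2 ≤ j ∧ ∀ ζ₁ ζ₂ : ℝ, 0 < ζ₂ → ζ₁ < 1 →
      ENNReal.ofReal (1 - ε) ≤
        liminf (fun N : ℕ => P (gapEvent ν ρ (potential u M) j ζ₁ ζ₂ N)) atTop := by
  obtain ⟨h, w, m, s₁, s₂, r₁, r₂, H⟩ := hu.exists_isMassPair
  have hh := H.cell_pos
  set p := Real.exp (-(ν * h)) with hp
  have hp0 : 0 < p := Real.exp_pos _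
  have hp1 : p ≤ 1 := Real.exp_le_one_iff.mpr (by have := mul_pos hν hh; linarith)
  obtain ⟨D, hD⟩ := exists_nat_ge
    ((1 + (r₂ + h - r₁ + m⁻¹) + (s₂ + h - s₁ + m⁻¹) + (Cl + s₁) + (Cr - r₂)) / h)
  rw [div_le_iff₀ hh] at hD
  obtain ⟨j, hj⟩ := exists_nat_ge ((p ^ D)⁻¹ / ε)
  rw [div_le_iff₀ hε] at hj
  refine ⟨j + 2, by omega, fun ζ₁ ζ₂ hζ₂ hζ₁ => ?_⟩
  refine H.le_liminf_measure_gapEvent hu hM hν one_pos hD hρ hζ₂ hζ₁ fun n _ => ?_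
  have h1 := sum_weight_le_card_longRuns hp0 hp1 n D (j + 2)
  have h2 := sum_weight p n
  rw [← Finset.sum_filter_add_sum_filter_not _ (fun O => (longRuns n O D).card < j + 2)] at h2
  simp only [not_lt] at h2
  rw [← Finset.sum_mul] at h1
  set S := ∑ O ∈ (Finset.Icc 1 n).powerset with j + 2 ≤ (longRuns n O D).card, weight p n O
  push_cast at h1
  have hj2 : (0 : ℝ) < j + 2 := by positivity
  have h3 : S ≤ ε := le_of_mul_le_mul_right (by linarith) hj2
  linarith

/-- Here the mass pair lies at the ends of the support of `u`, and the longest run is ahead of all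
others by `⌊c / h⌋` cells with probability at least `exp (-(ν * c))`. A lead of a little
more than `a + b + 4 / m` in length suffices, half of the mass `m` being given away for the sake of
the cell length. -/
lemma exp_le_liminf_measure_gapEvent (hν : 0 < ν) (hρ : 0 < ρ)
    (hM : IsPoissonRandomMeasure P ν M) (hu : IsSingleSitePotential u Cl Cr) {a b c m : ℝ}
    (ha : 0 < a) (haC : a ≤ Cr) (hb : 0 < b) (hbC : b ≤ Cl) (hm : 0 < m)
    (hm₁ : m ≤ ∫ x in (Cr - a)..Cr, u x) (hm₂ : m ≤ ∫ x in (-Cl)..(-Cl + b), u x)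
    (hslack : a + b + 4 * m⁻¹ < c) {ζ₁ ζ₂ : ℝ} (hζ₂ : 0 < ζ₂) (hζ₁ : ζ₁ < 1) :
    ENNReal.ofReal (Real.exp (-(ν * c))) ≤
      liminf (fun N : ℕ => P (gapEvent ν ρ (potential u M) 2 ζ₁ ζ₂ N)) atTop := by
  have hm' := inv_pos.mpr hm
  have hc : 0 < c := by linarith
  have hslack := sub_pos.mpr hslack
  obtain ⟨K, hK⟩ := hu.bounded
  have hK0 : 0 ≤ K := (hu.nonneg 0).trans (hK 0)
  -- `h` is small enough to shorten the right interval without losing half of its mass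
  obtain ⟨h, hh, hhlt⟩ : ∃ h : ℝ, 0 < h ∧
      h < min a (min (m / (2 * (K + 1))) ((c - (a + b + 4 * m⁻¹)) / 3)) :=
    exists_between (lt_min ha (lt_min (by positivity) (by positivity)))
  obtain ⟨hha, hhlt⟩ := lt_min_iff.mp hhlt
  obtain ⟨hhm, hhc⟩ := lt_min_iff.mp hhlt
  rw [lt_div_iff₀ (by positivity)] at hhm
  have H : IsMassPair u h (Cl + Cr + h) (m / 2) (-Cl) (-Cl + b) (Cr - a + h) Cr := by
    have hCl := hu.left_pos
    have hCr := hu.right_pos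
    refine ⟨hh, by positivity, by positivity, by linarith, by linarith, by linarith,
      by linarith, by linarith, ?_, ?_⟩
    · linarith
    · have e := intervalIntegral.integral_add_adjacent_intervals
        (hu.intervalIntegrable (Cr - a) (Cr - a + h)) (hu.intervalIntegrable (Cr - a + h) Cr)
      have h3 : ∫ x in (Cr - a)..(Cr - a + h), u x ≤ K * h := by
        have := intervalIntegral.integral_mono_on (show Cr - a ≤ Cr - a + h by linarith)
          (hu.intervalIntegrable _ _) (intervalIntegrable_const (c := K)) fun x _ => hK x
        rw [intervalIntegral.integral_const, add_sub_cancel_left, smul_eq_mul] at this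
        linarith
      linarith
  set p := Real.exp (-(ν * h)) with hp
  have hp0 : 0 < p := Real.exp_pos _
  have hp1 : p ≤ 1 := Real.exp_le_one_iff.mpr (by have := mul_pos hν hh; linarith)
  set D := ⌊c / h⌋₊ with hDdef
  have hDle : (D : ℝ) * h ≤ c := by
    rw [← le_div_iff₀ hh]
    exact Nat.floor_le (by positivity)
  have hleD : c ≤ D * h + h := by
    have := (Nat.lt_floor_add_one (c / h)).le
    rw [div_le_iff₀ hh] at this
    linarith
  have hD0 : 0 < D := by
    refine Nat.floor_pos.mpr ?_
    rw [le_div_iff₀ hh]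
    linarith
  have hinv : (m / 2)⁻¹ = 2 * m⁻¹ := by
    rw [inv_div, div_eq_mul_inv]
  refine H.le_liminf_measure_gapEvent hu hM hν (D := D) (δ := h) hh (by rw [hinv]; linarith) hρ
    hζ₂ hζ₁ fun n hn => ?_
  obtain ⟨k, rfl⟩ := Nat.exists_eq_add_of_le' hn
  have h4 : Real.exp (-(ν * c)) ≤ p ^ D := by
    rw [hp, ← Real.exp_nat_mul, Real.exp_le_exp]
    have := mul_le_mul_of_nonneg_left hDle hν.le
    linarith
  have h5 := le_sum_weight_card_longRuns_le_one hp0.le hp1 k hD0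
  simp only [← Nat.lt_succ_iff] at h5
  exact h4.trans h5

end conclusion

end PoissonBEC
end

theorem theorem5p4 {Ω : Type*} [MeasurableSpace Ω] (P : Measure Ω) [IsProbabilityMeasure P]
    (ν ρ : ℝ) (hν : 0 < ν) (hρ : 0 < ρ)
    (M : Ω → Measure ℝ) (hM : PoissonBEC.IsPoissonRandomMeasure P ν M)
    (u : ℝ → ℝ) (Cl Cr : ℝ) (hu : PoissonBEC.IsSingleSitePotential u Cl Cr) :
    (∀ ε : ℝ, 0 < ε → ∃ j : ℕ, 2 ≤ j ∧ ∀ ζ₁ ζ₂ : ℝ, 0 < ζ₂ → ζ₂ < ζ₁ → ζ₁ < 1 →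
      ENNReal.ofReal (1 - ε) ≤ liminf (fun N : ℕ =>
        P (PoissonBEC.gapEvent ν ρ (PoissonBEC.potential u M) j ζ₁ ζ₂ N)) atTop) ∧
    (∀ a b c : ℝ, 0 < a → a ≤ Cr → 0 < b → b ≤ Cl → 0 < c →
      0 < min (∫ x in (Cr - a)..Cr, u x) (∫ x in (-Cl)..(-Cl + b), u x) →
      max (2 * (a + b)) (16 * (8 * Real.pi + 1) ^ 2 /
        min (∫ x in (Cr - a)..Cr, u x) (∫ x in (-Cl)..(-Cl + b), u x)) < c →
      ∀ ζ₁ ζ₂ : ℝ, 0 < ζ₂ → ζ₂ < ζ₁ → ζ₁ < 1 →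
        ENNReal.ofReal (Real.exp (-(ν * c))) ≤ liminf (fun N : ℕ =>
          P (PoissonBEC.gapEvent ν ρ (PoissonBEC.potential u M) 2 ζ₁ ζ₂ N)) atTop) := by
  refine ⟨fun ε hε => ?_, fun a b c ha haC hb hbC _ hm hmax ζ₁ ζ₂ hζ₂ _ hζ₁ => ?_⟩
  · obtain ⟨j, hj, H⟩ := PoissonBEC.exists_le_liminf_measure_gapEvent hν hρ hM hu hε
    exact ⟨j, hj, fun ζ₁ ζ₂ hζ₂ _ hζ₁ => H ζ₁ ζ₂ hζ₂ hζ₁⟩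
  · obtain ⟨h1, h2⟩ := max_lt_iff.mp hmax
    refine PoissonBEC.exp_le_liminf_measure_gapEvent hν hρ hM hu ha haC hb hbC hm (min_le_left _ _)
      (min_le_right _ _) ?_ hζ₂ hζ₁
    have h3 := inv_pos.mpr hm
    rw [div_eq_mul_inv] at h2
    have h4 : (1 : ℝ) ≤ (8 * Real.pi + 1) ^ 2 := one_le_pow₀ (by linarith [Real.pi_pos])
    have h5 := mul_le_mul_of_nonneg_right h4 h3.le
    linarith
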